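/- Let $k\ge 1$ bins, numbered clockwise around a ring, have capacity $C$ each, and place $n\le kC$ objects one after the other into the initially empty bins. Each object is first hashed to a bin chosen uniformly at random, independently of everything else, and is put there if that bin is not full (a bin is full if it contains $C$ objects). If the bin is full, then under CH-BL (consistent hashing with bounded loads) the object goes to the nearest non-full bin in the clockwise direction, while under RJ-CH (random jump consistent hashing) the object is rehashed, each time to a fresh independent uniformly random bin, until it reaches a non-full bin. Let $X_i^{(CH-BL)}$ and $X_i^{(RJ-CH)}$ be the final number of objects in bin $i$, and let $L^{(CH-BL)}$ and $L^{(RJ-CH)}$ be the final number of full bins, under the two methods. Then for every $i=1,\dots,k$ and every real $d\ge 1$, $$E\big[(X_i^{(RJ-CH)})^d\big]\le E\big[(X_i^{(CH-BL)})^d\big];$$ in particular $$E\big[(X_i^{(RJ-CH)})^2\big]\le E\big[(X_i^{(CH-BL)})^2\big]\quad\text{and}\quad \operatorname{var}\big(X_i^{(RJ-CH)}\big)\le \operatorname{var}\big(X_i^{(CH-BL)}\big).$$ Moreover, $$E\big(L^{(RJ-CH)}\big)\le E\big(L^{(CH-BL)}\big).$$ -/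

import Mathlib

open MeasureTheory ProbabilityTheory

/-- Insert one object: it probes the bins `p 0, p 1, p 2, …` in this order and is put into the
first one whose load is below the capacity `C`.  (If no probed bin is available, then the object
is not placed.  When some bin is available this never happens under clockwise probing, and has
probability zero under independent uniform probing.) -/
noncomputable def placeObject {k : ℕ} (C : ℕ) (load : Fin k → ℕ) (p : ℕ → Fin k) : Fin k → ℕ :=
  open Classical in
  if hp : ∃ t, load (p t) < C then
    Function.update load (p (Nat.find hp)) (load (p (Nat.find hp)) + 1)
  else load

/-- The loads of the bins (initially empty) after `n` objects have been inserted one after the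
other, where object number `j` probes the bins in the order `p j 0, p j 1, …`. -/
noncomputable def finalLoad {k : ℕ} (C : ℕ) : (n : ℕ) → (Fin n → ℕ → Fin k) → Fin k → ℕ
  | 0, _ => fun _ => 0
  | n + 1, p => placeObject C (finalLoad C n fun j => p j.castSucc) (p (Fin.last n))

/-- CH-BL: object `j` is hashed to the bin `h j 0`; overflow goes to the nearest clockwise non-full
bin, i.e. the bins are probed in the cyclic order starting at `h j 0`. -/
noncomputable def loadCHBL {k : ℕ} [NeZero k] (C n : ℕ) (h : Fin n → ℕ → Fin k) : Fin k → ℕ :=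
  finalLoad C n fun j t => h j 0 + Fin.ofNat k t

/-- RJ-CH: object `j` is hashed to the bin `h j 0`; as long as it meets a full bin it is rehashed,
the bin reached after `t` failed attempts being `h j t`. -/
noncomputable def loadRJCH {k : ℕ} (C n : ℕ) (h : Fin n → ℕ → Fin k) : Fin k → ℕ :=
  finalLoad C n h

/-- The number of full bins. -/
def numFull {k : ℕ} (C : ℕ) (load : Fin k → ℕ) : ℕ :=
  (Finset.univ.filter fun i => load i = C).card

/-- The law of the hash values: `h j t` (object `j`, number `t` of failed attempts) are independent
and uniformly distributed over the `k` bins. -/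
noncomputable def hashLaw (k n : ℕ) [NeZero k] : Measure (Fin n → ℕ → Fin k) :=
  Measure.pi fun _ => Measure.infinitePi fun _ => (PMF.uniformOfFintype (Fin k)).toMeasure

/-- Loads never exceed the capacity. -/
theorem finalLoad_le {k : ℕ} (C : ℕ) : ∀ (n : ℕ) (p : Fin n → ℕ → Fin k) (i : Fin k),
    finalLoad C n p i ≤ C
  | 0, _, _ => Nat.zero_le _
  | n + 1, p, i => by
    have ih := finalLoad_le C n fun j => p j.castSucc
    simp only [finalLoad, placeObject]
    split_ifs with hp
    · have h := Nat.find_spec hp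
      rw [Function.update_apply]
      split_ifs
      · omega
      · exact ih i
    · exact ih i

theorem measurable_placeObject {k : ℕ} (C : ℕ) :
    Measurable fun x : (Fin k → ℕ) × (ℕ → Fin k) => placeObject C x.1 x.2 := by
  refine measurable_from_prod_countable_right fun load => ?_
  have hpr : ∀ t : ℕ, MeasurableSet {p : ℕ → Fin k | load (p t) < C} := fun t =>
    measurableSet_preimage (measurable_pi_apply (X := fun _ : ℕ => Fin k) t)
      (MeasurableSet.of_discrete (s := {b : Fin k | load b < C}))
  refine measurable_to_countable' fun y => ?_
  have : (fun p : ℕ → Fin k => placeObject C load p) ⁻¹' {y} =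
      (⋃ t : ℕ, ({p | load (p t) < C} ∩ ⋂ s : ℕ, ⋂ _ : s < t, {p | load (p s) < C}ᶜ) ∩
        {p | Function.update load (p t) (load (p t) + 1) = y}) ∪
      ((⋂ t : ℕ, {p | load (p t) < C}ᶜ) ∩ {_p | load = y}) := by
    classical
    ext p
    simp only [Set.mem_preimage, Set.mem_singleton_iff, placeObject, Set.mem_union, Set.mem_iUnion,
      Set.mem_inter_iff, Set.mem_iInter, Set.mem_ofPred_eq, Set.mem_compl_iff]
    split_ifs with hp
    · constructor
      · intro h
        exact Or.inl ⟨Nat.find hp, ⟨Nat.find_spec hp, fun s hs => Nat.find_min hp hs⟩, h⟩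
      · rintro (⟨t, ⟨h1, h2⟩, h3⟩ | ⟨h, -⟩)
        · have : Nat.find hp = t := (Nat.find_eq_iff hp).2 ⟨h1, fun s hs => h2 s hs⟩
          rw [this]
          exact h3
        · exact absurd hp (not_exists.2 h)
    · constructor
      · exact fun h => Or.inr ⟨not_exists.1 hp, h⟩
      · rintro (⟨t, ⟨h1, -⟩, -⟩ | ⟨-, h⟩)
        · exact absurd ⟨t, h1⟩ hp
        · exact h
  rw [this]
  refine MeasurableSet.union (MeasurableSet.iUnion fun t => MeasurableSet.inter
    ((hpr t).inter (MeasurableSet.iInter fun s => MeasurableSet.iInter fun _ => (hpr s).compl)) ?_)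
    ((MeasurableSet.iInter fun t => (hpr t).compl).inter (MeasurableSet.const _))
  exact measurableSet_preimage (measurable_pi_apply (X := fun _ : ℕ => Fin k) t)
    (MeasurableSet.of_discrete (s := {b : Fin k | Function.update load b (load b + 1) = y}))

theorem measurable_finalLoad {k : ℕ} (C : ℕ) : ∀ n : ℕ,
    Measurable fun p : Fin n → ℕ → Fin k => finalLoad C n p
  | 0 => measurable_const
  | n + 1 => (measurable_placeObject C).comp
      (((measurable_finalLoad C n).comp
        (measurable_pi_lambda _ fun j => measurable_pi_apply j.castSucc)).prodMk
        (measurable_pi_apply (Fin.last n)))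

/-- The loads under CH-BL are random variables. -/
theorem measurable_loadCHBL {k : ℕ} [NeZero k] (C n : ℕ) :
    Measurable fun h : Fin n → ℕ → Fin k => loadCHBL C n h :=
  (measurable_finalLoad C n).comp (measurable_pi_lambda _ fun j => measurable_pi_lambda _ fun t =>
    (measurable_of_countable fun b : Fin k => b + Fin.ofNat k t).comp
      ((measurable_pi_apply 0).comp (measurable_pi_apply j)))

/-- The loads under RJ-CH are random variables. -/
theorem measurable_loadRJCH {k : ℕ} (C n : ℕ) :
    Measurable fun h : Fin n → ℕ → Fin k => loadRJCH C n h :=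
  measurable_finalLoad C n

/-! Under both rules the next object joins a random non-full bin, with probabilities depending only
on the set `S` of non-full bins: uniform on `S` for RJ-CH, and `(g i + 1) / k` for CH-BL, where `g
i` is the number of full bins directly before `i`. As long as some bin is not full, the forward
equations have solutions of product form over `S`: the weights are `1 / j!` for uniform insertion
(`law_uniformInsert`) and `blockWeight C (g i) j` for clockwise probing (`law_gapInsert`).

A convex function on `{0, …, C}` is affine plus a nonnegative combination of the deficits `(a -
x)⁺`. The total load is `n` almost surely under both rules, so it is enough to compare the means of
the summed deficits; rotation symmetry then passes from the sum to a single bin. The number of full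
bins is also a sum of a convex function of the loads. Two comparisons are needed.

Given `S`. The numbers `j! * blockWeight C l j` form a moment sequence, so a block weight behaves
like a mixture of Poisson weights `T ^ j / j!`. The inequality between mean deficits is linear in
the weights of each site, hence it need only be shown for arbitrary Poisson rates against equal ones
(`uniExp_mul_capSum_poisson_le`). Its core is `capSum_poisson_ratio_le`: if `Z` and `U` are the
partition functions of capped sites with rates `T i` and with rates `1`, and `y` is the mean of the
`T i`, then `Z s / Z (s - 1) ≤ y * (U s / U (s - 1))`. This is an induction on the number of sites,
based on a size-bias identity and on a bound for generating functions of log-concave laws. It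
implies that unequal rates put more sites at the highest admissible value, in likelihood ratio order
(`topSum_step`). For equal rates the mean deficit increases with the number of such sites
(`uniExp_top_cross`), and induction on the cap concludes.

Varying `S`. The number of full bins is stochastically smaller under uniform insertion
(`fullCount_uniform_le_gap`). Given `S`, clockwise probing completes a bin with at least the uniform
probability, for two reasons: by the first comparison more bins are one object short of full, and a
longer gap makes a bin both likelier to be one short and likelier to be hit (Chebyshev's sum
inequality).

Under uniform insertion the mean deficit given `S` is an increasing function of the number of full
bins. The second comparison applied to this function, followed by the first one on each `S`, gives
`deficit_uniform_le_gap`. -/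

/-! ### Chebyshev-type inequalities in cross-multiplied form -/

/-- Binet–Cauchy: the double sum of the products of two-by-two minors is twice the difference of the
two sides. -/
theorem sum_mul_sum_le_of_cross {ι : Type*} (s : Finset ι) (p q f g : ι → ℝ)
    (h : ∀ j ∈ s, ∀ l ∈ s, 0 ≤ (p j * q l - p l * q j) * (f j * g l - f l * g j)) :
    (∑ j ∈ s, p j * g j) * (∑ j ∈ s, q j * f j) ≤
      (∑ j ∈ s, p j * f j) * (∑ j ∈ s, q j * g j) := by
  have key : ∑ j ∈ s, ∑ l ∈ s, (p j * q l - p l * q j) * (f j * g l - f l * g j) =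
      2 * ((∑ j ∈ s, p j * f j) * (∑ j ∈ s, q j * g j)
        - (∑ j ∈ s, p j * g j) * (∑ j ∈ s, q j * f j)) := by
    have e1 : ∀ a b : ι → ℝ, ∑ j ∈ s, ∑ l ∈ s, a j * b l = (∑ j ∈ s, a j) * ∑ l ∈ s, b l :=
      fun a b => (Finset.sum_mul_sum s s a b).symm
    have e2 : ∀ j l, (p j * q l - p l * q j) * (f j * g l - f l * g j) =
        (p j * f j) * (q l * g l) - (p j * g j) * (q l * f l) - (q j * f j) * (p l * g l)
          + (q j * g j) * (p l * f l) := fun j l => by ring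
    simp only [e2, Finset.sum_add_distrib, Finset.sum_sub_distrib, e1]
    ring
  have : 0 ≤ ∑ j ∈ s, ∑ l ∈ s, (p j * q l - p l * q j) * (f j * g l - f l * g j) :=
    Finset.sum_nonneg fun j hj => Finset.sum_nonneg fun l hl => h j hj l hl
  linarith

/-- If `p / q` and `f / g` are both decreasing, the minors have equal signs. Ratios are
cross-multiplied throughout, so that vanishing entries need no separate treatment. -/
theorem sum_mul_sum_le_of_order {ι : Type*} [LinearOrder ι] (s : Finset ι) (p q f g : ι → ℝ)
    (hpq : ∀ j ∈ s, ∀ l ∈ s, j < l → p l * q j ≤ p j * q l)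
    (hfg : ∀ j ∈ s, ∀ l ∈ s, j < l → f l * g j ≤ f j * g l) :
    (∑ j ∈ s, p j * g j) * (∑ j ∈ s, q j * f j) ≤
      (∑ j ∈ s, p j * f j) * (∑ j ∈ s, q j * g j) := by
  refine sum_mul_sum_le_of_cross s p q f g fun j hj l hl => ?_
  rcases lt_trichotomy j l with h | h | h
  · exact mul_nonneg (sub_nonneg.2 (hpq j hj l hl h)) (sub_nonneg.2 (hfg j hj l hl h))
  · subst h; simp
  · have := mul_nonneg (sub_nonneg.2 (hpq l hl j hj h)) (sub_nonneg.2 (hfg l hl j hj h))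
    linarith

/-! ### Partition functions and means for capped sites with a given total -/

/-- The sum of `∏ i ∈ V, a i (x i)` over all `x : V → {0, …, C - 1}` with total `s`. -/
noncomputable def capSum {ι : Type*} (a : ι → ℕ → ℝ) (C : ℕ) (V : Finset ι) (s : ℤ) : ℝ :=
  (∏ i ∈ V, ∑ j ∈ Finset.range C, AddMonoidAlgebra.single (j : ℤ) (a i j)).coeff s

theorem coeff_sum_single_mul (b : ℕ → ℝ) (C : ℕ) (f : AddMonoidAlgebra ℝ ℤ) (s : ℤ) :
    ((∑ j ∈ Finset.range C, AddMonoidAlgebra.single (j : ℤ) (b j)) * f).coeff s =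
      ∑ j ∈ Finset.range C, b j * f.coeff (s - j) := by
  rw [Finset.sum_mul, AddMonoidAlgebra.coeff_sum, Finsupp.finsetSum_apply]
  refine Finset.sum_congr rfl fun j _ => ?_
  rw [AddMonoidAlgebra.coeff_single_mul_apply, neg_add_eq_sub]

theorem coeff_one_int (s : ℤ) :
    (1 : AddMonoidAlgebra ℝ ℤ).coeff s = if s = 0 then 1 else 0 := by
  rw [AddMonoidAlgebra.one_def, AddMonoidAlgebra.coeff_single, Finsupp.single_apply]
  simp [eq_comm]

section capSum
variable {ι : Type*} (a : ι → ℕ → ℝ) (C : ℕ)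

theorem capSum_empty (s : ℤ) : capSum a C ∅ s = if s = 0 then 1 else 0 := by
  simp [capSum, coeff_one_int]

theorem capSum_congr {a b : ι → ℕ → ℝ} {C : ℕ} {V : Finset ι}
    (h : ∀ i ∈ V, ∀ j < C, a i j = b i j) (s : ℤ) : capSum a C V s = capSum b C V s := by
  unfold capSum
  congr 1
  congr 1
  refine Finset.prod_congr rfl fun i hi => Finset.sum_congr rfl fun j hj => ?_
  rw [h i hi j (Finset.mem_range.1 hj)]

variable [DecidableEq ι]

theorem capSum_insert {V : Finset ι} {i : ι} (hi : i ∉ V) (s : ℤ) :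
    capSum a C (insert i V) s = ∑ j ∈ Finset.range C, a i j * capSum a C V (s - j) := by
  rw [capSum, Finset.prod_insert hi, coeff_sum_single_mul]
  rfl

theorem capSum_erase {V : Finset ι} {i : ι} (hi : i ∈ V) (s : ℤ) :
    capSum a C V s = ∑ j ∈ Finset.range C, a i j * capSum a C (V.erase i) (s - j) := by
  conv_lhs => rw [← Finset.insert_erase hi]
  exact capSum_insert a C (Finset.notMem_erase i V) s

theorem capSum_nonneg {a : ι → ℕ → ℝ} {C : ℕ} {V : Finset ι} (h : ∀ i ∈ V, ∀ j < C, 0 ≤ a i j) :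
    ∀ s : ℤ, 0 ≤ capSum a C V s := by
  induction V using Finset.induction_on with
  | empty => intro s; rw [capSum_empty]; split_ifs <;> norm_num
  | insert i V hi ih =>
    intro s
    rw [capSum_insert a C hi]
    refine Finset.sum_nonneg fun j hj => mul_nonneg
      (h i (Finset.mem_insert_self i V) j (Finset.mem_range.1 hj)) (ih (fun i' hi' => h i'
        (Finset.mem_insert_of_mem hi')) _)

/-- The sum of `(∑ i ∈ V, q (x i)) * ∏ i ∈ V, a i (x i)` over all `x : V → {0, …, C - 1}` with
total `s`. -/
noncomputable def capExp (q : ℕ → ℝ) (V : Finset ι) (s : ℤ) : ℝ :=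
  ∑ i ∈ V, ∑ j ∈ Finset.range C, q j * a i j * capSum a C (V.erase i) (s - j)

theorem capExp_empty (q : ℕ → ℝ) (s : ℤ) : capExp a C q ∅ s = 0 := by simp [capExp]

theorem capExp_insert (q : ℕ → ℝ) {V : Finset ι} {i : ι} (hi : i ∉ V) (s : ℤ) :
    capExp a C q (insert i V) s =
      ∑ j ∈ Finset.range C, a i j * (q j * capSum a C V (s - j) + capExp a C q V (s - j)) := by
  rw [capExp, Finset.sum_insert hi, Finset.erase_insert hi]
  have : ∀ l ∈ V, ∑ j ∈ Finset.range C, q j * a l j * capSum a C ((insert i V).erase l) (s - j) =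
      ∑ m ∈ Finset.range C, a i m *
        ∑ j ∈ Finset.range C, q j * a l j * capSum a C (V.erase l) (s - m - j) := by
    intro l hl
    have hne : i ≠ l := fun h => hi (h ▸ hl)
    rw [Finset.erase_insert_of_ne hne]
    simp_rw [Finset.mul_sum]
    rw [Finset.sum_comm]
    refine Finset.sum_congr rfl fun j _ => ?_
    rw [capSum_insert a C (fun h => hi (Finset.mem_of_mem_erase h)), Finset.mul_sum]
    refine Finset.sum_congr rfl fun m _ => ?_
    rw [sub_right_comm]
    ring
  rw [Finset.sum_congr rfl this, Finset.sum_comm, ← Finset.sum_add_distrib]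
  refine Finset.sum_congr rfl fun j _ => ?_
  rw [mul_add, capExp, Finset.mul_sum]
  ring

theorem capExp_erase (q : ℕ → ℝ) {V : Finset ι} {i : ι} (hi : i ∈ V) (s : ℤ) :
    capExp a C q V s = ∑ j ∈ Finset.range C, a i j *
      (q j * capSum a C (V.erase i) (s - j) + capExp a C q (V.erase i) (s - j)) := by
  conv_lhs => rw [← Finset.insert_erase hi]
  exact capExp_insert a C q (Finset.notMem_erase i V) s

theorem capExp_congr {a b : ι → ℕ → ℝ} {C : ℕ} {q r : ℕ → ℝ} {V : Finset ι}
    (h : ∀ i ∈ V, ∀ j < C, a i j = b i j) (hq : ∀ j < C, q j = r j) (s : ℤ) :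
    capExp a C q V s = capExp b C r V s := by
  refine Finset.sum_congr rfl fun i hi => Finset.sum_congr rfl fun j hj => ?_
  rw [h i hi j (Finset.mem_range.1 hj), hq j (Finset.mem_range.1 hj),
    capSum_congr (fun l hl => h l (Finset.mem_of_mem_erase hl))]

theorem capExp_add (q r : ℕ → ℝ) (V : Finset ι) (s : ℤ) :
    capExp a C (fun j => q j + r j) V s = capExp a C q V s + capExp a C r V s := by
  simp only [capExp, add_mul, Finset.sum_add_distrib]

theorem capExp_mul (c : ℝ) (q : ℕ → ℝ) (V : Finset ι) (s : ℤ) :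
    capExp a C (fun j => c * q j) V s = c * capExp a C q V s := by
  simp only [capExp, Finset.mul_sum, mul_assoc]

theorem capExp_const (c : ℝ) (V : Finset ι) (s : ℤ) :
    capExp a C (fun _ => c) V s = c * V.card * capSum a C V s := by
  have : ∀ i ∈ V, ∑ j ∈ Finset.range C, c * a i j * capSum a C (V.erase i) (s - j) =
      c * capSum a C V s := by
    intro i hi
    rw [capSum_erase a C hi, Finset.mul_sum]
    exact Finset.sum_congr rfl fun j _ => by ring
  rw [capExp, Finset.sum_congr rfl this, Finset.sum_const, nsmul_eq_mul]
  ring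

/-- The total is prescribed, so the sum of the values is the constant `s`. Hence means of affine
functions are explicit, and only their nonlinear part matters in comparisons. -/
theorem capExp_id (V : Finset ι) : ∀ s : ℤ,
    capExp a C (fun j => (j : ℝ)) V s = s * capSum a C V s := by
  induction V using Finset.induction_on with
  | empty =>
    intro s
    rw [capExp_empty, capSum_empty]
    split_ifs with h <;> simp [h]
  | insert i V hi ih =>
    intro s
    rw [capExp_insert a C _ hi, capSum_insert a C hi, Finset.mul_sum]
    refine Finset.sum_congr rfl fun j _ => ?_
    rw [ih]
    push_cast
    ring

theorem capExp_affine (c d : ℝ) (V : Finset ι) (s : ℤ) :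
    capExp a C (fun j => c + d * (j : ℝ)) V s = (c * V.card + d * s) * capSum a C V s := by
  rw [capExp_add a C (fun _ => c) (fun j => d * (j : ℝ)), capExp_const,
    capExp_mul a C d (fun j => (j : ℝ)), capExp_id]
  ring

theorem capExp_nonneg {a : ι → ℕ → ℝ} {C : ℕ} {q : ℕ → ℝ} {V : Finset ι}
    (h : ∀ i ∈ V, ∀ j < C, 0 ≤ a i j) (hq : ∀ j < C, 0 ≤ q j) (s : ℤ) :
    0 ≤ capExp a C q V s :=
  Finset.sum_nonneg fun i hi => Finset.sum_nonneg fun j hj =>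
    mul_nonneg (mul_nonneg (hq j (Finset.mem_range.1 hj)) (h i hi j (Finset.mem_range.1 hj)))
      (capSum_nonneg (fun l hl => h l (Finset.mem_of_mem_erase hl)) _)

end capSum

/-! ### Equal weights -/

/-- `capSum` for the weights `1 / j!` and `m` sites. -/
noncomputable def uniSum (C m : ℕ) (s : ℤ) : ℝ :=
  ((∑ j ∈ Finset.range C, AddMonoidAlgebra.single (j : ℤ) (1 / (j.factorial : ℝ))) ^ m).coeff s

/-- `capExp` for the weights `1 / j!` and `m` sites. -/
noncomputable def uniExp (C : ℕ) (q : ℕ → ℝ) (m : ℕ) (s : ℤ) : ℝ :=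
  m * ∑ j ∈ Finset.range C, q j * (1 / (j.factorial : ℝ)) * uniSum C (m - 1) (s - j)

theorem capSum_uniform {ι : Type*} (C : ℕ) (V : Finset ι) (s : ℤ) :
    capSum (fun _ j => 1 / (j.factorial : ℝ)) C V s = uniSum C V.card s := by
  rw [capSum, Finset.prod_const, uniSum]

theorem capExp_uniform {ι : Type*} [DecidableEq ι] (C : ℕ) (q : ℕ → ℝ) (V : Finset ι) (s : ℤ) :
    capExp (fun _ j => 1 / (j.factorial : ℝ)) C q V s = uniExp C q V.card s := by
  rw [capExp, uniExp, ← nsmul_eq_mul, ← Finset.sum_const]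
  refine Finset.sum_congr rfl fun i hi => ?_
  simp_rw [capSum_uniform, Finset.card_erase_of_mem hi]

theorem uniSum_zero (C : ℕ) (s : ℤ) : uniSum C 0 s = if s = 0 then 1 else 0 := by
  simp [uniSum, coeff_one_int]

theorem uniSum_succ (C m : ℕ) (s : ℤ) : uniSum C (m + 1) s =
    ∑ j ∈ Finset.range C, 1 / (j.factorial : ℝ) * uniSum C m (s - j) := by
  rw [uniSum, pow_succ', coeff_sum_single_mul]
  rfl

theorem uniSum_nonneg (C : ℕ) : ∀ (m : ℕ) (s : ℤ), 0 ≤ uniSum C m s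
  | 0, s => by rw [uniSum_zero]; split_ifs <;> norm_num
  | m + 1, s => by
    rw [uniSum_succ]
    exact Finset.sum_nonneg fun j _ => mul_nonneg (by positivity) (uniSum_nonneg C m _)

theorem uniExp_affine (C : ℕ) (c d : ℝ) (m : ℕ) (s : ℤ) :
    uniExp C (fun j => c + d * (j : ℝ)) m s = (c * m + d * s) * uniSum C m s := by
  have h := capExp_affine (fun (_ : Fin m) j => 1 / (j.factorial : ℝ)) C c d Finset.univ s
  rwa [capExp_uniform, capSum_uniform, Finset.card_univ, Fintype.card_fin] at h

theorem uniSum_pos_iff (C : ℕ) : ∀ (m : ℕ) (s : ℤ),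
    0 < uniSum (C + 1) m s ↔ 0 ≤ s ∧ s ≤ m * C
  | 0, s => by
    rw [uniSum_zero]
    split_ifs with h
    · simp [h]
    · simp only [lt_irrefl, Nat.cast_zero, zero_mul, false_iff]
      omega
  | m + 1, s => by
    rw [uniSum_succ, Finset.sum_pos_iff_of_nonneg
      (fun j _ => mul_nonneg (by positivity) (uniSum_nonneg _ m _))]
    constructor
    · rintro ⟨j, hj, h⟩
      have h' := (uniSum_pos_iff C m (s - j)).1
        (pos_of_mul_pos_right h (by positivity))
      have := Finset.mem_range.1 hj
      push_cast
      constructor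
      · omega
      · nlinarith [h'.2, (by omega : (j : ℤ) ≤ C)]
    · rintro ⟨h0, h1⟩
      push_cast at h1
      have : ∃ j : ℕ, j ≤ C ∧ 0 ≤ s - j ∧ s - j ≤ m * C := by
        by_cases hs : s ≤ C
        · refine ⟨s.toNat, by omega, by omega, ?_⟩
          have : (0 : ℤ) ≤ m * C := by positivity
          omega
        · exact ⟨C, le_rfl, by omega, by linarith⟩
      obtain ⟨j, hj, hj0, hj1⟩ := this
      exact ⟨j, Finset.mem_range.2 (by omega), mul_pos (by positivity)
        ((uniSum_pos_iff C m _).2 ⟨hj0, hj1⟩)⟩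

theorem uniSum_eq_zero {C m : ℕ} {s : ℤ} (h : ¬ (0 ≤ s ∧ s ≤ m * C)) : uniSum (C + 1) m s = 0 := by
  by_contra h'
  exact h ((uniSum_pos_iff C m s).1 (lt_of_le_of_ne (uniSum_nonneg _ _ _) (Ne.symm h')))

/-! ### Log-concavity of the equal-weight partition functions -/

theorem factorial_mul_factorial_le (a d e : ℕ) :
    (a + e).factorial * (a + d).factorial ≤ a.factorial * (a + d + e).factorial := by
  induction e with
  | zero => simp
  | succ e ih =>
    rw [← add_assoc, ← add_assoc, Nat.factorial_succ, Nat.factorial_succ]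
    calc (a + e + 1) * (a + e).factorial * (a + d).factorial
        = (a + e + 1) * ((a + e).factorial * (a + d).factorial) := by ring
      _ ≤ (a + d + e + 1) * (a.factorial * (a + d + e).factorial) :=
        Nat.mul_le_mul (by omega) ih
      _ = _ := by ring

/-- A sequence on `ℤ` is a Pólya frequency sequence of order two. -/
def IsPF2 (z : ℤ → ℝ) : Prop :=
  ∀ u u' v v' : ℤ, u ≤ u' → v ≤ v' → z (u - v') * z (u' - v) ≤ z (u - v) * z (u' - v')

noncomputable def truncWeight (C : ℕ) (x : ℤ) : ℝ :=
  if 0 ≤ x ∧ x < C then 1 / (x.toNat.factorial : ℝ) else 0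

theorem truncWeight_nonneg (C : ℕ) (x : ℤ) : 0 ≤ truncWeight C x := by
  unfold truncWeight; split_ifs <;> positivity

theorem truncWeight_natCast {C j : ℕ} (h : j < C) : truncWeight C j = 1 / (j.factorial : ℝ) := by
  rw [truncWeight, if_pos ⟨by positivity, by exact_mod_cast h⟩, Int.toNat_natCast]

theorem isPF2_truncWeight (C : ℕ) : IsPF2 (truncWeight C) := by
  intro u u' v v' hu hv
  by_cases h : 0 ≤ u - v' ∧ u' - v < C
  · obtain ⟨a, ha⟩ := Int.eq_ofNat_of_zero_le h.1
    obtain ⟨d, hd⟩ := Int.eq_ofNat_of_zero_le (sub_nonneg.2 hu)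
    obtain ⟨e, he⟩ := Int.eq_ofNat_of_zero_le (sub_nonneg.2 hv)
    have h1 : u' - v = ((a + d + e : ℕ) : ℤ) := by push_cast; omega
    have h2 : u - v = ((a + e : ℕ) : ℤ) := by push_cast; omega
    have h3 : u' - v' = ((a + d : ℕ) : ℤ) := by push_cast; omega
    have h4 : a + d + e < C := by omega
    rw [ha, h1, h2, h3, truncWeight_natCast h4, truncWeight_natCast (by omega : a < C),
      truncWeight_natCast (by omega : a + e < C), truncWeight_natCast (by omega : a + d < C),
      div_mul_div_comm, div_mul_div_comm]
    refine div_le_div_of_nonneg_left (by norm_num) (by positivity) ?_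
    exact_mod_cast factorial_mul_factorial_le a d e
  · have : truncWeight C (u - v') * truncWeight C (u' - v) = 0 := by
      by_cases h0 : 0 ≤ u - v'
      · rw [truncWeight.eq_1 C (u' - v), if_neg (by omega), mul_zero]
      · rw [truncWeight.eq_1 C (u - v'), if_neg (by omega), zero_mul]
    rw [this]
    exact mul_nonneg (truncWeight_nonneg _ _) (truncWeight_nonneg _ _)

/-- The window `[lo, hi]` only has to be large enough. This allows convolutions at two different
arguments to be written over one index set, as the composition inequality requires. -/
theorem sum_truncWeight (C : ℕ) (z : ℤ → ℝ) {u lo hi v : ℤ} (hlo : lo ≤ u - C) (hhi : u ≤ hi) :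
    ∑ j ∈ Finset.range C, 1 / (j.factorial : ℝ) * z (u - v - j) =
      ∑ t ∈ Finset.Icc lo hi, truncWeight C (u - t) * z (t - v) := by
  have : ∑ t ∈ (Finset.range C).image (fun j : ℕ => u - j), truncWeight C (u - t) * z (t - v) =
      ∑ t ∈ Finset.Icc lo hi, truncWeight C (u - t) * z (t - v) := by
    refine Finset.sum_subset ?_ ?_
    · intro t ht
      obtain ⟨j, hj, rfl⟩ := Finset.mem_image.1 ht
      have := Finset.mem_range.1 hj
      rw [Finset.mem_Icc]
      omega
    · intro t _ ht
      rw [truncWeight, if_neg, zero_mul]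
      rintro ⟨h0, h1⟩
      refine ht (Finset.mem_image.2 ⟨(u - t).toNat, Finset.mem_range.2 (by omega), by omega⟩)
  rw [← this, Finset.sum_image (fun a _ b _ h => by simpa using h)]
  refine Finset.sum_congr rfl fun j hj => ?_
  rw [sub_sub_cancel, truncWeight_natCast (Finset.mem_range.1 hj), sub_right_comm]

/-- Adding a site convolves with the truncated weight `1 / j!`, and convolution preserves total
positivity of order two. -/
theorem isPF2_uniSum (C : ℕ) : ∀ m : ℕ, IsPF2 (uniSum C m)
  | 0 => by
    intro u u' v v' hu hv
    simp only [uniSum_zero]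
    split_ifs <;> first | omega | norm_num
  | m + 1 => by
    intro u u' v v' hu hv
    have e : ∀ x y : ℤ, u ≤ x → x ≤ u' → uniSum C (m + 1) (x - y) =
        ∑ t ∈ Finset.Icc (u - C) u', truncWeight C (x - t) * uniSum C m (t - y) := fun x y _ h2 => by
      rw [uniSum_succ]
      exact sum_truncWeight C _ (by omega) h2
    rw [e u _ le_rfl hu, e u' _ hu le_rfl, e u _ le_rfl hu, e u' _ hu le_rfl]
    exact sum_mul_sum_le_of_order _ _ _ _ _
      (fun j _ l _ h => by
        exact isPF2_truncWeight C u u' j l hu h.le)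
      (fun j _ l _ h => by
        have := isPF2_uniSum C m j l v v' h.le hv
        linarith)

/-! ### A generating function bound for log-concave laws -/

theorem sub_mul_sum_geom (x y : ℝ) {D m : ℕ} (hm : m ≤ D + 1) :
    (x - y) * ∑ i ∈ Finset.range m, x ^ (D - i) * y ^ i = x ^ (D + 1) - x ^ (D + 1 - m) * y ^ m := by
  induction m with
  | zero => simp
  | succ m ih =>
    rw [Finset.sum_range_succ, mul_add, ih (by omega)]
    have h1 : D + 1 - m = (D - m) + 1 := by omega
    have h2 : D + 1 - (m + 1) = D - m := by omega
    rw [h1, h2]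
    ring

/-- Among log-concave laws on `{0, …, D}`, the probability generating function at `y / x` is at
most that of the geometric law with the same mean (in homogeneous form). -/
theorem logConcave_pgf_le {D : ℕ} {p : ℕ → ℝ} (hD : ∀ m, D < m → p m = 0)
    (hlc : ∀ j l i, j ≤ l → p j * p (l + i) ≤ p l * p (j + i)) {x y : ℝ} (hx : 0 ≤ x) (hy : 0 ≤ y) :
    (∑ m ∈ Finset.range (D + 1), p m * (x ^ (D - m) * y ^ m)) *
        (x * ∑ m ∈ Finset.range (D + 1), p m + (x - y) * ∑ m ∈ Finset.range (D + 1), m * p m) ≤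
      x ^ (D + 1) * (∑ m ∈ Finset.range (D + 1), p m) ^ 2 := by
  set G : ℕ → ℝ := fun m => x ^ (D - m) * y ^ m with hG
  -- The tails satisfy `∑ τ i = ∑ m * p m`, and `∑ τ i * z ^ i` is the difference quotient of the
  -- generating function between `1` and `z = y / x`. Comparing the `τ`-average of `z ^ i` with its
  -- `p`-average gives the bound, with equality for the untruncated geometric law, where `τ` is
  -- proportional to `p`.
  set τ : ℕ → ℝ := fun i => ∑ m ∈ Finset.Ico (i + 1) (D + 1), p m with hτ
  have hτ' : ∀ i, τ i = ∑ m ∈ Finset.range (D + 1), p (i + 1 + m) := by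
    intro i
    rw [hτ]
    simp only
    rw [Finset.sum_Ico_eq_sum_range]
    refine Finset.sum_subset (fun m hm => ?_) fun m _ hm => hD _ ?_
    · rw [Finset.mem_range] at *; omega
    · rw [Finset.mem_range] at hm; omega
  have hswap : ∀ g : ℕ → ℝ, ∑ i ∈ Finset.range (D + 1), τ i * g i =
      ∑ m ∈ Finset.range (D + 1), p m * ∑ i ∈ Finset.range m, g i := by
    intro g
    simp only [hτ, Finset.sum_mul, Finset.mul_sum]
    refine Finset.sum_comm' fun i m => ?_
    simp only [Finset.mem_range, Finset.mem_Ico]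
    omega
  have hM : ∑ m ∈ Finset.range (D + 1), m * p m = ∑ i ∈ Finset.range (D + 1), τ i * 1 := by
    rw [hswap]
    simp [mul_comm]
  have hS : (x - y) * ∑ i ∈ Finset.range (D + 1), τ i * G i =
      x ^ (D + 1) * (∑ m ∈ Finset.range (D + 1), p m) -
        x * ∑ m ∈ Finset.range (D + 1), p m * G m := by
    rw [hswap, Finset.mul_sum, Finset.mul_sum, Finset.mul_sum, ← Finset.sum_sub_distrib]
    refine Finset.sum_congr rfl fun m hm => ?_
    have hm' := Finset.mem_range.1 hm
    rw [mul_left_comm, sub_mul_sum_geom x y (by omega)]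
    have h1 : D + 1 - m = (D - m) + 1 := by omega
    rw [h1]
    simp only [hG]
    ring
  -- Log-concavity makes the hazard rate increase, that is, `τ / p` decreases.
  have hcross : ∀ j ∈ Finset.range (D + 1), ∀ l ∈ Finset.range (D + 1), j < l →
      τ l * p j ≤ τ j * p l := by
    intro j _ l _ hjl
    rw [hτ', hτ', Finset.sum_mul, Finset.sum_mul]
    refine Finset.sum_le_sum fun m _ => ?_
    have := hlc j l (1 + m) hjl.le
    rw [← add_assoc, ← add_assoc] at this
    linarith
  have hGdiff : ∀ j l, j < l → l ≤ D → G l = x ^ (D - l) * y ^ j * y ^ (l - j) ∧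
      G j = x ^ (D - l) * y ^ j * x ^ (l - j) := by
    intro j l hjl hl
    have h1 : D - j = (D - l) + (l - j) := by omega
    have h2 : y ^ l = y ^ j * y ^ (l - j) := by rw [← pow_add]; congr 1; omega
    simp only [hG]
    rw [h1, pow_add, h2]
    constructor <;> ring
  -- The powers `z ^ i` decrease for `y ≤ x` and increase for `x ≤ y`; the factor `x - y` absorbs
  -- the change of direction.
  have main : 0 ≤ (x - y) * ((∑ i ∈ Finset.range (D + 1), τ i * G i) *
      (∑ m ∈ Finset.range (D + 1), p m * 1) -
      (∑ i ∈ Finset.range (D + 1), τ i * 1) * (∑ m ∈ Finset.range (D + 1), p m * G m)) := by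
    rcases le_total y x with h | h
    · refine mul_nonneg (sub_nonneg.2 h) (sub_nonneg.2 ?_)
      refine sum_mul_sum_le_of_order _ τ p G (fun _ => 1) hcross fun j _ l hl hjl => ?_
      obtain ⟨h1, h2⟩ := hGdiff j l hjl (by have := Finset.mem_range.1 hl; omega)
      rw [h1, h2, mul_one, mul_one]
      gcongr
    · refine mul_nonneg_of_nonpos_of_nonpos (sub_nonpos.2 h) (sub_nonpos.2 ?_)
      refine sum_mul_sum_le_of_order _ τ p (fun _ => 1) G hcross fun j _ l hl hjl => ?_
      obtain ⟨h1, h2⟩ := hGdiff j l hjl (by have := Finset.mem_range.1 hl; omega)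
      rw [h1, h2, one_mul, one_mul]
      gcongr
  rw [hM]
  simp only [mul_one] at main ⊢
  set P := ∑ m ∈ Finset.range (D + 1), p m
  set S := ∑ m ∈ Finset.range (D + 1), p m * G m
  set t := ∑ i ∈ Finset.range (D + 1), τ i
  set tG := ∑ i ∈ Finset.range (D + 1), τ i * G i
  have : (x - y) * (tG * P - t * S) = ((x - y) * tG) * P - (x - y) * t * S := by ring
  rw [this, hS] at main
  nlinarith [main]

/-! ### Poisson weights with unequal rates against equal rates -/

/-- The Poisson weights with rates `T i`. -/
noncomputable def poissonWeight {ι : Type*} (T : ι → ℝ) (i : ι) (j : ℕ) : ℝ :=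
  T i ^ j / (j.factorial : ℝ)

theorem poissonWeight_one {ι : Type*} :
    poissonWeight (fun _ : ι => (1 : ℝ)) = fun _ j => 1 / (j.factorial : ℝ) := by
  funext i j; simp [poissonWeight]

theorem capSum_eq_zero {ι : Type*} [DecidableEq ι] (a : ι → ℕ → ℝ) (D : ℕ) (V : Finset ι) :
    ∀ s : ℤ, ¬ (0 ≤ s ∧ s ≤ V.card * D) → capSum a (D + 1) V s = 0 := by
  induction V using Finset.induction_on with
  | empty =>
    intro s hs
    rw [capSum_empty, if_neg]
    rintro rfl
    simp at hs
  | insert i V hi ih =>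
    intro s hs
    rw [capSum_insert a _ hi]
    refine Finset.sum_eq_zero fun j hj => ?_
    rw [ih, mul_zero]
    rintro ⟨h0, h1⟩
    have := Finset.mem_range.1 hj
    refine hs ⟨by omega, ?_⟩
    rw [Finset.card_insert_of_notMem hi]
    push_cast
    nlinarith [(by omega : (j : ℤ) ≤ D)]

section tilt
variable {ι : Type*} {T : ι → ℝ}

theorem poissonWeight_nonneg (hT : ∀ i, 0 < T i) (i : ι) (j : ℕ) : 0 ≤ poissonWeight T i j := by
  have := hT i
  unfold poissonWeight
  positivity

variable [DecidableEq ι]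

theorem capSum_poisson_nonneg (hT : ∀ i, 0 < T i) (C : ℕ) (V : Finset ι) (s : ℤ) :
    0 ≤ capSum (poissonWeight T) C V s :=
  capSum_nonneg (fun i _ j _ => poissonWeight_nonneg hT i j) s

/-- Write `s` as the sum of the site values and use `j * T ^ j / j! = T * T ^ (j - 1) / (j - 1)!`.
The shift lowers the total by one. The cap excludes the term in which the shifted value is `D`,
which is the one subtracted. -/
theorem capSum_sizeBias (T : ι → ℝ) (D : ℕ) (V : Finset ι) (s : ℤ) :
    s * capSum (poissonWeight T) (D + 1) V s =
      (∑ i ∈ V, T i) * capSum (poissonWeight T) (D + 1) V (s - 1) -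
        (∑ i ∈ V, T i ^ (D + 1) * capSum (poissonWeight T) (D + 1) (V.erase i) (s - (D + 1))) /
          D.factorial := by
  rw [← capExp_id, capExp, Finset.sum_mul, Finset.sum_div, ← Finset.sum_sub_distrib]
  refine Finset.sum_congr rfl fun i hi => ?_
  rw [capSum_erase _ _ hi (s - 1), Finset.sum_range_succ', Finset.sum_range_succ, mul_add,
    Finset.mul_sum]
  have h1 : ∀ j : ℕ, ((j + 1 : ℕ) : ℝ) * poissonWeight T i (j + 1) = T i * poissonWeight T i j := by
    intro j
    unfold poissonWeight
    rw [Nat.factorial_succ]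
    have : (j.factorial : ℝ) ≠ 0 := by positivity
    have : ((j : ℝ) + 1) ≠ 0 := by positivity
    push_cast
    field_simp
    ring
  have h2 : T i * (poissonWeight T i D * capSum (poissonWeight T) (D + 1) (V.erase i) (s - 1 - D)) =
      T i ^ (D + 1) * capSum (poissonWeight T) (D + 1) (V.erase i) (s - (D + 1)) / D.factorial := by
    unfold poissonWeight
    rw [sub_sub, add_comm (1 : ℤ)]
    ring
  rw [h2, add_sub_cancel_right]
  simp only [Nat.cast_zero, zero_mul, add_zero]
  refine Finset.sum_congr rfl fun j _ => ?_
  have h3 : s - ((j + 1 : ℕ) : ℤ) = s - 1 - j := by push_cast; ring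
  rw [h1, mul_assoc, h3]

theorem uniSum_sizeBias (D m : ℕ) (s : ℤ) :
    s * uniSum (D + 1) m s = m * uniSum (D + 1) m (s - 1) -
      m * uniSum (D + 1) (m - 1) (s - (D + 1)) / D.factorial := by
  have h := capSum_sizeBias (fun _ : Fin m => (1 : ℝ)) D Finset.univ s
  simp only [poissonWeight_one, capSum_uniform, one_pow, one_mul, Finset.mem_univ,
    Finset.card_erase_of_mem, Finset.sum_const, Finset.card_univ, Fintype.card_fin, nsmul_eq_mul,
    mul_one] at h
  exact h

/-- The one-step ratio bound is iterated `m` times. The intermediate factor is cancelled only where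
it is positive; elsewhere the left-hand side vanishes. -/
theorem capSum_poisson_le_of_step (hT : ∀ i, 0 < T i) {D : ℕ} {V : Finset ι} {y : ℝ} (hy : 0 ≤ y)
    (h : ∀ s, capSum (poissonWeight T) (D + 1) V s * uniSum (D + 1) V.card (s - 1) ≤
      y * capSum (poissonWeight T) (D + 1) V (s - 1) * uniSum (D + 1) V.card s) (s : ℤ) (m : ℕ) :
    capSum (poissonWeight T) (D + 1) V s * uniSum (D + 1) V.card (s - m) ≤
      y ^ m * capSum (poissonWeight T) (D + 1) V (s - m) * uniSum (D + 1) V.card s := by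
  set Z := capSum (poissonWeight T) (D + 1) V
  set U := uniSum (D + 1) V.card
  have hZ : ∀ s, 0 ≤ Z s := capSum_poisson_nonneg hT _ V
  have hU : ∀ s, 0 ≤ U s := uniSum_nonneg _ _
  induction m with
  | zero => simp
  | succ m ih =>
    have e : s - ((m + 1 : ℕ) : ℤ) = s - m - 1 := by push_cast; ring
    rw [e]
    have hR : 0 ≤ y ^ (m + 1) * Z (s - m - 1) * U s :=
      mul_nonneg (mul_nonneg (by positivity) (hZ _)) (hU _)
    by_cases h0 : 0 ≤ s - m
    · by_cases h1 : s - m ≤ V.card * D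
      · have hpos : 0 < U (s - m) := (uniSum_pos_iff D _ _).2 ⟨h0, h1⟩
        refine le_of_mul_le_mul_right ?_ hpos
        have a1 := mul_le_mul_of_nonneg_right ih (hU (s - m - 1))
        have a2 := mul_le_mul_of_nonneg_left (h (s - m))
          (mul_nonneg (pow_nonneg hy m) (hU s))
        calc Z s * U (s - m - 1) * U (s - m) = Z s * U (s - m) * U (s - m - 1) := by ring
          _ ≤ _ := a1
          _ = y ^ m * U s * (Z (s - m) * U (s - m - 1)) := by ring
          _ ≤ _ := a2
          _ = _ := by ring
      · have : Z s = 0 := capSum_eq_zero _ D V s (by omega)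
        rw [this, zero_mul]
        exact hR
    · have : U (s - m - 1) = 0 := uniSum_eq_zero (by omega)
      rw [this, mul_zero]
      exact hR

/-- The inductive step seen from one site: if the other sites have partition ratios at most `y`
times the uniform ones, the sum over the value of site `i` is dominated by a generating function at
`y / T i`, to which the log-concave bound applies. The factor `D - s / V.card` is the mean distance
of a site from `D` under equal rates. -/
theorem tilt_step_site (hT : ∀ i, 0 < T i) {D : ℕ} {V : Finset ι} {i : ι} (hi : i ∈ V) {y : ℝ}
    (hy : 0 ≤ y)
    (h : ∀ s, capSum (poissonWeight T) (D + 1) (V.erase i) s *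
        uniSum (D + 1) (V.erase i).card (s - 1) ≤
      y * capSum (poissonWeight T) (D + 1) (V.erase i) (s - 1) *
        uniSum (D + 1) (V.erase i).card s) (s : ℤ) :
    capSum (poissonWeight T) (D + 1) V s * uniSum (D + 1) (V.card - 1) (s - D) *
        (T i + (D - s / V.card) * (T i - y)) ≤
      T i ^ (D + 1) * capSum (poissonWeight T) (D + 1) (V.erase i) (s - D) *
        uniSum (D + 1) V.card s := by
  have hx := hT i
  have hb : 0 < V.card := Finset.card_pos.2 ⟨i, hi⟩
  have hb' : (V.card : ℝ) ≠ 0 := by positivity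
  have hW : (V.erase i).card = V.card - 1 := Finset.card_erase_of_mem hi
  have hVs : V.card = (V.card - 1) + 1 := by omega
  have hmulti := capSum_poisson_le_of_step hT hy h
  rw [hW] at hmulti
  set b := V.card with hbdef
  set U := uniSum (D + 1) (b - 1) with hUdef
  have hU : ∀ s, 0 ≤ U s := uniSum_nonneg _ _
  set Z := capSum (poissonWeight T) (D + 1) (V.erase i)
  have hZ : ∀ s, 0 ≤ Z s := capSum_poisson_nonneg hT _ _
  -- Unnormalized law of `D - x` for the value `x` of one of `b` sites with equal rates and total
  -- `s`. It is log-concave as a product of two log-concave sequences.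
  set p : ℕ → ℝ := fun m => truncWeight (D + 1) (D - m) * U (s - D + m) with hp
  have hp0 : ∀ m, 0 ≤ p m := fun m => mul_nonneg (truncWeight_nonneg _ _) (hU _)
  have hpD : ∀ m, D < m → p m = 0 := fun m hm => by
    simp only [hp]
    rw [truncWeight, if_neg (by omega), zero_mul]
  have hpj : ∀ j ∈ Finset.range (D + 1), p (D - j) = 1 / (j.factorial : ℝ) * U (s - j) := by
    intro j hj
    have hj' := Finset.mem_range.1 hj
    simp only [hp]
    rw [← truncWeight_natCast hj']
    congr 2 <;> push_cast [Nat.cast_sub (by omega : j ≤ D)] <;> ring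
  have hlc : ∀ j l r, j ≤ l → p j * p (l + r) ≤ p l * p (j + r) := by
    intro j l r hjl
    have h1 := isPF2_truncWeight (D + 1) (D - l) (D - j) 0 r (by omega) (by omega)
    have h2 := isPF2_uniSum (D + 1) (b - 1) (s - D + j) (s - D + l) (-r) 0 (by omega) (by omega)
    simp only [hp]
    have e1 : ((D : ℤ) - (l + r : ℕ)) = D - l - r := by push_cast; ring
    have e2 : ((D : ℤ) - (j + r : ℕ)) = D - j - r := by push_cast; ring
    have e3 : s - D + (l + r : ℕ) = s - D + l - -r := by push_cast; ring
    have e4 : s - D + (j + r : ℕ) = s - D + j - -r := by push_cast; ring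
    rw [e1, e2, e3, e4]
    simp only [sub_zero] at h1 h2
    calc _ = (truncWeight (D + 1) (D - l - r) * truncWeight (D + 1) (D - j)) *
          (U (s - D + j) * U (s - D + l - -r)) := by ring
      _ ≤ (truncWeight (D + 1) (D - l) * truncWeight (D + 1) (D - j - r)) *
          (U (s - D + j - -r) * U (s - D + l)) :=
        mul_le_mul h1 h2 (mul_nonneg (hU _) (hU _))
          (mul_nonneg (truncWeight_nonneg _ _) (truncWeight_nonneg _ _))
      _ = _ := by ring
  have hrefl : ∀ g : ℕ → ℝ, ∑ m ∈ Finset.range (D + 1), p m * g m =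
      ∑ j ∈ Finset.range (D + 1), 1 / (j.factorial : ℝ) * U (s - j) * g (D - j) := by
    intro g
    rw [← Finset.sum_range_reflect]
    refine Finset.sum_congr rfl fun j hj => ?_
    rw [← hpj j hj]
    simp
  have hP : ∑ m ∈ Finset.range (D + 1), p m = uniSum (D + 1) b s := by
    rw [hVs, uniSum_succ]
    simpa using hrefl fun _ => 1
  set P := uniSum (D + 1) b s with hPdef
  have hP0 : 0 ≤ P := uniSum_nonneg _ _ _
  set κ : ℝ := D - s / b with hκ
  have hM : ∑ m ∈ Finset.range (D + 1), m * p m = κ * P := by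
    have h1 : ∑ m ∈ Finset.range (D + 1), m * p m =
        ∑ j ∈ Finset.range (D + 1), ((D : ℝ) + (-1) * (j : ℝ)) * (1 / (j.factorial : ℝ)) *
          U (s - j) := by
      have := hrefl fun m => (m : ℝ)
      simp only [mul_comm (p _)] at this
      rw [this]
      refine Finset.sum_congr rfl fun j hj => ?_
      have hj' := Finset.mem_range.1 hj
      rw [Nat.cast_sub (by omega)]
      ring
    have h2 := uniExp_affine (D + 1) D (-1) b s
    rw [uniExp, ← h1] at h2
    have h3 : κ * P = ((D : ℝ) * b + -1 * s) * uniSum (D + 1) b s / b := by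
      rw [hκ]; field_simp; ring
    rw [h3, ← h2]
    field_simp
  set S := ∑ m ∈ Finset.range (D + 1), p m * (T i ^ (D - m) * y ^ m) with hS
  have hS0 : 0 ≤ S := Finset.sum_nonneg fun m _ => mul_nonneg (hp0 m) (by positivity)
  have hpgf := logConcave_pgf_le hpD hlc hx.le hy
  rw [hP, hM, ← hS] at hpgf
  have hSe : S * (T i + κ * (T i - y)) ≤ T i ^ (D + 1) * P := by
    rcases hP0.eq_or_lt with h0 | h0
    · have : S = 0 := by
        rw [← h0] at hP
        have hz := (Finset.sum_eq_zero_iff_of_nonneg fun m _ => hp0 m).1 hP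
        exact Finset.sum_eq_zero fun m hm => by rw [hz m hm, zero_mul]
      rw [this, ← h0]
      simp
    · refine le_of_mul_le_mul_right ?_ h0
      linarith
  -- Every `Z (s - j)` is compared with the last one, `Z (s - D)`, at the cost of a factor `y ^ (D -
  -- j)`.
  have hA : capSum (poissonWeight T) (D + 1) V s * U (s - D) ≤ Z (s - D) * S := by
    rw [capSum_erase _ _ hi, hS, hrefl, Finset.sum_mul, Finset.mul_sum]
    refine Finset.sum_le_sum fun j hj => ?_
    have hj' := Finset.mem_range.1 hj
    have h1 := hmulti (s - j) (D - j)
    have e1 : s - j - ((D - j : ℕ) : ℤ) = s - D := by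
      rw [Nat.cast_sub (by omega)]; ring
    rw [e1] at h1
    have h2 := mul_le_mul_of_nonneg_left h1 (poissonWeight_nonneg hT i j)
    have e2 : D - (D - j) = j := by omega
    rw [e2]
    calc _ = poissonWeight T i j * (Z (s - j) * U (s - D)) := by ring
      _ ≤ _ := h2
      _ = _ := by unfold poissonWeight; ring
  rcases le_total 0 (T i + κ * (T i - y)) with he | he
  · calc _ ≤ Z (s - D) * S * (T i + κ * (T i - y)) := mul_le_mul_of_nonneg_right hA he
      _ = Z (s - D) * (S * (T i + κ * (T i - y))) := by ring
      _ ≤ Z (s - D) * (T i ^ (D + 1) * P) := mul_le_mul_of_nonneg_left hSe (hZ _)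
      _ = _ := by ring
  · exact le_trans (mul_nonpos_of_nonneg_of_nonpos
      (mul_nonneg (capSum_poisson_nonneg hT _ _ _) (hU _)) he)
      (mul_nonneg (mul_nonneg (by positivity) (hZ _)) hP0)

/-- After the size-bias identities for both partition functions, the claim is a lower bound for the
terms subtracted by the cap. This bound is the sum over `i` of `tilt_step_site`, with the mean rate
of the other sites as `y`; the corrections proportional to `T i - y` cancel in the sum. -/
theorem capSum_poisson_ratio_le (hT : ∀ i, 0 < T i) (D : ℕ) (n : ℕ) : ∀ (V : Finset ι),
    V.card = n → ∀ (y : ℝ), 0 ≤ y → V.card * y = ∑ i ∈ V, T i → ∀ s : ℤ,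
    capSum (poissonWeight T) (D + 1) V s * uniSum (D + 1) V.card (s - 1) ≤
      y * capSum (poissonWeight T) (D + 1) V (s - 1) * uniSum (D + 1) V.card s := by
  induction n with
  | zero =>
    intro V hV y hy _ s
    rw [Finset.card_eq_zero] at hV
    subst hV
    simp only [capSum_empty, uniSum_zero, Finset.card_empty]
    split_ifs <;> first | omega | simp
  | succ n ih =>
    intro V hV y hy hsum s
    have hR : 0 ≤ y * capSum (poissonWeight T) (D + 1) V (s - 1) * uniSum (D + 1) V.card s :=
      mul_nonneg (mul_nonneg hy (capSum_poisson_nonneg hT _ _ _)) (uniSum_nonneg _ _ _)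
    rcases le_or_gt s 0 with hs | hs
    · rw [uniSum_eq_zero (s := s - 1) (by omega), mul_zero]
      exact hR
    have hsR : (0 : ℝ) < s := by exact_mod_cast hs
    -- Mean rate of the other sites. For a single site there are none, and the value `T i` keeps the
    -- sum of `T i - avg i` equal to zero.
    set avg : ι → ℝ := fun i => if n = 0 then T i else (∑ l ∈ V, T l - T i) / n with havg
    have herase : ∀ i ∈ V, ∑ l ∈ V.erase i, T l = ∑ l ∈ V, T l - T i := fun i hi => by
      rw [← Finset.add_sum_erase V T hi]; ring
    have havg0 : ∀ i ∈ V, 0 ≤ avg i := by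
      intro i hi
      simp only [havg]
      split_ifs
      · exact (hT i).le
      · rw [← herase i hi]
        exact div_nonneg (Finset.sum_nonneg fun l _ => (hT l).le) (by positivity)
    have hcard : ∀ i ∈ V, (V.erase i).card = n := fun i hi => by
      rw [Finset.card_erase_of_mem hi, hV]; rfl
    have havgsum : ∀ i ∈ V, (V.erase i).card * avg i = ∑ l ∈ V.erase i, T l := by
      intro i hi
      rw [hcard i hi]
      simp only [havg]
      split_ifs with h0
      · have : V.erase i = ∅ := Finset.card_eq_zero.1 (by rw [hcard i hi, h0])
        rw [this, h0]
        simp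
      · rw [herase i hi]
        have : (n : ℝ) ≠ 0 := by exact_mod_cast h0
        field_simp
    have htot : ∑ i ∈ V, (T i - avg i) = 0 := by
      rw [Finset.sum_sub_distrib]
      simp only [havg]
      split_ifs with h0
      · simp
      · rw [← Finset.sum_div, Finset.sum_sub_distrib, Finset.sum_const, hV, nsmul_eq_mul]
        have : (n : ℝ) ≠ 0 := by exact_mod_cast h0
        push_cast
        field_simp
        ring
    have hsite := fun i (hi : i ∈ V) => tilt_step_site hT hi (havg0 i hi)
      (ih (V.erase i) (hcard i hi) (avg i) (havg0 i hi) (havgsum i hi)) (s - 1)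
    have hadd := Finset.sum_le_sum hsite
    rw [← Finset.mul_sum, Finset.sum_add_distrib, ← Finset.mul_sum, htot, mul_zero, add_zero,
      ← hsum, ← Finset.sum_mul] at hadd
    have e1 : s - 1 - (D : ℤ) = s - (D + 1) := by ring
    rw [e1] at hadd
    have b1 := capSum_sizeBias T D V s
    have b2 := uniSum_sizeBias D V.card s
    rw [← hsum] at b1
    set Z := capSum (poissonWeight T) (D + 1) V
    set U := uniSum (D + 1) V.card
    set X := ∑ i ∈ V, T i ^ (D + 1) * capSum (poissonWeight T) (D + 1) (V.erase i) (s - (D + 1))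
    set Y := uniSum (D + 1) (V.card - 1) (s - (D + 1))
    have hf : (0 : ℝ) < D.factorial := by positivity
    refine le_of_mul_le_mul_left ?_ hsR
    have c1 : (s : ℝ) * (Z s * U (s - 1)) =
        V.card * y * Z (s - 1) * U (s - 1) - X * U (s - 1) / D.factorial := by
      rw [← mul_assoc, b1]; ring
    have c2 : (s : ℝ) * (y * Z (s - 1) * U s) = V.card * y * Z (s - 1) * U (s - 1) -
        Z (s - 1) * Y * (V.card * y) / D.factorial := by
      calc _ = y * Z (s - 1) * (s * U s) := by ring
        _ = _ := by rw [b2]; ring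
    rw [c1, c2]
    have := div_le_div_of_nonneg_right hadd hf.le
    linarith

/-- Raising one site to the level `C` is more favourable for unequal rates than for equal ones. -/
theorem capSum_poisson_raise (hT : ∀ i, 0 < T i) (D : ℕ) (V : Finset ι) (s : ℤ) :
    V.card * uniSum (D + 1) (V.card - 1) (s - (D + 1)) * capSum (poissonWeight T) (D + 1) V s ≤
      (∑ i ∈ V, T i ^ (D + 1) * capSum (poissonWeight T) (D + 1) (V.erase i) (s - (D + 1))) *
        uniSum (D + 1) V.card s := by
  have hR : 0 ≤ (∑ i ∈ V, T i ^ (D + 1) *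
      capSum (poissonWeight T) (D + 1) (V.erase i) (s - (D + 1))) * uniSum (D + 1) V.card s :=
    mul_nonneg (Finset.sum_nonneg fun i _ => mul_nonneg (pow_nonneg (hT i).le _)
      (capSum_poisson_nonneg hT _ _ _)) (uniSum_nonneg _ _ _)
  rcases V.eq_empty_or_nonempty with rfl | hne
  · simp
  rcases le_or_gt s 0 with hs | hs
  · rw [uniSum_eq_zero (s := s - (D + 1)) (by omega), mul_zero, zero_mul]
    exact hR
  by_cases hs' : s ≤ V.card * D
  swap
  · rw [capSum_eq_zero _ D V s (by omega), mul_zero]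
    exact hR
  have hb : (0 : ℝ) < V.card := by exact_mod_cast hne.card_pos
  set y : ℝ := (∑ i ∈ V, T i) / V.card with hy
  have hy0 : 0 < y := div_pos (Finset.sum_pos (fun i _ => hT i) hne) hb
  have hsum : V.card * y = ∑ i ∈ V, T i := by rw [hy]; field_simp
  -- The ratio bound is used twice: once through the size-bias identities to bound `X` from below in
  -- terms of `Z (s - 1)`, and once directly to pass from `Z (s - 1)` to `Z s`.
  have h1 := capSum_poisson_ratio_le hT D V.card V rfl y hy0.le hsum s
  have b1 := capSum_sizeBias T D V s
  have b2 := uniSum_sizeBias D V.card s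
  rw [← hsum] at b1
  have hpos : 0 < uniSum (D + 1) V.card (s - 1) := (uniSum_pos_iff D _ _).2 ⟨by omega, by omega⟩
  have hsR : (0 : ℝ) < s := by exact_mod_cast hs
  set Z := capSum (poissonWeight T) (D + 1) V
  set U := uniSum (D + 1) V.card
  set X := ∑ i ∈ V, T i ^ (D + 1) * capSum (poissonWeight T) (D + 1) (V.erase i) (s - (D + 1))
  set Y := uniSum (D + 1) (V.card - 1) (s - (D + 1))
  have hf : (0 : ℝ) < D.factorial := by positivity
  have hY : 0 ≤ Y := uniSum_nonneg _ _ _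
  have hUs : 0 ≤ U s := uniSum_nonneg _ _ _
  have hX : V.card * Y * y * Z (s - 1) ≤ X * U (s - 1) := by
    have h2 := mul_le_mul_of_nonneg_left h1 hsR.le
    have c1 : (s : ℝ) * (Z s * U (s - 1)) =
        V.card * y * Z (s - 1) * U (s - 1) - X * U (s - 1) / D.factorial := by
      rw [← mul_assoc, b1]; ring
    have c2 : (s : ℝ) * (y * Z (s - 1) * U s) = V.card * y * Z (s - 1) * U (s - 1) -
        V.card * Y * y * Z (s - 1) / D.factorial := by
      calc _ = y * Z (s - 1) * (s * U s) := by ring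
        _ = _ := by rw [b2]; ring
    rw [c1, c2] at h2
    refine (div_le_div_iff_of_pos_right hf).1 ?_
    linarith
  refine le_of_mul_le_mul_right ?_ hpos
  calc V.card * Y * Z s * U (s - 1) = V.card * Y * (Z s * U (s - 1)) := by ring
    _ ≤ V.card * Y * (y * Z (s - 1) * U s) := mul_le_mul_of_nonneg_left h1 (mul_nonneg hb.le hY)
    _ = V.card * Y * y * Z (s - 1) * U s := by ring
    _ ≤ X * U (s - 1) * U s := mul_le_mul_of_nonneg_right hX hUs
    _ = _ := by ring

end tilt

/-! ### Mean deficits under equal weights -/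

/-- The test function `x ↦ (a - x)⁺`. -/
def deficit (a : ℕ) (j : ℕ) : ℝ := ((a - j : ℕ) : ℝ)

theorem deficit_nonneg (a j : ℕ) : 0 ≤ deficit a j := Nat.cast_nonneg _

theorem uniExp_deficit_self (C m : ℕ) (s : ℤ) :
    uniExp C (deficit C) m s = (C * m - s) * uniSum C m s := by
  have : uniExp C (deficit C) m s = uniExp C (fun j => (C : ℝ) + (-1) * (j : ℝ)) m s := by
    unfold uniExp
    congr 1
    refine Finset.sum_congr rfl fun j hj => ?_
    have := Finset.mem_range.1 hj
    rw [deficit, Nat.cast_sub this.le]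
    ring
  rw [this, uniExp_affine]
  ring

/-- Filling one more site increases the mean deficit. -/
theorem uniExp_deficit_raise (D : ℕ) {a : ℕ} (ha : a ≤ D + 1) (m : ℕ) (s : ℤ) :
    uniExp (D + 1) (deficit a) (m + 1) s * uniSum (D + 1) m (s - (D + 1)) ≤
      uniExp (D + 1) (deficit a) m (s - (D + 1)) * uniSum (D + 1) (m + 1) s := by
  by_cases hs : 0 ≤ s ∧ s ≤ (m + 1 : ℕ) * D
  swap
  · have h0 : uniSum (D + 1) (m + 1) s = 0 := uniSum_eq_zero hs
    have h1 : uniExp (D + 1) (deficit a) (m + 1) s = 0 := by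
      rw [uniSum_succ] at h0
      have hnn : ∀ j ∈ Finset.range (D + 1),
          0 ≤ 1 / (j.factorial : ℝ) * uniSum (D + 1) m (s - j) := fun j _ =>
        mul_nonneg (by positivity) (uniSum_nonneg _ _ _)
      have hz := (Finset.sum_eq_zero_iff_of_nonneg hnn).1 h0
      rw [uniExp, Finset.sum_eq_zero, mul_zero]
      intro j hj
      rw [mul_assoc, Nat.add_sub_cancel, hz j hj, mul_zero]
    rw [h0, h1, zero_mul, mul_zero]
  cases m with
  | zero =>
    rw [uniSum_eq_zero (m := 0) (s := s - (D + 1)), mul_zero]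
    · rw [uniExp]; simp
    · simp at hs ⊢; omega
  | succ m =>
    set f := deficit a
    set g := deficit (D + 1)
    set p : ℕ → ℝ := fun j => 1 / (j.factorial : ℝ) * uniSum (D + 1) (m + 1) (s - j)
    set q : ℕ → ℝ := fun j => 1 / (j.factorial : ℝ) * uniSum (D + 1) m (s - (D + 1) - j)
    -- With one site fewer and the total lowered by `D + 1`, the law of a single site favours small
    -- values, where the ratio of `deficit a` to `deficit (D + 1)` is larger.
    have h := sum_mul_sum_le_of_order (Finset.range (D + 1)) q p f g ?_ ?_
    · have e1 : ∀ r, uniExp (D + 1) r (m + 1 + 1) s =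
          ((m + 1 + 1 : ℕ) : ℝ) * ∑ j ∈ Finset.range (D + 1), p j * r j := fun r => by
        rw [uniExp, Nat.add_sub_cancel]
        congr 1
        exact Finset.sum_congr rfl fun j _ => by simp only [p]; ring
      have e2 : ∀ r, uniExp (D + 1) r (m + 1) (s - (D + 1)) =
          ((m + 1 : ℕ) : ℝ) * ∑ j ∈ Finset.range (D + 1), q j * r j := fun r => by
        rw [uniExp, Nat.add_sub_cancel]
        congr 1
        exact Finset.sum_congr rfl fun j _ => by simp only [q]; ring
      have d1 := uniExp_deficit_self (D + 1) (m + 1 + 1) s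
      have d2 := uniExp_deficit_self (D + 1) (m + 1) (s - (D + 1))
      rw [e1] at d1 ⊢
      rw [e2] at d2 ⊢
      -- The total deficit below `D + 1` is the same constant `c` in both systems: the site left out
      -- contributed zero. So comparing the ratios of `f` to `g` compares the means of `f`
      -- themselves.
      set c : ℝ := ((D + 1 : ℕ) : ℝ) * ((m + 1 + 1 : ℕ) : ℝ) - s with hc
      have hc' : ((D + 1 : ℕ) : ℝ) * ((m + 1 : ℕ) : ℝ) - ((s - (D + 1) : ℤ) : ℝ) = c := by
        rw [hc]; push_cast; ring
      rw [hc'] at d2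
      have hcpos : 0 < c := by
        have h2 := hs.2
        have : (s : ℝ) ≤ ((m + 1 + 1 : ℕ) : ℝ) * D := by exact_mod_cast h2
        rw [hc]
        push_cast at this ⊢
        nlinarith
      refine le_of_mul_le_mul_left ?_ hcpos
      set b := ((m + 1 + 1 : ℕ) : ℝ)
      set b' := ((m + 1 : ℕ) : ℝ)
      have hb : 0 ≤ b * b' := by positivity
      calc c * (b * (∑ j ∈ Finset.range (D + 1), p j * f j) *
            uniSum (D + 1) (m + 1) (s - (D + 1)))
          = b * (∑ j ∈ Finset.range (D + 1), p j * f j) *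
            (c * uniSum (D + 1) (m + 1) (s - (D + 1))) := by ring
        _ = b * b' * ((∑ j ∈ Finset.range (D + 1), q j * g j) *
            (∑ j ∈ Finset.range (D + 1), p j * f j)) := by rw [← d2]; ring
        _ ≤ b * b' * ((∑ j ∈ Finset.range (D + 1), q j * f j) *
            (∑ j ∈ Finset.range (D + 1), p j * g j)) := mul_le_mul_of_nonneg_left h hb
        _ = b' * (∑ j ∈ Finset.range (D + 1), q j * f j) *
            (c * uniSum (D + 1) (m + 1 + 1) s) := by rw [← d1]; ring
        _ = _ := by ring
    · intro j hj l hl hjl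
      have hl' := Finset.mem_range.1 hl
      simp only [p, q]
      have key : uniSum (D + 1) m (s - (D + 1) - l) * uniSum (D + 1) (m + 1) (s - j) ≤
          uniSum (D + 1) m (s - (D + 1) - j) * uniSum (D + 1) (m + 1) (s - l) := by
        rw [uniSum_succ, uniSum_succ, Finset.mul_sum, Finset.mul_sum]
        refine Finset.sum_le_sum fun t ht => ?_
        have ht' := Finset.mem_range.1 ht
        have := isPF2_uniSum (D + 1) m (s - l) (s - j) t (D + 1) (by omega) (by omega)
        have e1 : s - (D + 1) - l = s - l - (D + 1) := by ring
        have e2 : s - (D + 1) - j = s - j - (D + 1) := by ring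
        rw [e1, e2]
        have h3 := mul_le_mul_of_nonneg_left this
          (by positivity : (0 : ℝ) ≤ 1 / (t.factorial : ℝ))
        linarith
      have := mul_le_mul_of_nonneg_left key
        (by positivity : (0 : ℝ) ≤ 1 / (j.factorial : ℝ) * (1 / (l.factorial : ℝ)))
      linarith
    · intro j hj l hl hjl
      have hj' := Finset.mem_range.1 hj
      have hl' := Finset.mem_range.1 hl
      simp only [f, g, deficit]
      norm_cast
      rcases le_total a l with h | h
      · rw [Nat.sub_eq_zero_of_le h]; simp
      · obtain ⟨x, rfl⟩ := Nat.exists_eq_add_of_le h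
        obtain ⟨y, hy⟩ := Nat.exists_eq_add_of_le ha
        obtain ⟨z, rfl⟩ := Nat.exists_eq_add_of_lt hjl
        have h1 : j + z + 1 + x - (j + z + 1) = x := by omega
        have h2 : D + 1 - j = x + y + z + 1 := by omega
        have h3 : j + z + 1 + x - j = x + z + 1 := by omega
        have h4 : D + 1 - (j + z + 1) = x + y := by omega
        rw [h1, h2, h3, h4]
        nlinarith

theorem uniExp_nonneg {C : ℕ} {q : ℕ → ℝ} (hq : ∀ j, 0 ≤ q j) (m : ℕ) (s : ℤ) :
    0 ≤ uniExp C q m s :=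
  mul_nonneg (Nat.cast_nonneg m) (Finset.sum_nonneg fun j _ =>
    mul_nonneg (mul_nonneg (hq j) (by positivity)) (uniSum_nonneg _ _ _))

theorem uniExp_eq_zero_of_uniSum {C m : ℕ} {s : ℤ} (q : ℕ → ℝ) (h : uniSum C m s = 0) :
    uniExp C q m s = 0 := by
  cases m with
  | zero => simp [uniExp]
  | succ m =>
    rw [uniSum_succ] at h
    have hnn : ∀ j ∈ Finset.range C, 0 ≤ 1 / (j.factorial : ℝ) * uniSum C m (s - j) := fun j _ =>
      mul_nonneg (by positivity) (uniSum_nonneg _ _ _)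
    have hz := (Finset.sum_eq_zero_iff_of_nonneg hnn).1 h
    rw [uniExp, Finset.sum_eq_zero, mul_zero]
    intro j hj
    rw [mul_assoc, Nat.add_sub_cancel, hz j hj, mul_zero]

/-! ### Splitting by the sites at the largest value -/

section split
variable {ι : Type*} [DecidableEq ι] (a : ι → ℕ → ℝ) (C : ℕ)

theorem insert_sdiff_facts {V t : Finset ι} {i : ι} (hi : i ∉ V) (ht : t ⊆ V) :
    insert i V \ t = insert i (V \ t) ∧ insert i V \ insert i t = V \ t ∧ i ∉ V \ t ∧ i ∉ t := by
  have hit : i ∉ t := fun h => hi (ht h)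
  refine ⟨Finset.insert_sdiff_of_notMem _ hit, ?_, fun h => hi (Finset.mem_sdiff.1 h).1, hit⟩
  ext x
  simp only [Finset.mem_sdiff, Finset.mem_insert]
  constructor
  · rintro ⟨h1 | h1, h2⟩
    · exact absurd (Or.inl h1) h2
    · exact ⟨h1, fun h => h2 (Or.inr h)⟩
  · rintro ⟨h1, h2⟩
    refine ⟨Or.inr h1, ?_⟩
    rintro (rfl | h)
    · exact hi h1
    · exact h2 h

/-- Splitting according to the set of sites that take the largest value `C`. -/
theorem capSum_split_top (V : Finset ι) : ∀ s : ℤ, capSum a (C + 1) V s =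
    ∑ U ∈ V.powerset, (∏ i ∈ U, a i C) * capSum a C (V \ U) (s - C * U.card) := by
  induction V using Finset.induction_on with
  | empty => intro s; simp [capSum_empty]
  | insert i V hi ih =>
    intro s
    rw [capSum_insert a _ hi, Finset.sum_range_succ, Finset.sum_powerset_insert hi]
    congr 1
    · simp_rw [ih, Finset.mul_sum]
      rw [Finset.sum_comm]
      refine Finset.sum_congr rfl fun t ht => ?_
      obtain ⟨h1, -, h3, -⟩ := insert_sdiff_facts hi (Finset.mem_powerset.1 ht)
      rw [h1, capSum_insert a C h3, Finset.mul_sum]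
      refine Finset.sum_congr rfl fun j _ => ?_
      rw [sub_right_comm]
      ring
    · rw [ih, Finset.mul_sum]
      refine Finset.sum_congr rfl fun t ht => ?_
      obtain ⟨-, h2, -, h4⟩ := insert_sdiff_facts hi (Finset.mem_powerset.1 ht)
      rw [h2, Finset.prod_insert h4, Finset.card_insert_of_notMem h4]
      have : s - (C : ℤ) - C * t.card = s - C * ((t.card + 1 : ℕ) : ℤ) := by push_cast; ring
      rw [this]
      ring

/-- Sites at the value `C` contribute `q C = 0`, so only the remaining sites, now capped one level
lower, enter the mean. -/
theorem capExp_split_top {q : ℕ → ℝ} (hq : q C = 0) (V : Finset ι) : ∀ s : ℤ,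
    capExp a (C + 1) q V s =
      ∑ U ∈ V.powerset, (∏ i ∈ U, a i C) * capExp a C q (V \ U) (s - C * U.card) := by
  induction V using Finset.induction_on with
  | empty => intro s; simp [capExp_empty]
  | insert i V hi ih =>
    intro s
    rw [capExp_insert a _ _ hi, Finset.sum_range_succ, Finset.sum_powerset_insert hi]
    congr 1
    · have : ∀ j ∈ Finset.range C, a i j * (q j * capSum a (C + 1) V (s - j) +
          capExp a (C + 1) q V (s - j)) = ∑ U ∈ V.powerset, (∏ i ∈ U, a i C) *
            (a i j * (q j * capSum a C (V \ U) (s - C * U.card - j) +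
              capExp a C q (V \ U) (s - C * U.card - j))) := by
        intro j _
        rw [ih, capSum_split_top, Finset.mul_sum, ← Finset.sum_add_distrib, Finset.mul_sum]
        refine Finset.sum_congr rfl fun t _ => ?_
        rw [sub_right_comm]
        ring
      rw [Finset.sum_congr rfl this, Finset.sum_comm]
      refine Finset.sum_congr rfl fun t ht => ?_
      obtain ⟨h1, -, h3, -⟩ := insert_sdiff_facts hi (Finset.mem_powerset.1 ht)
      rw [h1, capExp_insert a C q h3, Finset.mul_sum]
    · rw [hq, zero_mul, zero_add, ih, Finset.mul_sum]
      refine Finset.sum_congr rfl fun t ht => ?_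
      obtain ⟨-, h2, -, h4⟩ := insert_sdiff_facts hi (Finset.mem_powerset.1 ht)
      rw [h2, Finset.prod_insert h4, Finset.card_insert_of_notMem h4]
      have : s - (C : ℤ) - C * t.card = s - C * ((t.card + 1 : ℕ) : ℤ) := by push_cast; ring
      rw [this]
      ring

/-- Double counting of pairs of a set and a distinguished element of it. -/
theorem sum_powersetCard_succ_mul (V : Finset ι) (r : ℕ) (F : Finset ι → ℝ) :
    ((r + 1 : ℕ) : ℝ) * ∑ U ∈ V.powersetCard (r + 1), F U =
      ∑ U ∈ V.powersetCard r, ∑ i ∈ V \ U, F (insert i U) := by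
  have : ∀ U ∈ V.powersetCard (r + 1), ((r + 1 : ℕ) : ℝ) * F U = ∑ _i ∈ U, F U := by
    intro U hU
    rw [Finset.sum_const, (Finset.mem_powersetCard.1 hU).2, nsmul_eq_mul]
  rw [Finset.mul_sum, Finset.sum_congr rfl this, Finset.sum_sigma', Finset.sum_sigma']
  refine Finset.sum_bij' (fun x _ => ⟨x.1.erase x.2, x.2⟩) (fun x _ => ⟨insert x.2 x.1, x.2⟩)
    ?_ ?_ ?_ ?_ ?_
  · rintro ⟨U, i⟩ h
    simp only [Finset.mem_sigma, Finset.mem_powersetCard, Finset.mem_sdiff] at h ⊢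
    refine ⟨⟨(Finset.erase_subset _ _).trans h.1.1, ?_⟩, h.1.1 h.2, Finset.notMem_erase _ _⟩
    rw [Finset.card_erase_of_mem h.2, h.1.2]
    rfl
  · rintro ⟨U, i⟩ h
    simp only [Finset.mem_sigma, Finset.mem_powersetCard, Finset.mem_sdiff] at h ⊢
    refine ⟨⟨Finset.insert_subset h.2.1 h.1.1, ?_⟩, Finset.mem_insert_self _ _⟩
    rw [Finset.card_insert_of_notMem h.2.2, h.1.2]
  · rintro ⟨U, i⟩ h
    simp only [Finset.mem_sigma] at h
    simp [Finset.insert_erase h.2]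
  · rintro ⟨U, i⟩ h
    simp only [Finset.mem_sigma, Finset.mem_sdiff] at h
    simp [Finset.erase_insert h.2.2]
  · rintro ⟨U, i⟩ h
    simp only [Finset.mem_sigma] at h
    simp [Finset.insert_erase h.2]

end split

/-- A ratio that increases from each index to the next one increases between any two indices. -/
theorem cross_le_of_step {p q : ℕ → ℝ} (hp : ∀ r, 0 ≤ p r) (hq : ∀ r, 0 ≤ q r)
    (hstep : ∀ r, p r * q (r + 1) ≤ p (r + 1) * q r) (hpq : ∀ r, q r = 0 → p r = 0)
    (hconn : ∀ j m l, j ≤ m → m ≤ l → 0 < q j → 0 < q l → 0 < q m) {j l : ℕ} (hjl : j ≤ l) :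
    p j * q l ≤ p l * q j := by
  rcases (hq j).eq_or_lt with h0 | hj
  · rw [hpq j h0.symm, zero_mul]
    exact mul_nonneg (hp l) (hq j)
  rcases (hq l).eq_or_lt with h0 | hl
  · rw [← h0, mul_zero]
    exact mul_nonneg (hp l) (hq j)
  induction l, hjl using Nat.le_induction with
  | base => exact le_rfl
  | succ l hjl ih =>
    have hm := hconn j l (l + 1) hjl l.le_succ hj hl
    refine le_of_mul_le_mul_right ?_ hm
    have h1 := mul_le_mul_of_nonneg_right (ih hm) hl.le
    have h2 := mul_le_mul_of_nonneg_right (hstep l) hj.le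
    calc p j * q (l + 1) * q l = p j * q l * q (l + 1) := by ring
      _ ≤ p l * q j * q (l + 1) := h1
      _ = p l * q (l + 1) * q j := by ring
      _ ≤ p (l + 1) * q l * q j := h2
      _ = _ := by ring

/-- The partition function is positive exactly when `(D + 1) * r ≤ s ≤ b * D + r`, which is an
interval of values `r`. Hence neighbouring ratio inequalities can be chained between any two points
of the support. -/
theorem uniSum_top_connected (D b : ℕ) (s : ℤ) {j m l : ℕ} (hjm : j ≤ m) (hml : m ≤ l) (hl : l ≤ b)
    (h1 : 0 < uniSum (D + 1) (b - j) (s - (D + 1) * j))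
    (h2 : 0 < uniSum (D + 1) (b - l) (s - (D + 1) * l)) :
    0 < uniSum (D + 1) (b - m) (s - (D + 1) * m) := by
  rw [uniSum_pos_iff] at *
  rw [Nat.cast_sub (by omega)] at *
  obtain ⟨h1, h1'⟩ := h1
  obtain ⟨h2, h2'⟩ := h2
  constructor
  · have : (0 : ℤ) ≤ (D + 1) * (l - m) := mul_nonneg (by positivity) (by omega)
    nlinarith
  · have h3 : (0 : ℤ) ≤ m - j := by omega
    nlinarith

/-- The mean deficit increases with the number of sites at the top, by `uniExp_deficit_raise`
applied one site at a time. The sequences are cut off beyond `b`, where the natural subtraction `b -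
r` would lose its meaning. -/
theorem uniExp_top_cross (D : ℕ) {a : ℕ} (ha : a ≤ D + 1) (b : ℕ) (s : ℤ) {j l : ℕ} (hjl : j ≤ l)
    (hl : l ≤ b) :
    uniExp (D + 1) (deficit a) (b - j) (s - (D + 1) * j) *
        uniSum (D + 1) (b - l) (s - (D + 1) * l) ≤
      uniExp (D + 1) (deficit a) (b - l) (s - (D + 1) * l) *
        uniSum (D + 1) (b - j) (s - (D + 1) * j) := by
  have h := cross_le_of_step
    (p := fun r => if r ≤ b then uniExp (D + 1) (deficit a) (b - r) (s - (D + 1) * r) else 0)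
    (q := fun r => if r ≤ b then uniSum (D + 1) (b - r) (s - (D + 1) * r) else 0)
    (fun r => by
      split_ifs
      exacts [uniExp_nonneg (deficit_nonneg a) _ _, le_rfl])
    (fun r => by
      split_ifs
      exacts [uniSum_nonneg _ _ _, le_rfl])
    (fun r => by
      by_cases hr : r + 1 ≤ b
      · rw [if_pos hr, if_pos hr, if_pos (by omega), if_pos (by omega)]
        have h := uniExp_deficit_raise D ha (b - (r + 1)) (s - (D + 1) * r)
        have e1 : b - (r + 1) + 1 = b - r := by omega
        have e2 : s - (D + 1) * r - (D + 1) = s - (D + 1) * ((r + 1 : ℕ) : ℤ) := by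
          push_cast; ring
        rwa [e1, e2] at h
      · rw [if_neg hr, if_neg hr, mul_zero, zero_mul])
    (fun r => by
      split_ifs
      exacts [fun h => uniExp_eq_zero_of_uniSum _ h, fun _ => rfl])
    (fun i m k him hmk => by
      by_cases hk : k ≤ b
      · rw [if_pos hk, if_pos (by omega), if_pos (by omega)]
        exact uniSum_top_connected D b s him hmk hk
      · rw [if_neg hk]
        exact fun _ h => absurd h (lt_irrefl _)) hjl
  rwa [if_pos hl, if_pos hl, if_pos (by omega), if_pos (by omega)] at h

section tilt
variable {ι : Type*} [DecidableEq ι] {T : ι → ℝ}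

/-- The contribution to `capSum` of the configurations in which exactly `r` sites have the
largest value `C`. -/
noncomputable def topSum (T : ι → ℝ) (C : ℕ) (V : Finset ι) (s : ℤ) (r : ℕ) : ℝ :=
  ∑ U ∈ V.powersetCard r, (∏ i ∈ U, poissonWeight T i C) *
    capSum (poissonWeight T) C (V \ U) (s - C * r)

theorem topSum_one (C : ℕ) (V : Finset ι) (s : ℤ) (r : ℕ) : topSum (fun _ => 1) C V s r =
    (V.card.choose r : ℝ) * ((1 / (C.factorial : ℝ)) ^ r * uniSum C (V.card - r) (s - C * r)) := by
  have : ∀ U ∈ V.powersetCard r, (∏ i ∈ U, poissonWeight (fun _ : ι => (1 : ℝ)) i C) *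
      capSum (poissonWeight fun _ : ι => (1 : ℝ)) C (V \ U) (s - C * r) =
      (1 / (C.factorial : ℝ)) ^ r * uniSum C (V.card - r) (s - C * r) := by
    intro U hU
    obtain ⟨h1, h2⟩ := Finset.mem_powersetCard.1 hU
    rw [poissonWeight_one, capSum_uniform, Finset.prod_const, h2, Finset.card_sdiff_of_subset h1, h2]
  rw [topSum, Finset.sum_congr rfl this, Finset.sum_const, Finset.card_powersetCard, nsmul_eq_mul]

theorem topSum_nonneg (hT : ∀ i, 0 < T i) (C : ℕ) (V : Finset ι) (s : ℤ) (r : ℕ) :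
    0 ≤ topSum T C V s r :=
  Finset.sum_nonneg fun _ _ => mul_nonneg
    (Finset.prod_nonneg fun i _ => poissonWeight_nonneg hT i C) (capSum_poisson_nonneg hT _ _ _)

theorem topSum_eq_zero (T : ι → ℝ) {D : ℕ} {V : Finset ι} {s : ℤ} {r : ℕ}
    (h : topSum (fun _ : ι => 1) (D + 1) V s r = 0) : topSum T (D + 1) V s r = 0 := by
  refine Finset.sum_eq_zero fun U hU => ?_
  obtain ⟨h1, h2⟩ := Finset.mem_powersetCard.1 hU
  have hr : r ≤ V.card := h2 ▸ Finset.card_le_card h1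
  rw [topSum_one, mul_eq_zero, mul_eq_zero] at h
  have hz : uniSum (D + 1) (V.card - r) (s - ((D + 1 : ℕ) : ℤ) * r) = 0 := by
    rcases h with h | h | h
    · exact absurd h (by exact_mod_cast (Nat.choose_pos hr).ne')
    · exact absurd h (by positivity)
    · exact h
  rw [capSum_eq_zero, mul_zero]
  rw [Finset.card_sdiff_of_subset h1, h2, ← uniSum_pos_iff, hz]
  exact lt_irrefl 0

/-- Likelihood ratio order: unequal rates favour many sites at the top. Given a set `U` of `r` such
sites, `capSum_poisson_raise` on `V \ U` compares the ways of raising one more; summing over `U`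
counts each set of `r + 1` sites `r + 1` times. -/
theorem topSum_step (hT : ∀ i, 0 < T i) (D : ℕ) (V : Finset ι) (s : ℤ) (r : ℕ) :
    topSum T (D + 1) V s r * topSum (fun _ => 1) (D + 1) V s (r + 1) ≤
      topSum T (D + 1) V s (r + 1) * topSum (fun _ => 1) (D + 1) V s r := by
  by_cases hr : r + 1 ≤ V.card
  swap
  · have : ∀ T' : ι → ℝ, topSum T' (D + 1) V s (r + 1) = 0 := fun T' => by
      rw [topSum, Finset.powersetCard_eq_empty.2 (by omega), Finset.sum_empty]
    rw [this, this, mul_zero, zero_mul]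
  set σ : ℤ := s - ((D + 1 : ℕ) : ℤ) * r with hσ
  have hσ' : s - ((D + 1 : ℕ) : ℤ) * ((r + 1 : ℕ) : ℤ) = σ - (D + 1) := by
    rw [hσ]; push_cast; ring
  set f : ℝ := 1 / ((D + 1).factorial : ℝ) with hf
  have hf0 : 0 ≤ f := by positivity
  set A := uniSum (D + 1) (V.card - r) σ
  set B := uniSum (D + 1) (V.card - r - 1) (σ - (D + 1))
  have h1 : ((r + 1 : ℕ) : ℝ) * topSum T (D + 1) V s (r + 1) =
      ∑ U ∈ V.powersetCard r, (∏ i ∈ U, poissonWeight T i (D + 1)) * (f *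
        ∑ i ∈ V \ U, T i ^ (D + 1) *
          capSum (poissonWeight T) (D + 1) ((V \ U).erase i) (σ - (D + 1))) := by
    rw [topSum, sum_powersetCard_succ_mul]
    refine Finset.sum_congr rfl fun U _ => ?_
    rw [Finset.mul_sum, Finset.mul_sum]
    refine Finset.sum_congr rfl fun i hi => ?_
    rw [Finset.prod_insert (Finset.mem_sdiff.1 hi).2, hσ', Finset.sdiff_insert]
    rw [show poissonWeight T i (D + 1) = T i ^ (D + 1) * f by
      rw [hf, poissonWeight]; ring]
    ring
  have h2 : ((r + 1 : ℕ) : ℝ) * topSum (fun _ : ι => 1) (D + 1) V s (r + 1) =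
      (V.card.choose r : ℝ) * f ^ r * (f * ((V.card - r : ℕ) * B)) := by
    rw [topSum_one, hσ', ← Nat.sub_sub, pow_succ]
    have := Nat.choose_succ_right_eq V.card r
    have h3 : (V.card.choose (r + 1) : ℝ) * ((r + 1 : ℕ) : ℝ) =
        V.card.choose r * ((V.card - r : ℕ) : ℝ) := by exact_mod_cast this
    calc _ = (V.card.choose (r + 1) : ℝ) * ((r + 1 : ℕ) : ℝ) * (f ^ r * f * B) := by ring
      _ = _ := by rw [h3]; ring
  have h3 : topSum (fun _ : ι => 1) (D + 1) V s r = V.card.choose r * (f ^ r * A) := topSum_one _ _ _ _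
  have h4 : topSum T (D + 1) V s r * ((V.card - r : ℕ) * B) * f ≤
      ((r + 1 : ℕ) : ℝ) * topSum T (D + 1) V s (r + 1) * A := by
    rw [h1, topSum, Finset.sum_mul, Finset.sum_mul, Finset.sum_mul]
    refine Finset.sum_le_sum fun U hU => ?_
    obtain ⟨hU1, hU2⟩ := Finset.mem_powersetCard.1 hU
    have h := capSum_poisson_raise hT D (V \ U) σ
    rw [Finset.card_sdiff_of_subset hU1, hU2] at h
    have hprod : 0 ≤ (∏ i ∈ U, poissonWeight T i (D + 1)) * f :=
      mul_nonneg (Finset.prod_nonneg fun i _ => poissonWeight_nonneg hT i _) hf0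
    have := mul_le_mul_of_nonneg_left h hprod
    linarith
  refine le_of_mul_le_mul_left ?_ (by positivity : (0 : ℝ) < ((r + 1 : ℕ) : ℝ))
  have hc : 0 ≤ (V.card.choose r : ℝ) * f ^ r := by positivity
  calc _ = topSum T (D + 1) V s r *
        (((r + 1 : ℕ) : ℝ) * topSum (fun _ : ι => 1) (D + 1) V s (r + 1)) := by ring
    _ = (V.card.choose r : ℝ) * f ^ r *
        (topSum T (D + 1) V s r * ((V.card - r : ℕ) * B) * f) := by rw [h2]; ring
    _ ≤ (V.card.choose r : ℝ) * f ^ r *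
        (((r + 1 : ℕ) : ℝ) * topSum T (D + 1) V s (r + 1) * A) := mul_le_mul_of_nonneg_left h4 hc
    _ = _ := by rw [h3]; ring

theorem capExp_deficit_self (a : ι → ℕ → ℝ) (C : ℕ) (V : Finset ι) (s : ℤ) :
    capExp a C (deficit C) V s = (C * V.card - s) * capSum a C V s := by
  rw [capExp_congr (b := a) (r := fun j => (C : ℝ) + (-1) * (j : ℝ)) (fun _ _ _ _ => rfl), capExp_affine]
  · ring
  · intro j hj
    rw [deficit, Nat.cast_sub hj.le]
    ring

theorem capSum_eq_sum_topSum (T : ι → ℝ) (C : ℕ) (V : Finset ι) (s : ℤ) :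
    capSum (poissonWeight T) (C + 1) V s =
      ∑ r ∈ Finset.range (V.card + 1), topSum T C V s r := by
  rw [capSum_split_top, Finset.sum_powerset]
  refine Finset.sum_congr rfl fun r _ => Finset.sum_congr rfl fun U hU => ?_
  rw [(Finset.mem_powersetCard.1 hU).2]

/-- Unequal rates spread the occupation numbers of capped, conditioned Poisson variables. -/
theorem uniExp_mul_capSum_poisson_le (hT : ∀ i, 0 < T i) (C : ℕ) : ∀ (a : ℕ), a ≤ C →
    ∀ (V : Finset ι) (s : ℤ),
    uniExp C (deficit a) V.card s * capSum (poissonWeight T) C V s ≤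
      capExp (poissonWeight T) C (deficit a) V s * uniSum C V.card s := by
  induction C with
  | zero =>
    intro a _ V s
    simp [uniExp, capExp]
  | succ C ih =>
    intro a ha V s
    -- At `a` equal to the cap the total deficit is determined by `s`, so equality holds. A smaller
    -- `a` gives zero at the top value, which lets the induction on the cap proceed.
    rcases ha.eq_or_lt with rfl | ha'
    · rw [uniExp_deficit_self, capExp_deficit_self]
      exact le_of_eq (by ring)
    have ha'' : a ≤ C := Nat.lt_succ_iff.1 ha'
    cases C with
    | zero =>
      obtain rfl : a = 0 := by omega
      have : uniExp (0 + 1) (deficit 0) V.card s = 0 := by simp [uniExp, deficit]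
      rw [this, zero_mul]
      exact mul_nonneg (capExp_nonneg (fun i _ j _ => poissonWeight_nonneg hT i j)
        (fun j _ => deficit_nonneg _ _) _) (uniSum_nonneg _ _ _)
    | succ D =>
    have hq : deficit a (D + 1) = 0 := by simp [deficit, ha'']
    set b := V.card with hb
    set f : ℝ := 1 / ((D + 1).factorial : ℝ) with hf
    set E : ℕ → ℝ := fun r => uniExp (D + 1) (deficit a) (b - r) (s - ((D + 1 : ℕ) : ℤ) * r) with hE
    set A : ℕ → ℝ := fun r => uniSum (D + 1) (b - r) (s - ((D + 1 : ℕ) : ℤ) * r) with hA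
    have hA0 : ∀ r, 0 ≤ A r := fun r => uniSum_nonneg _ _ _
    -- Mean deficit for equal rates given `r` sites at the top; it is zero by convention when this
    -- is impossible.
    set g : ℕ → ℝ := fun r => E r / A r with hg
    have hEg : ∀ r, E r = g r * A r := by
      intro r
      by_cases h : A r = 0
      · rw [h, mul_zero]; exact uniExp_eq_zero_of_uniSum _ h
      · rw [hg]; field_simp
    have hgmono : ∀ j l, j ≤ l → l ≤ b → A j ≠ 0 → A l ≠ 0 → g j ≤ g l := by
      intro j l hjl hl hj hl'
      have h := uniExp_top_cross D ha'' b s hjl hl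
      rw [hg]
      simp only
      rw [div_le_div_iff₀ (lt_of_le_of_ne (hA0 j) hj.symm) (lt_of_le_of_ne (hA0 l) hl'.symm)]
      simpa [hE, hA] using h
    set pT : ℕ → ℝ := topSum T (D + 1) V s with hpT
    set p1 : ℕ → ℝ := topSum (fun _ : ι => 1) (D + 1) V s with hp1
    have hp1' : ∀ r, p1 r = (b.choose r : ℝ) * (f ^ r * A r) := fun r => topSum_one _ _ _ _
    have hpT0 : ∀ r, 0 ≤ pT r := topSum_nonneg hT _ _ _
    have hp10 : ∀ r, 0 ≤ p1 r := topSum_nonneg (fun _ => one_pos) _ _ _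
    have hpos_iff : ∀ r, r ≤ b → (0 < p1 r ↔ 0 < A r) := by
      intro r hr
      have h1 : (0 : ℝ) < (b.choose r : ℝ) := by exact_mod_cast Nat.choose_pos hr
      have h2 : 0 < f ^ r := by positivity
      rw [hp1', mul_pos_iff_of_pos_left h1, mul_pos_iff_of_pos_left h2]
    have hvanish : ∀ r, b < r → p1 r = 0 := fun r hr => by
      rw [hp1', Nat.choose_eq_zero_of_lt hr]; simp
    have hcross : ∀ j l, j ≤ l → pT j * p1 l ≤ pT l * p1 j := fun j l hjl =>
      cross_le_of_step hpT0 hp10 (topSum_step hT D V s) (fun r h => topSum_eq_zero T h)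
        (fun j m l hjm hml h1 h2 => by
          have hl : l ≤ b := by
            by_contra h
            rw [hvanish l (by omega)] at h2
            exact lt_irrefl _ h2
          rw [hpos_iff _ (by omega)] at *
          have := uniSum_top_connected D b s hjm hml hl
          simp only [hA] at *
          push_cast at *
          exact this h1 h2) hjl
    set R := Finset.range (b + 1)
    have hZT : capSum (poissonWeight T) (D + 1 + 1) V s = ∑ r ∈ R, pT r :=
      capSum_eq_sum_topSum _ _ _ _
    have hZ1 : uniSum (D + 1 + 1) b s = ∑ r ∈ R, p1 r := by
      rw [← capSum_eq_sum_topSum, poissonWeight_one, capSum_uniform]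
    have hN1 : uniExp (D + 1 + 1) (deficit a) b s = ∑ r ∈ R, p1 r * g r := by
      rw [hb, ← capExp_uniform, capExp_split_top _ _ hq, Finset.sum_powerset]
      refine Finset.sum_congr rfl fun r _ => ?_
      have : ∀ U ∈ V.powersetCard r, (∏ i ∈ U, 1 / ((D + 1).factorial : ℝ)) *
          capExp (fun (_ : ι) j => 1 / (j.factorial : ℝ)) (D + 1) (deficit a) (V \ U)
            (s - ((D + 1 : ℕ) : ℤ) * U.card) = f ^ r * E r := by
        intro U hU
        obtain ⟨h1, h2⟩ := Finset.mem_powersetCard.1 hU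
        rw [capExp_uniform, Finset.prod_const, Finset.card_sdiff_of_subset h1, h2]
      rw [Finset.sum_congr rfl this, Finset.sum_const, Finset.card_powersetCard, nsmul_eq_mul,
        hp1', hEg]
      ring
    have hNT : ∑ r ∈ R, pT r * g r ≤
        capExp (poissonWeight T) (D + 1 + 1) (deficit a) V s := by
      rw [capExp_split_top _ _ hq, Finset.sum_powerset]
      refine Finset.sum_le_sum fun r _ => ?_
      rw [hpT, topSum, Finset.sum_mul]
      refine Finset.sum_le_sum fun U hU => ?_
      obtain ⟨h1, h2⟩ := Finset.mem_powersetCard.1 hU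
      rw [mul_assoc, h2]
      refine mul_le_mul_of_nonneg_left ?_
        (Finset.prod_nonneg fun i _ => poissonWeight_nonneg hT i _)
      have h := ih a ha'' (V \ U) (s - ((D + 1 : ℕ) : ℤ) * r)
      rw [Finset.card_sdiff_of_subset h1, h2] at h
      by_cases hAr : A r = 0
      · have : g r = 0 := by rw [hg]; simp [hAr]
        rw [this, mul_zero]
        exact capExp_nonneg (fun i _ j _ => poissonWeight_nonneg hT i j)
          (fun j _ => deficit_nonneg _ _) _
      · have hAr' : 0 < A r := lt_of_le_of_ne (hA0 r) (Ne.symm hAr)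
        refine le_of_mul_le_mul_right ?_ hAr'
        calc _ = g r * A r * capSum (poissonWeight T) (D + 1) (V \ U)
              (s - ((D + 1 : ℕ) : ℤ) * r) := by ring
          _ ≤ _ := by rw [← hEg]; exact h
    rw [hZT, hZ1, hN1]
    have hZ10 : 0 ≤ ∑ r ∈ R, p1 r := Finset.sum_nonneg fun r _ => hp10 r
    refine le_trans ?_ (mul_le_mul_of_nonneg_right hNT hZ10)
    -- It remains to compare the averages of `g` under `p1` and `pT`: `pT / p1` and `g` both
    -- increase on the support of `p1`, which contains that of `pT`.
    have hfin := sum_mul_sum_le_of_cross R p1 pT (fun _ => 1) g ?_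
    · simp only [mul_one] at hfin
      linarith
    · have hsym : ∀ j l, j ≤ l → l ≤ b → 0 ≤ (p1 j * pT l - p1 l * pT j) * (g l - g j) := by
        intro j l hjl hl
        by_cases hj0 : A j = 0
        · have h1 : p1 j = 0 := by rw [hp1', hj0]; simp
          rw [h1, show pT j = 0 from topSum_eq_zero T h1]; simp
        by_cases hl0 : A l = 0
        · have h1 : p1 l = 0 := by rw [hp1', hl0]; simp
          rw [h1, show pT l = 0 from topSum_eq_zero T h1]; simp
        · refine mul_nonneg ?_ (sub_nonneg.2 (hgmono j l hjl hl hj0 hl0))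
          have := hcross j l hjl
          linarith
      intro j hj l hl
      have hj' := Finset.mem_range.1 hj
      have hl' := Finset.mem_range.1 hl
      rcases le_total j l with h | h
      · have := hsym j l h (by omega)
        linarith
      · have := hsym l j h (by omega)
        linarith

end tilt

/-! ### Weights of blocks of full bins -/

/-- `blockWeight C l y` is `1 / m!` times the number of ways to hash `m = l * C + y` objects to a
block of `l + 1` consecutive bins such that the overflow passes through the first `l` bins, fills
all of them and leaves `y` objects (not capped) to the last one. -/
noncomputable def blockWeight (C : ℕ) : ℕ → ℕ → ℝ
  | 0, y => 1 / (y.factorial : ℝ)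
  | l + 1, y => ∑ u ∈ Finset.range (y + 1), blockWeight C l (C + u) / ((y - u).factorial : ℝ)

theorem blockWeight_pos (C : ℕ) : ∀ l y : ℕ, 0 < blockWeight C l y
  | 0, y => by rw [blockWeight]; positivity
  | l + 1, y => by
    rw [blockWeight]
    exact Finset.sum_pos (fun u _ => div_pos (blockWeight_pos C l _) (by positivity)) (by simp)

/-- Classification by the last of the `l * C + y` objects. Either it ended in the last bin, hashed
to any of the `l + 1` bins, or it filled bin number `t` of the block, hashed to one of the `t + 1`
bins up to there; in that case the block had been two blocks before. The proof verifies this from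
the recursion by induction on `l`. -/
theorem blockWeight_add_last_ball {C : ℕ} (hC : 0 < C) (l : ℕ) : ∀ y : ℕ,
    ((l * C + y : ℕ) : ℝ) * blockWeight C l y =
      ((l + 1 : ℕ) : ℝ) * (if y = 0 then 0 else blockWeight C l (y - 1)) +
        ∑ t ∈ Finset.range l, ((t + 1 : ℕ) : ℝ) * blockWeight C t (C - 1) *
          blockWeight C (l - 1 - t) y := by
  induction l with
  | zero =>
    intro y
    cases y with
    | zero => simp
    | succ y =>
      have : (y.factorial : ℝ) ≠ 0 := by positivity
      have : ((y : ℝ) + 1) ≠ 0 := by positivity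
      simp only [blockWeight, Nat.factorial_succ, Finset.range_zero, Finset.sum_empty]
      push_cast
      simp
      field_simp
  | succ l ih =>
    intro y
    set R : ℕ → ℝ := fun u => blockWeight C l (C + u) with hR
    set S : ℝ := if y = 0 then 0 else blockWeight C (l + 1) (y - 1) with hS
    have hV : ∀ y, blockWeight C (l + 1) y =
        ∑ u ∈ Finset.range (y + 1), R u / ((y - u).factorial : ℝ) := fun y => by rw [blockWeight]
    have h1 : ∑ u ∈ Finset.range (y + 1), ((y - u : ℕ) : ℝ) * (R u / ((y - u).factorial : ℝ)) =
        S := by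
      cases y with
      | zero => simp [hS]
      | succ y =>
        rw [Finset.sum_range_succ, hS, if_neg (by omega), Nat.add_sub_cancel, hV]
        simp only [Nat.sub_self, Nat.cast_zero, zero_mul, add_zero]
        refine Finset.sum_congr rfl fun u hu => ?_
        have hu' := Finset.mem_range.1 hu
        have e : y + 1 - u = (y - u) + 1 := by omega
        rw [e, Nat.factorial_succ]
        have : ((y - u).factorial : ℝ) ≠ 0 := by positivity
        have : (((y - u : ℕ) : ℝ) + 1) ≠ 0 := by positivity
        push_cast
        field_simp
    -- Shifting the overflow by one leaves a boundary term at `u = 0`: the shorter block had only `C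
    -- - 1` objects in its last bin. It is the new summand `t = l`.
    have h2 : ∑ u ∈ Finset.range (y + 1), blockWeight C l (C + u - 1) / ((y - u).factorial : ℝ) =
        S + blockWeight C l (C - 1) * blockWeight C 0 y := by
      rw [Finset.sum_range_succ']
      congr 1
      · cases y with
        | zero => simp [hS]
        | succ y =>
          rw [hS, if_neg (by omega), Nat.add_sub_cancel, hV]
          refine Finset.sum_congr rfl fun u _ => ?_
          have e1 : C + (u + 1) - 1 = C + u := by omega
          have e2 : y + 1 - (u + 1) = y - u := by omega
          rw [e1, e2]
      · rw [blockWeight]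
        simp [div_eq_mul_inv]
    have h3 : ∀ u ∈ Finset.range (y + 1), (((l + 1) * C + y : ℕ) : ℝ) *
        (R u / ((y - u).factorial : ℝ)) =
        ((y - u : ℕ) : ℝ) * (R u / ((y - u).factorial : ℝ)) +
        ((l + 1 : ℕ) : ℝ) * (blockWeight C l (C + u - 1) / ((y - u).factorial : ℝ)) +
        ∑ t ∈ Finset.range l, ((t + 1 : ℕ) : ℝ) * blockWeight C t (C - 1) *
          (blockWeight C (l - 1 - t) (C + u) / ((y - u).factorial : ℝ)) := by
      intro u hu
      have hu' := Finset.mem_range.1 hu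
      have h := ih (C + u)
      rw [if_neg (by omega)] at h
      -- Of the objects, `y - u` are hashed to the last bin itself and `l * C + (C + u)` to the bins
      -- before it.
      have e : (((l + 1) * C + y : ℕ) : ℝ) = ((y - u : ℕ) : ℝ) + ((l * C + (C + u) : ℕ) : ℝ) := by
        rw [Nat.cast_sub (by omega)]; push_cast; ring
      have h4 : ∑ t ∈ Finset.range l, ((t + 1 : ℕ) : ℝ) * blockWeight C t (C - 1) *
          (blockWeight C (l - 1 - t) (C + u) / ((y - u).factorial : ℝ)) =
          (∑ t ∈ Finset.range l, ((t + 1 : ℕ) : ℝ) * blockWeight C t (C - 1) *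
            blockWeight C (l - 1 - t) (C + u)) / ((y - u).factorial : ℝ) := by
        rw [Finset.sum_div]
        exact Finset.sum_congr rfl fun t _ => by ring
      rw [h4, e, add_mul, ← mul_div_assoc _ (R u) _]
      simp only [hR]
      rw [← mul_div_assoc, h]
      ring
    rw [hV, Finset.mul_sum, Finset.sum_congr rfl h3, Finset.sum_add_distrib,
      Finset.sum_add_distrib, h1, ← Finset.mul_sum, h2, Finset.sum_comm, Finset.sum_range_succ]
    have h5 : ∀ t ∈ Finset.range l, ∑ u ∈ Finset.range (y + 1), ((t + 1 : ℕ) : ℝ) *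
        blockWeight C t (C - 1) * (blockWeight C (l - 1 - t) (C + u) / ((y - u).factorial : ℝ)) =
        ((t + 1 : ℕ) : ℝ) * blockWeight C t (C - 1) * blockWeight C (l + 1 - 1 - t) y := by
      intro t ht
      have ht' := Finset.mem_range.1 ht
      have e : l + 1 - 1 - t = (l - 1 - t) + 1 := by omega
      rw [e, blockWeight, Finset.mul_sum]
    rw [Finset.sum_congr rfl h5]
    have e : l + 1 - 1 - l = 0 := by omega
    rw [e]
    push_cast
    ring

/-- Longer blocks favour larger loads in their last bin. Convolution with the totally positive
kernel `1 / j!` preserves monotone likelihood ratios of the incoming overflow, so the property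
passes from `l` to `l + 1`. -/
theorem blockWeight_step (C : ℕ) : ∀ (l : ℕ) {y y' : ℕ}, y ≤ y' →
    blockWeight C l y' * blockWeight C (l + 1) y ≤ blockWeight C (l + 1) y' * blockWeight C l y := by
  have conv : ∀ (R R' : ℕ → ℝ), (∀ j l, j < l → R l * R' j ≤ R j * R' l) → ∀ {y y' : ℕ}, y ≤ y' →
      (∑ u ∈ Finset.range (y' + 1), R u / ((y' - u).factorial : ℝ)) *
        (∑ u ∈ Finset.range (y + 1), R' u / ((y - u).factorial : ℝ)) ≤
      (∑ u ∈ Finset.range (y' + 1), R' u / ((y' - u).factorial : ℝ)) *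
        (∑ u ∈ Finset.range (y + 1), R u / ((y - u).factorial : ℝ)) := by
    intro R R' h y y' hy
    have e : ∀ (Q : ℕ → ℝ) (x : ℕ), x ≤ y' →
        ∑ u ∈ Finset.range (x + 1), Q u / ((x - u).factorial : ℝ) =
        ∑ u ∈ Finset.range (y' + 1), Q u * truncWeight (y' + 1) ((x : ℤ) - u) := by
      intro Q x hx
      have e1 : ∑ u ∈ Finset.range (x + 1), Q u / ((x - u).factorial : ℝ) =
          ∑ u ∈ Finset.range (x + 1), Q u * truncWeight (y' + 1) ((x : ℤ) - u) := by
        refine Finset.sum_congr rfl fun u hu => ?_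
        have hu' := Finset.mem_range.1 hu
        rw [← Nat.cast_sub (by omega), truncWeight_natCast (by omega)]
        ring
      rw [e1]
      refine Finset.sum_subset (fun u hu => ?_) fun u _ hu => ?_
      · rw [Finset.mem_range] at *; omega
      · rw [Finset.mem_range] at hu
        rw [truncWeight, if_neg (by omega), mul_zero]
    rw [e R y' le_rfl, e R y hy, e R' y' le_rfl, e R' y hy, mul_comm (∑ u ∈ _, R' u * _)]
    refine sum_mul_sum_le_of_order _ R R' _ _ (fun j _ l _ hjl => h j l hjl)
      fun j _ l _ hjl => ?_
    exact isPF2_truncWeight (y' + 1) y y' j l (by exact_mod_cast hy) (by exact_mod_cast hjl.le)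
  intro l
  induction l with
  | zero =>
    intro y y' hy
    -- A block of length zero receives no overflow: its incoming law is a point mass at `0`, which
    -- is smallest in likelihood ratio order.
    have h := conv (fun u => if u = 0 then 1 else 0) (fun u => blockWeight C 0 (C + u))
      (fun j l hjl => by
        rw [if_neg (by omega), zero_mul]
        split_ifs
        · rw [one_mul]; exact (blockWeight_pos _ _ _).le
        · rw [zero_mul]) hy
    have e : ∀ x : ℕ, ∑ u ∈ Finset.range (x + 1), (if u = 0 then (1 : ℝ) else 0) /
        ((x - u).factorial : ℝ) = blockWeight C 0 x := by
      intro x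
      rw [Finset.sum_range_succ', Finset.sum_eq_zero, blockWeight]
      · simp
      · intro u _; simp
    rw [e, e] at h
    exact h
  | succ l ih =>
    intro y y' hy
    have e : ∀ l x : ℕ, blockWeight C (l + 1) x =
        ∑ u ∈ Finset.range (x + 1), blockWeight C l (C + u) / ((x - u).factorial : ℝ) :=
      fun l x => by rw [blockWeight]
    rw [e (l + 1) y, e l y', e (l + 1) y', e l y]
    refine conv _ _ (fun j m hjm => ?_) hy
    have := ih (by omega : C + j ≤ C + m)
    linarith

theorem blockWeight_cross (C : ℕ) {l l' y y' : ℕ} (hl : l ≤ l') (hy : y ≤ y') :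
    blockWeight C l y' * blockWeight C l' y ≤ blockWeight C l' y' * blockWeight C l y :=
  cross_le_of_step (p := fun l => blockWeight C l y') (q := fun l => blockWeight C l y)
    (fun l => (blockWeight_pos C l y').le) (fun l => (blockWeight_pos C l y).le)
    (fun l => blockWeight_step C l hy) (fun l h => absurd h (blockWeight_pos C l y).ne')
    (fun _ m _ _ _ _ _ => blockWeight_pos C m y) hl

/-! ### Block weights as mixtures of Poisson weights -/

/-- The sequence defines a linear functional that is nonnegative at the polynomials that are
nonnegative on `(0, ∞)`. -/
def IsMomentSeq (A : ℕ → ℝ) : Prop :=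
  ∀ (N : ℕ) (c : ℕ → ℝ), (∀ T : ℝ, 0 < T → 0 ≤ ∑ j ∈ Finset.range N, c j * T ^ j) →
    0 ≤ ∑ j ∈ Finset.range N, c j * A j

theorem isMomentSeq_one : IsMomentSeq fun _ => 1 := fun N c h => by simpa using h 1 one_pos

/-- If the `A u` are the moments of `T`, these are the moments of `T + 1`. -/
theorem IsMomentSeq.binomial {A : ℕ → ℝ} (hA : IsMomentSeq A) :
    IsMomentSeq fun y => ∑ u ∈ Finset.range (y + 1), (y.choose u : ℝ) * A u := by
  intro N c hc
  have key : ∀ B : ℕ → ℝ, ∑ y ∈ Finset.range N, c y * ∑ u ∈ Finset.range (y + 1),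
      (y.choose u : ℝ) * B u =
      ∑ u ∈ Finset.range N, (∑ y ∈ Finset.range N, c y * (y.choose u : ℝ)) * B u := by
    intro B
    simp_rw [Finset.sum_mul]
    rw [Finset.sum_comm]
    refine Finset.sum_congr rfl fun y hy => ?_
    have hy' := Finset.mem_range.1 hy
    rw [Finset.mul_sum]
    simp_rw [← mul_assoc]
    refine Finset.sum_subset (fun u hu => ?_) fun u _ hu => ?_
    · rw [Finset.mem_range] at *; omega
    · rw [Finset.mem_range] at hu
      rw [Nat.choose_eq_zero_of_lt (by omega)]
      simp
  rw [key]
  refine hA N _ fun T hT => ?_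
  rw [← key]
  have := hc (T + 1) (by linarith)
  convert this using 3 with y _
  rw [add_pow]
  refine Finset.sum_congr rfl fun u _ => ?_
  rw [one_pow]
  ring

/-- A polynomial that is nonnegative on `(0, ∞)` has a nonnegative integral over `[0, T]`; the
functional is applied to this antiderivative. -/
theorem IsMomentSeq.integrate {A : ℕ → ℝ} (hA : IsMomentSeq A) :
    IsMomentSeq fun u => A (u + 1) / ((u + 1 : ℕ) : ℝ) := by
  intro N c hc
  have h := hA (N + 1) (fun j => if j = 0 then 0 else c (j - 1) / (j : ℝ)) fun T hT => ?_
  · rw [Finset.sum_range_succ'] at h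
    simp only [if_true, zero_mul, add_zero] at h
    convert h using 2 with u _
    rw [if_neg (by omega), Nat.add_sub_cancel]
    ring
  · rw [Finset.sum_range_succ']
    have h1 : ∫ x in (0 : ℝ)..T, ∑ j ∈ Finset.range N, c j * x ^ j =
        ∑ j ∈ Finset.range N, c j * (T ^ (j + 1) / ((j : ℝ) + 1)) := by
      rw [intervalIntegral.integral_finsetSum]
      · refine Finset.sum_congr rfl fun j _ => ?_
        rw [intervalIntegral.integral_const_mul, integral_pow]
        simp
      · intro j _
        exact (by fun_prop : Continuous fun x : ℝ => c j * x ^ j).intervalIntegrable _ _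
    have h2 : 0 ≤ ∫ x in (0 : ℝ)..T, ∑ j ∈ Finset.range N, c j * x ^ j := by
      refine intervalIntegral.integral_nonneg_of_ae_restrict hT.le ?_
      rw [Filter.EventuallyLE, MeasureTheory.ae_restrict_iff' measurableSet_Icc]
      have h0 : ∀ᵐ x : ℝ, x ≠ 0 := by
        rw [MeasureTheory.ae_iff]; simp
      filter_upwards [h0] with x hx hx'
      exact hc x (lt_of_le_of_ne hx'.1 (Ne.symm hx))
    rw [h1] at h2
    simp only [if_true, zero_mul, add_zero]
    convert h2 using 2 with j _
    rw [if_neg (by omega), Nat.add_sub_cancel]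
    push_cast
    ring

/-- In the recursion, the shift of the load by `C` is `C` integrations, and the convolution with `1
/ j!` is the translation `T ↦ T + 1`, that is, the objects hashed directly to the new bin. -/
theorem isMomentSeq_blockWeight (C : ℕ) : ∀ l : ℕ,
    IsMomentSeq fun y => (y.factorial : ℝ) * blockWeight C l y
  | 0 => by
    convert isMomentSeq_one using 2 with y
    rw [blockWeight]
    field_simp
  | l + 1 => by
    have h : ∀ i : ℕ, IsMomentSeq fun u => (u.factorial : ℝ) * blockWeight C l (i + u) := by
      intro i
      induction i with
      | zero => simpa using isMomentSeq_blockWeight C l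
      | succ i ih =>
        convert ih.integrate using 2 with u
        rw [Nat.factorial_succ, add_right_comm i 1 u, add_assoc i u 1]
        push_cast
        field_simp
    convert (h C).binomial using 2 with y
    rw [blockWeight, Finset.mul_sum]
    refine Finset.sum_congr rfl fun u hu => ?_
    have hu' := Finset.mem_range.1 hu
    have := Nat.choose_mul_factorial_mul_factorial (by omega : u ≤ y)
    rw [← this]
    push_cast
    field_simp

/-! ### From Poisson weights to moment sequences -/

section spread
variable {ι : Type*} [DecidableEq ι]

/-- The difference of the two sides is linear in the weights of each single site. With the other
sites fixed, it is a polynomial in the Poisson rate of site `i`, nonnegative for positive rates, so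
the functional of `A i` may replace evaluation. The sites in `W` are replaced one after the other.
-/
theorem uniExp_mul_capSum_moment_le_aux {A : ι → ℕ → ℝ} (hA : ∀ i, IsMomentSeq (A i)) (C : ℕ)
    {a : ℕ} (ha : a ≤ C) (V : Finset ι) (s : ℤ) (W : Finset ι) : ∀ T : ι → ℝ, (∀ i, 0 < T i) →
    0 ≤ capExp (fun i j => (if i ∈ W then A i j else T i ^ j) / (j.factorial : ℝ)) C (deficit a) V s
          * uniSum C V.card s - uniExp C (deficit a) V.card s *
        capSum (fun i j => (if i ∈ W then A i j else T i ^ j) / (j.factorial : ℝ)) C V s := by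
  induction W using Finset.induction_on with
  | empty =>
    intro T hT
    simp only [Finset.notMem_empty, if_false]
    exact sub_nonneg.2 (uniExp_mul_capSum_poisson_le hT C a ha V s)
  | insert i W hi ih =>
    intro T hT
    set w : ι → ℕ → ℝ := fun l j =>
      (if l ∈ insert i W then A l j else T l ^ j) / (j.factorial : ℝ) with hw
    set v : ℝ → ι → ℕ → ℝ := fun t l j =>
      (if l ∈ W then A l j else Function.update T i t l ^ j) / (j.factorial : ℝ) with hv
    have hne : ∀ t l, l ≠ i → ∀ j, w l j = v t l j := by
      intro t l hl j
      simp only [hw, hv, Finset.mem_insert, hl, false_or, Function.update_of_ne hl]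
    have hpos : ∀ t : ℝ, 0 < t → ∀ l, 0 < Function.update T i t l := by
      intro t ht l
      rcases eq_or_ne l i with rfl | hl
      · simpa using ht
      · rw [Function.update_of_ne hl]; exact hT l
    by_cases hiV : i ∈ V
    swap
    · have h := ih _ (hpos 1 one_pos)
      have hc : ∀ l ∈ V, ∀ j < C, w l j = v 1 l j := fun l hl j _ =>
        hne 1 l (fun h => hiV (h ▸ hl)) j
      rw [capExp_congr hc (fun _ _ => rfl), capSum_congr hc]
      exact h
    · set c : ℕ → ℝ := fun j => ((deficit a j * capSum w C (V.erase i) (s - j) +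
        capExp w C (deficit a) (V.erase i) (s - j)) * uniSum C V.card s -
        uniExp C (deficit a) V.card s * capSum w C (V.erase i) (s - j)) / (j.factorial : ℝ) with hc
      have hcw : ∀ t, ∀ l ∈ V.erase i, ∀ j < C, v t l j = w l j := fun t l hl j _ =>
        (hne t l (Finset.ne_of_mem_erase hl) j).symm
      have h1 : capExp w C (deficit a) V s * uniSum C V.card s -
          uniExp C (deficit a) V.card s * capSum w C V s = ∑ j ∈ Finset.range C, c j * A i j := by
        rw [capExp_erase _ _ _ hiV, capSum_erase _ _ hiV, Finset.sum_mul, Finset.mul_sum,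
          ← Finset.sum_sub_distrib]
        refine Finset.sum_congr rfl fun j _ => ?_
        have : w i j = A i j / (j.factorial : ℝ) := by simp [hw]
        rw [this, hc]
        ring
      have h2 : ∀ t, capExp (v t) C (deficit a) V s * uniSum C V.card s -
          uniExp C (deficit a) V.card s * capSum (v t) C V s =
          ∑ j ∈ Finset.range C, c j * t ^ j := by
        intro t
        rw [capExp_erase _ _ _ hiV, capSum_erase _ _ hiV, Finset.sum_mul, Finset.mul_sum,
          ← Finset.sum_sub_distrib]
        refine Finset.sum_congr rfl fun j _ => ?_
        have : v t i j = t ^ j / (j.factorial : ℝ) := by simp [hv, hi]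
        rw [this, capSum_congr (hcw t), capExp_congr (hcw t) (fun _ _ => rfl), hc]
        ring
      rw [h1]
      refine hA i C c fun t ht => ?_
      rw [← h2]
      exact ih _ (hpos t ht)

/-- Weights `A i j / j!` with moment sequences `A i` spread the occupation numbers at least as much
as the weights `1 / j!`. -/
theorem uniExp_mul_capSum_moment_le {a : ι → ℕ → ℝ}
    (hA : ∀ i, IsMomentSeq fun j => (j.factorial : ℝ) * a i j) {C c : ℕ} (hc : c ≤ C)
    (V : Finset ι) (s : ℤ) : uniExp C (deficit c) V.card s * capSum a C V s ≤
      capExp a C (deficit c) V s * uniSum C V.card s := by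
  have h := uniExp_mul_capSum_moment_le_aux hA C hc V s V (fun _ => 1) (fun _ => one_pos)
  have e : ∀ i ∈ V, ∀ j < C, (if i ∈ V then (j.factorial : ℝ) * a i j else 1 ^ j) /
      (j.factorial : ℝ) = a i j := by
    intro i hi j _
    rw [if_pos hi]
    field_simp
  rw [capExp_congr e (fun _ _ => rfl), capSum_congr e] at h
  exact sub_nonneg.1 h

/-- If the likelihood ratios of the weights increase with `l`, then the sites with larger `l` are
more likely to take the largest value. -/
theorem card_mul_sum_top_ge {a : ι → ℕ → ℝ} {D : ℕ} (ha : ∀ i j, 0 ≤ a i j) {l : ι → ℕ}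
    (hcross : ∀ i i' j, l i ≤ l i' → j ≤ D → a i D * a i' j ≤ a i' D * a i j) (V : Finset ι)
    (s : ℤ) :
    (∑ i ∈ V, (l i : ℝ)) * (∑ i ∈ V, a i D * capSum a (D + 1) (V.erase i) (s - D)) ≤
      V.card * ∑ i ∈ V, (l i : ℝ) * (a i D * capSum a (D + 1) (V.erase i) (s - D)) := by
  -- Chebyshev's sum inequality. To see that a larger `l` gives a larger top weight, two sites are
  -- compared by expanding over the value of the other one; the factor from the remaining sites is
  -- common.
  refine MonovaryOn.sum_mul_sum_le_card_mul_sum ?_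
  intro i hi i' hi' hlt
  by_contra hcon
  push Not at hcon
  have hle : l i ≤ l i' := by
    by_contra h
    push Not at h
    have hne : i ≠ i' := by rintro rfl; exact lt_irrefl _ h
    have h1 : i' ∈ V.erase i := Finset.mem_erase.2 ⟨hne.symm, hi'⟩
    have h2 : i ∈ V.erase i' := Finset.mem_erase.2 ⟨hne, hi⟩
    beta_reduce at hlt
    rw [capSum_erase _ _ h1, capSum_erase _ _ h2, Finset.erase_right_comm, Finset.mul_sum,
      Finset.mul_sum] at hlt
    refine absurd hlt (not_lt.2 (Finset.sum_le_sum fun j hj => ?_))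
    rw [← mul_assoc, ← mul_assoc]
    refine mul_le_mul_of_nonneg_right ?_ (capSum_nonneg (fun m _ j _ => ha m j) _)
    exact hcross i' i j h.le (by have := Finset.mem_range.1 hj; omega)
  exact absurd hcon (not_lt.2 (by exact_mod_cast hle))

end spread

/-! ### Load vectors and forward equations -/

section moves
variable {ι : Type*} [DecidableEq ι]

/-- Add one object to bin `i`. -/
def addOne (y : ι → ℕ) (i : ι) : ι → ℕ := Function.update y i (y i + 1)

/-- Remove one object from bin `i`. -/
def subOne (y : ι → ℕ) (i : ι) : ι → ℕ := Function.update y i (y i - 1)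

theorem subOne_addOne (y : ι → ℕ) (i : ι) : subOne (addOne y i) i = y := by
  ext l
  rcases eq_or_ne l i with rfl | h
  · simp [subOne, addOne]
  · simp [subOne, addOne, h]

theorem addOne_subOne {y : ι → ℕ} {i : ι} (hi : 0 < y i) : addOne (subOne y i) i = y := by
  ext l
  rcases eq_or_ne l i with rfl | h
  · simp only [subOne, addOne, Function.update_self]; omega
  · simp [subOne, addOne, h]

end moves

section states
variable {ι : Type*} [Fintype ι]

/-- The set of bins that are not full. -/
def nonfull (C : ℕ) (y : ι → ℕ) : Finset ι := Finset.univ.filter fun i => y i < C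

theorem mem_nonfull {C : ℕ} {y : ι → ℕ} {i : ι} : i ∈ nonfull C y ↔ y i < C := by simp [nonfull]

theorem sum_deficit_nonfull {C a : ℕ} (ha : a ≤ C) (y : ι → ℕ) :
    ∑ i ∈ nonfull C y, deficit a (y i) = ∑ i, deficit a (y i) := by
  refine Finset.sum_subset (Finset.subset_univ _) fun i _ hi => ?_
  rw [mem_nonfull] at hi
  rw [deficit, Nat.sub_eq_zero_of_le (by omega), Nat.cast_zero]

variable [DecidableEq ι]

/-- The load vectors with `n` objects. -/
def loadBox (ι : Type*) [Fintype ι] [DecidableEq ι] (C n : ℕ) : Finset (ι → ℕ) :=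
  (Fintype.piFinset fun _ => Finset.range (C + 1)).filter fun y => ∑ i, y i = n

theorem mem_loadBox {C n : ℕ} {y : ι → ℕ} :
    y ∈ loadBox ι C n ↔ (∀ i, y i ≤ C) ∧ ∑ i, y i = n := by
  simp [loadBox, Fintype.mem_piFinset]

/-- The load vectors with `n` objects and a given set of non-full bins. -/
def loadFiber (C n : ℕ) (S : Finset ι) : Finset (ι → ℕ) :=
  (loadBox ι C n).filter fun y => nonfull C y = S

theorem mem_loadFiber {C n : ℕ} {S : Finset ι} {y : ι → ℕ} :
    y ∈ loadFiber C n S ↔ y ∈ loadBox ι C n ∧ nonfull C y = S := by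
  simp [loadFiber]

theorem sum_loadBox_eq_sum_loadFiber (C n : ℕ) (f : (ι → ℕ) → ℝ) :
    ∑ y ∈ loadBox ι C n, f y = ∑ S : Finset ι, ∑ y ∈ loadFiber C n S, f y :=
  (Finset.sum_fiberwise (loadBox ι C n) (nonfull C) f).symm

theorem loadFiber_eq (C n : ℕ) (S : Finset ι) : loadFiber C n S =
    (Fintype.piFinset fun i => if i ∈ S then Finset.range C else {C}).filter
      fun y => ∑ i, y i = n := by
  ext y
  rw [mem_loadFiber, mem_loadBox, Finset.mem_filter, Fintype.mem_piFinset]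
  constructor
  · rintro ⟨⟨h1, h2⟩, rfl⟩
    refine ⟨fun i => ?_, h2⟩
    split_ifs with h
    · exact Finset.mem_range.2 (mem_nonfull.1 h)
    · rw [mem_nonfull] at h
      exact Finset.mem_singleton.2 (le_antisymm (h1 i) (not_lt.1 h))
  · rintro ⟨h1, h2⟩
    refine ⟨⟨fun i => ?_, h2⟩, ?_⟩
    · have := h1 i
      split_ifs at this
      · exact (Finset.mem_range.1 this).le
      · exact (Finset.mem_singleton.1 this).le
    · ext i
      rw [mem_nonfull]
      have := h1 i
      split_ifs at this with h
      · exact ⟨fun _ => h, fun _ => Finset.mem_range.1 this⟩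
      · rw [Finset.mem_singleton.1 this]
        exact ⟨fun h => absurd h (lt_irrefl _), fun h' => absurd h' h⟩

/-- Each full bin contributes the monomial of degree `C` to the generating function, so fixing the
set of full bins only shifts the total left to `S`. -/
theorem sum_loadFiber_prod (b : ι → ℕ → ℝ) (C n : ℕ) (S : Finset ι) :
    ∑ y ∈ loadFiber C n S, ∏ i ∈ S, b i (y i) =
      capSum b C S (n - C * (Fintype.card ι - S.card : ℕ)) := by
  set t : ι → Finset ℕ := fun i => if i ∈ S then Finset.range C else {C} with ht
  set b' : ι → ℕ → ℝ := fun i j => if i ∈ S then b i j else 1 with hb'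
  have h1 : ∏ i, ∑ j ∈ t i, AddMonoidAlgebra.single (j : ℤ) (b' i j) =
      ∑ y ∈ Fintype.piFinset t,
        AddMonoidAlgebra.single ((∑ i, y i : ℕ) : ℤ) (∏ i ∈ S, b i (y i)) := by
    rw [Finset.prod_univ_sum]
    refine Finset.sum_congr rfl fun y _ => ?_
    have h : ∀ A : Finset ι, ∏ i ∈ A, AddMonoidAlgebra.single ((y i : ℕ) : ℤ) (b' i (y i)) =
        AddMonoidAlgebra.single ((∑ i ∈ A, y i : ℕ) : ℤ) (∏ i ∈ A, b' i (y i)) := by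
      intro A
      induction A using Finset.induction_on with
      | empty => rw [Finset.prod_empty, Finset.prod_empty, Finset.sum_empty, Nat.cast_zero,
          AddMonoidAlgebra.one_def]
      | insert i A hi ih =>
        rw [Finset.prod_insert hi, Finset.prod_insert hi, Finset.sum_insert hi, ih,
          AddMonoidAlgebra.single_mul_single, Nat.cast_add]
    rw [h]
    congr 1
    simp only [hb']
    rw [Finset.prod_ite_mem, Finset.univ_inter]
  have h2 : ∏ i, ∑ j ∈ t i, AddMonoidAlgebra.single (j : ℤ) (b' i j) =
      AddMonoidAlgebra.single ((C * (Fintype.card ι - S.card : ℕ) : ℕ) : ℤ) (1 : ℝ) *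
        ∏ i ∈ S, ∑ j ∈ Finset.range C, AddMonoidAlgebra.single (j : ℤ) (b i j) := by
    rw [← Finset.prod_compl_mul_prod S]
    congr 1
    · have : ∀ i ∈ Sᶜ, ∑ j ∈ t i, AddMonoidAlgebra.single (j : ℤ) (b' i j) =
          AddMonoidAlgebra.single (C : ℤ) (1 : ℝ) := by
        intro i hi
        have hi' := Finset.mem_compl.1 hi
        simp [ht, hb', hi']
      rw [Finset.prod_congr rfl this, Finset.prod_const, AddMonoidAlgebra.single_pow, one_pow,
        Finset.card_compl, nsmul_eq_mul, Nat.cast_mul, mul_comm]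
    · refine Finset.prod_congr rfl fun i hi => ?_
      simp [ht, hb', hi]
  have h3 := congrArg (fun f : AddMonoidAlgebra ℝ ℤ => f.coeff n) (h1.symm.trans h2)
  simp only [AddMonoidAlgebra.coeff_sum, Finsupp.finsetSum_apply, AddMonoidAlgebra.coeff_single,
    Finsupp.single_apply, AddMonoidAlgebra.coeff_single_mul_apply, one_mul] at h3
  rw [loadFiber_eq, Finset.sum_filter, capSum]
  rw [neg_add_eq_sub] at h3
  push_cast at h3 ⊢
  rw [← h3]
  refine Finset.sum_congr rfl fun y _ => ?_
  congr 1
  exact propext ⟨fun h => by exact_mod_cast h, fun h => by exact_mod_cast h⟩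

theorem sum_loadFiber_prod_mul (b : ι → ℕ → ℝ) (q : ℕ → ℝ) (C n : ℕ) {S : Finset ι} {i : ι}
    (hi : i ∈ S) :
    ∑ y ∈ loadFiber C n S, (∏ l ∈ S, b l (y l)) * q (y i) =
      ∑ j ∈ Finset.range C, q j * b i j *
        capSum b C (S.erase i) (n - C * (Fintype.card ι - S.card : ℕ) - j) := by
  set b' : ι → ℕ → ℝ := fun l j => if l = i then q j * b i j else b l j with hb'
  have h1 : ∀ y ∈ loadFiber C n S, (∏ l ∈ S, b l (y l)) * q (y i) = ∏ l ∈ S, b' l (y l) := by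
    intro y _
    rw [← Finset.mul_prod_erase S _ hi, ← Finset.mul_prod_erase S (fun l => b' l (y l)) hi]
    have : ∏ l ∈ S.erase i, b' l (y l) = ∏ l ∈ S.erase i, b l (y l) :=
      Finset.prod_congr rfl fun l hl => by simp [hb', Finset.ne_of_mem_erase hl]
    rw [this]
    simp only [hb', if_true]
    ring
  rw [Finset.sum_congr rfl h1, sum_loadFiber_prod, capSum_erase _ _ hi]
  refine Finset.sum_congr rfl fun j _ => ?_
  rw [capSum_congr (b := b) (fun l hl m _ => by simp [hb', Finset.ne_of_mem_erase hl])]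
  simp [hb']

theorem sum_loadFiber_prod_mul_sum (b : ι → ℕ → ℝ) (q : ℕ → ℝ) (C n : ℕ) (S : Finset ι) :
    ∑ y ∈ loadFiber C n S, (∏ l ∈ S, b l (y l)) * ∑ i ∈ S, q (y i) =
      capExp b C q S (n - C * (Fintype.card ι - S.card : ℕ)) := by
  simp_rw [Finset.mul_sum]
  rw [Finset.sum_comm, capExp]
  exact Finset.sum_congr rfl fun i hi => sum_loadFiber_prod_mul b q C n hi

theorem sum_update_eq (y : ι → ℕ) (i : ι) (v : ℕ) :
    ∑ l, Function.update y i v l + y i = ∑ l, y l + v := by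
  rw [Finset.sum_update_of_mem (Finset.mem_univ i), ← Finset.add_sum_erase _ y (Finset.mem_univ i),
    Finset.sdiff_singleton_eq_erase]
  omega

/-- The forward equation of a chain that adds one object per step. -/
theorem sum_loadBox_forward (C n : ℕ) (w : (ι → ℕ) → ℝ) (κ : Finset ι → ι → ℝ)
    (F : (ι → ℕ) → ℝ) :
    ∑ y ∈ loadBox ι C n, w y * ∑ i ∈ nonfull C y, κ (nonfull C y) i * F (addOne y i) =
      ∑ y ∈ loadBox ι C (n + 1), (∑ i ∈ Finset.univ.filter fun i => 0 < y i,
        w (subOne y i) * κ (nonfull C (subOne y i)) i) * F y := by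
  simp_rw [Finset.mul_sum, Finset.sum_mul]
  rw [Finset.sum_sigma', Finset.sum_sigma']
  refine Finset.sum_bij' (fun x _ => ⟨addOne x.1 x.2, x.2⟩) (fun x _ => ⟨subOne x.1 x.2, x.2⟩)
    ?_ ?_ ?_ ?_ ?_
  · rintro ⟨y, i⟩ h
    simp only [Finset.mem_sigma, mem_loadBox, mem_nonfull, Finset.mem_filter, Finset.mem_univ,
      true_and] at h ⊢
    obtain ⟨⟨h1, h2⟩, h3⟩ := h
    refine ⟨⟨fun l => ?_, ?_⟩, by simp [addOne]⟩
    · rcases eq_or_ne l i with rfl | hl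
      · simp only [addOne, Function.update_self]; omega
      · simp only [addOne, Function.update_of_ne hl]; exact h1 l
    · have := sum_update_eq y i (y i + 1)
      simp only [addOne]
      omega
  · rintro ⟨y, i⟩ h
    simp only [Finset.mem_sigma, mem_loadBox, mem_nonfull, Finset.mem_filter, Finset.mem_univ,
      true_and] at h ⊢
    obtain ⟨⟨h1, h2⟩, h3⟩ := h
    have h1i := h1 i
    refine ⟨⟨fun l => ?_, ?_⟩, by simp only [subOne, Function.update_self]; omega⟩
    · rcases eq_or_ne l i with rfl | hl
      · simp only [subOne, Function.update_self]; omega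
      · simp only [subOne, Function.update_of_ne hl]; exact h1 l
    · have := sum_update_eq y i (y i - 1)
      simp only [subOne]
      omega
  · rintro ⟨y, i⟩ _
    simp [subOne_addOne]
  · rintro ⟨y, i⟩ h
    simp only [Finset.mem_sigma, Finset.mem_filter, Finset.mem_univ, true_and] at h
    simp [addOne_subOne h.2]
  · rintro ⟨y, i⟩ _
    simp only [subOne_addOne]
    ring

theorem nonfull_subOne_of_mem {C : ℕ} {y : ι → ℕ} {i : ι} (hi : i ∈ nonfull C y) :
    nonfull C (subOne y i) = nonfull C y := by
  rw [mem_nonfull] at hi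
  ext l
  rw [mem_nonfull, mem_nonfull]
  rcases eq_or_ne l i with rfl | hl
  · simp only [subOne, Function.update_self]; omega
  · simp only [subOne, Function.update_of_ne hl]

theorem nonfull_subOne_of_notMem {C : ℕ} {y : ι → ℕ} {i : ι} (hi : i ∉ nonfull C y)
    (hy : y i = C) (hC : 0 < C) : nonfull C (subOne y i) = insert i (nonfull C y) := by
  ext l
  rw [Finset.mem_insert, mem_nonfull, mem_nonfull]
  rcases eq_or_ne l i with rfl | hl
  · simp only [subOne, Function.update_self, true_or, iff_true]; omega
  · simp only [subOne, Function.update_of_ne hl, hl, false_or]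

/-- The weight of a load vector in a law of product form. -/
noncomputable def productLaw (C : ℕ) (c : Finset ι → ℝ) (a : Finset ι → ι → ℕ → ℝ)
    (y : ι → ℕ) : ℝ :=
  c (nonfull C y) * ∏ i ∈ nonfull C y, a (nonfull C y) i (y i)

/-- The forward recursion for a law of product form, with the predecessors sorted according to
whether the last object filled its bin. -/
theorem forward_productLaw {C n : ℕ} (hC : 0 < C) (c : Finset ι → ℝ) (a : Finset ι → ι → ℕ → ℝ)
    (κ : Finset ι → ι → ℝ) {S : Finset ι} {y : ι → ℕ} (hy : y ∈ loadFiber C n S) :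
    ∑ i ∈ Finset.univ.filter (fun i => 0 < y i),
        productLaw C c a (subOne y i) * κ (nonfull C (subOne y i)) i =
      ∑ i ∈ S, (if y i = 0 then 0 else
        c S * (a S i (y i - 1) * ∏ l ∈ S.erase i, a S l (y l)) * κ S i) +
      ∑ h ∈ Sᶜ, c (insert h S) * (a (insert h S) h (C - 1) *
        ∏ l ∈ S, a (insert h S) l (y l)) * κ (insert h S) h := by
  obtain ⟨hbox, rfl⟩ := mem_loadFiber.1 hy
  have hle := (mem_loadBox.1 hbox).1
  set S := nonfull C y
  have hfull : ∀ h, h ∉ S → y h = C := fun h hh => by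
    rw [mem_nonfull] at hh
    exact le_antisymm (hle h) (not_lt.1 hh)
  rw [Finset.sum_filter, ← Finset.sum_add_sum_compl S]
  congr 1
  · refine Finset.sum_congr rfl fun i hi => ?_
    by_cases h0 : y i = 0
    · rw [if_pos h0, if_neg (by omega)]
    · rw [if_neg h0, if_pos (by omega), productLaw, nonfull_subOne_of_mem hi]
      congr 2
      rw [← Finset.mul_prod_erase _ _ hi]
      congr 1
      · simp [subOne]; rfl
      · refine Finset.prod_congr rfl fun l hl => ?_
        simp [subOne, Finset.ne_of_mem_erase hl]; rfl
  · refine Finset.sum_congr rfl fun h hh => ?_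
    have hh' := Finset.mem_compl.1 hh
    have hyh := hfull h hh'
    rw [if_pos (by omega), productLaw, nonfull_subOne_of_notMem hh' hyh hC]
    congr 2
    rw [Finset.prod_insert hh']
    congr 1
    · simp [subOne, hyh]; rfl
    · refine Finset.prod_congr rfl fun l hl => ?_
      have : l ≠ h := fun e => hh' (e ▸ hl)
      simp [subOne, this]; rfl

end states

/-! ### Load chains and their product-form laws -/

/-- The indicator of the value `D`. -/
def topInd (D j : ℕ) : ℝ := if j = D then 1 else 0

/-- On `{0, …, D}` the indicator of `D` is a deficit plus an affine function, so deficit comparisons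
also control the mean number of bins that are one object short of full. -/
theorem topInd_eq_deficit {D j : ℕ} (hj : j < D + 1) :
    topInd D j = deficit (D - 1) j + ((-1) * deficit (D + 1) j + 2) := by
  unfold topInd deficit
  rw [Nat.cast_sub hj.le]
  split_ifs with h
  · rw [h, Nat.sub_eq_zero_of_le (Nat.sub_le D 1)]; push_cast; ring
  · obtain ⟨x, rfl⟩ := Nat.exists_eq_add_of_lt (lt_of_le_of_ne (Nat.lt_succ_iff.1 hj) h)
    rw [Nat.add_sub_cancel, Nat.add_sub_cancel_left]
    push_cast; ring

theorem sum_topInd_mul (D : ℕ) (x : ℕ → ℝ) :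
    ∑ j ∈ Finset.range (D + 1), topInd D j * x j = x D := by
  simp [topInd]

section compare
variable {ι : Type*} [DecidableEq ι]

theorem uniExp_topInd_mul_capSum_le {a : ι → ℕ → ℝ}
    (hA : ∀ i, IsMomentSeq fun j => (j.factorial : ℝ) * a i j) (D : ℕ) (V : Finset ι) (s : ℤ) :
    uniExp (D + 1) (topInd D) V.card s * capSum a (D + 1) V s ≤
      capExp a (D + 1) (topInd D) V s * uniSum (D + 1) V.card s := by
  have key : ∀ b : ι → ℕ → ℝ, capExp b (D + 1) (topInd D) V s =
      capExp b (D + 1) (deficit (D - 1)) V s +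
        (-((D + 1 : ℕ) * V.card - s) + 2 * V.card) * capSum b (D + 1) V s := by
    intro b
    rw [capExp_congr (b := b) (fun _ _ _ _ => rfl) (fun j hj => topInd_eq_deficit hj), capExp_add,
      capExp_add b _ (fun j => (-1) * deficit (D + 1) j), capExp_mul, capExp_const,
      capExp_deficit_self]
    ring
  have h := uniExp_mul_capSum_moment_le hA (by omega : D - 1 ≤ D + 1) V s
  have key1 := key fun _ j => 1 / (j.factorial : ℝ)
  rw [capExp_uniform, capExp_uniform, capSum_uniform] at key1
  rw [key1, key a]
  linarith

variable [Fintype ι]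

/-- The number of full bins in terms of the set of non-full ones. -/
def fullCount (S : Finset ι) : ℕ := Fintype.card ι - S.card

/-- The probability that the next object fills a bin, given that `j` of the `k` bins are full and
`n` objects have been placed, when the loads of the others are conditioned multinomial. -/
noncomputable def fillRate (D k n j : ℕ) : ℝ :=
  uniExp (D + 1) (topInd D) (k - j) (n - (D + 1 : ℕ) * (j : ℕ)) /
    ((k - j : ℕ) * uniSum (D + 1) (k - j) (n - (D + 1 : ℕ) * (j : ℕ)))

theorem uniExp_le_card_mul {C : ℕ} {q : ℕ → ℝ} (hq : ∀ j < C, q j ≤ 1) (m : ℕ) (s : ℤ) :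
    uniExp C q m s ≤ m * uniSum C m s := by
  cases m with
  | zero => simp [uniExp]
  | succ m =>
    rw [uniExp, uniSum_succ, Nat.add_sub_cancel]
    refine mul_le_mul_of_nonneg_left (Finset.sum_le_sum fun j hj => ?_) (by positivity)
    have h := mul_le_mul_of_nonneg_right (hq j (Finset.mem_range.1 hj))
      (mul_nonneg (by positivity : (0 : ℝ) ≤ 1 / (j.factorial : ℝ)) (uniSum_nonneg C m (s - j)))
    linarith

theorem fillRate_nonneg (D k n j : ℕ) : 0 ≤ fillRate D k n j :=
  div_nonneg (uniExp_nonneg (fun j => by unfold topInd; split_ifs <;> norm_num) _ _)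
    (mul_nonneg (Nat.cast_nonneg _) (uniSum_nonneg _ _ _))

theorem fillRate_le_one (D k n j : ℕ) : fillRate D k n j ≤ 1 :=
  div_le_one_of_le₀
    (uniExp_le_card_mul (fun j _ => by unfold topInd; split_ifs <;> norm_num) _ _)
    (mul_nonneg (Nat.cast_nonneg _) (uniSum_nonneg _ _ _))

theorem fillRate_mul_uniSum {ι : Type*} [Fintype ι] (D n : ℕ) {S : Finset ι} :
    fillRate D (Fintype.card ι) n (fullCount S) * uniSum (D + 1) S.card
        (n - (D + 1 : ℕ) * (Fintype.card ι - S.card : ℕ)) =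
      uniExp (D + 1) (topInd D) S.card (n - (D + 1 : ℕ) * (Fintype.card ι - S.card : ℕ)) /
        S.card := by
  have hS : Fintype.card ι - (Fintype.card ι - S.card) = S.card := by
    have := S.card_le_univ
    omega
  rw [fillRate, fullCount, hS]
  by_cases h : uniSum (D + 1) S.card (n - (D + 1 : ℕ) * (Fintype.card ι - S.card : ℕ)) = 0
  · rw [h, uniExp_eq_zero_of_uniSum _ h]; simp
  · rw [div_mul_eq_mul_div, mul_div_mul_right _ _ h]

theorem fullCount_addOne {D n : ℕ} {S : Finset ι} {y : ι → ℕ} (hy : y ∈ loadFiber (D + 1) n S)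
    {i : ι} (hi : i ∈ S) (G : ℕ → ℝ) : G (fullCount (nonfull (D + 1) (addOne y i))) =
      G (fullCount S) + (G (fullCount S + 1) - G (fullCount S)) * topInd D (y i) := by
  obtain ⟨-, rfl⟩ := mem_loadFiber.1 hy
  unfold topInd
  split_ifs with h
  · have : nonfull (D + 1) (addOne y i) = (nonfull (D + 1) y).erase i := by
      ext l
      rw [Finset.mem_erase, mem_nonfull, mem_nonfull]
      rcases eq_or_ne l i with rfl | hl
      · simp [addOne, h]
      · simp [addOne, hl]
    have hc := Finset.card_pos.2 ⟨i, hi⟩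
    have hc' := (nonfull (D + 1) y).card_le_univ
    have e : fullCount ((nonfull (D + 1) y).erase i) = fullCount (nonfull (D + 1) y) + 1 := by
      unfold fullCount
      rw [Finset.card_erase_of_mem hi]
      omega
    rw [this, e]
    ring
  · have : nonfull (D + 1) (addOne y i) = nonfull (D + 1) y := by
      have hi' := mem_nonfull.1 hi
      ext l
      rw [mem_nonfull, mem_nonfull]
      rcases eq_or_ne l i with rfl | hl
      · simp only [addOne, Function.update_self]; omega
      · simp [addOne, hl]
    rw [this]
    ring

theorem sum_productLaw_fiber (C n : ℕ) (c : Finset ι → ℝ) (a : Finset ι → ι → ℕ → ℝ)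
    (S : Finset ι) (f : (ι → ℕ) → ℝ) : ∑ y ∈ loadFiber C n S, productLaw C c a y * f y =
      c S * ∑ y ∈ loadFiber C n S, (∏ i ∈ S, a S i (y i)) * f y := by
  rw [Finset.mul_sum]
  refine Finset.sum_congr rfl fun y hy => ?_
  obtain ⟨-, rfl⟩ := mem_loadFiber.1 hy
  rw [productLaw, mul_assoc]

theorem sum_productLaw_fiber_const (C n : ℕ) (c : Finset ι → ℝ) (a : Finset ι → ι → ℕ → ℝ)
    (S : Finset ι) (x : ℝ) : ∑ y ∈ loadFiber C n S, productLaw C c a y * x =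
      c S * (capSum (a S) C S (n - C * (Fintype.card ι - S.card : ℕ)) * x) := by
  rw [sum_productLaw_fiber, ← Finset.sum_mul, sum_loadFiber_prod]

/-- The number of full bins grows only when the chosen bin holds exactly `D` objects, so one step is
governed by the weight of the configurations with that bin at `D`. -/
theorem sum_productLaw_step (D n : ℕ) (c : Finset ι → ℝ) (a : Finset ι → ι → ℕ → ℝ)
    {S : Finset ι} {κ : ι → ℝ} (hκ : ∑ i ∈ S, κ i = 1) (G : ℕ → ℝ) :
    ∑ y ∈ loadFiber (D + 1) n S, productLaw (D + 1) c a y *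
        ∑ i ∈ S, κ i * G (fullCount (nonfull (D + 1) (addOne y i))) =
      c S * (capSum (a S) (D + 1) S (n - (D + 1 : ℕ) * (Fintype.card ι - S.card : ℕ)) *
          G (fullCount S) + (G (fullCount S + 1) - G (fullCount S)) *
            ∑ i ∈ S, κ i * (a S i D * capSum (a S) (D + 1) (S.erase i)
              (n - (D + 1 : ℕ) * (Fintype.card ι - S.card : ℕ) - D))) := by
  have h1 : ∀ y ∈ loadFiber (D + 1) n S, productLaw (D + 1) c a y *
      ∑ i ∈ S, κ i * G (fullCount (nonfull (D + 1) (addOne y i))) =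
      productLaw (D + 1) c a y * G (fullCount S) + productLaw (D + 1) c a y *
        ((G (fullCount S + 1) - G (fullCount S)) * ∑ i ∈ S, κ i * topInd D (y i)) := by
    intro y hy
    have : ∑ i ∈ S, κ i * G (fullCount (nonfull (D + 1) (addOne y i))) =
        G (fullCount S) * ∑ i ∈ S, κ i +
          (G (fullCount S + 1) - G (fullCount S)) * ∑ i ∈ S, κ i * topInd D (y i) := by
      rw [Finset.mul_sum, Finset.mul_sum, ← Finset.sum_add_distrib]
      refine Finset.sum_congr rfl fun i hi => ?_
      rw [fullCount_addOne hy hi G]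
      ring
    rw [this, hκ]
    ring
  rw [Finset.sum_congr rfl h1, Finset.sum_add_distrib, sum_productLaw_fiber_const,
    sum_productLaw_fiber, mul_add]
  congr 2
  have h2 : ∀ y ∈ loadFiber (D + 1) n S, (∏ i ∈ S, a S i (y i)) *
      ((G (fullCount S + 1) - G (fullCount S)) * ∑ i ∈ S, κ i * topInd D (y i)) =
      (G (fullCount S + 1) - G (fullCount S)) *
        ∑ i ∈ S, κ i * ((∏ i ∈ S, a S i (y i)) * topInd D (y i)) := by
    intro y _
    rw [mul_left_comm, Finset.mul_sum]
    congr 1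
    exact Finset.sum_congr rfl fun i _ => by ring
  rw [Finset.sum_congr rfl h2, ← Finset.mul_sum, Finset.sum_comm]
  congr 1
  refine Finset.sum_congr rfl fun i hi => ?_
  rw [← Finset.mul_sum, sum_loadFiber_prod_mul _ _ _ _ hi]
  simp_rw [mul_assoc]
  rw [sum_topInd_mul]

/-- A process that adds one object per step to a random non-full bin, the probabilities depending
only on the set of non-full bins; `E n` is the expectation with respect to the loads after `n`
steps. -/
structure IsLoadChain (C : ℕ) (κ : Finset ι → ι → ℝ) (E : ℕ → ((ι → ℕ) → ℝ) → ℝ) : Prop where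
  zero : ∀ F, E 0 F = F fun _ => 0
  succ : ∀ n F, n < Fintype.card ι * C → E (n + 1) F =
    E n fun y => ∑ i ∈ nonfull C y, κ (nonfull C y) i * F (addOne y i)

theorem loadBox_zero (C : ℕ) : loadBox ι C 0 = {fun _ => 0} := by
  ext y
  rw [mem_loadBox, Finset.mem_singleton]
  constructor
  · rintro ⟨-, h⟩
    funext i
    exact (Finset.sum_eq_zero_iff.1 h) i (Finset.mem_univ i)
  · rintro rfl
    simp

theorem nonfull_nonempty_of_lt {ι : Type*} [Fintype ι] {C n : ℕ}
    (hn : n < Fintype.card ι * C) {y : ι → ℕ} (hy : ∑ i, y i ≤ n) : (nonfull C y).Nonempty := by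
  by_contra h
  rw [Finset.not_nonempty_iff_eq_empty] at h
  have : ∀ i ∈ Finset.univ, C ≤ y i := fun i _ => by
    by_contra hlt
    exact Finset.notMem_empty i (h ▸ mem_nonfull.2 (not_le.1 hlt))
  have h2 := Finset.card_nsmul_le_sum Finset.univ y C this
  rw [Finset.card_univ, smul_eq_mul] at h2
  have h3 : ∑ i, y i ≤ n := hy
  exact absurd (h2.trans h3) (not_le.2 hn)

theorem IsLoadChain.law {C : ℕ} (hC : 0 < C) {κ : Finset ι → ι → ℝ}
    {E : ℕ → ((ι → ℕ) → ℝ) → ℝ} (hE : IsLoadChain C κ E) (c : ℕ → Finset ι → ℝ)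
    (a : Finset ι → ι → ℕ → ℝ) (h0 : c 0 Finset.univ * ∏ i, a Finset.univ i 0 = 1)
    (hrec : ∀ n (S : Finset ι), S.Nonempty → ∀ y ∈ loadFiber C (n + 1) S,
      ∑ i ∈ S, (if y i = 0 then 0 else
        c n S * (a S i (y i - 1) * ∏ l ∈ S.erase i, a S l (y l)) * κ S i) +
      ∑ h ∈ Sᶜ, c n (insert h S) * (a (insert h S) h (C - 1) *
        ∏ l ∈ S, a (insert h S) l (y l)) * κ (insert h S) h = c (n + 1) S * ∏ i ∈ S, a S i (y i))
    (n : ℕ) (hn : n < Fintype.card ι * C) :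
    ∀ F, E n F = ∑ y ∈ loadBox ι C n, productLaw C (c n) a y * F y := by
  induction n with
  | zero =>
    intro F
    have : nonfull C (fun _ : ι => 0) = Finset.univ := by
      ext i; simp [mem_nonfull, hC]
    rw [hE.zero, loadBox_zero, Finset.sum_singleton, productLaw, this, h0, one_mul]
  | succ n ih =>
    intro F
    rw [hE.succ n F (by omega), ih (by omega), sum_loadBox_forward]
    refine Finset.sum_congr rfl fun y hy => ?_
    have hne := nonfull_nonempty_of_lt hn (mem_loadBox.1 hy).2.le
    have hf : y ∈ loadFiber C (n + 1) (nonfull C y) := mem_loadFiber.2 ⟨hy, rfl⟩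
    rw [forward_productLaw hC (c n) a κ hf, hrec n _ hne y hf, productLaw]

theorem IsLoadChain.nonempty_of_mem {C n : ℕ} (hn : n < Fintype.card ι * C) {S : Finset ι}
    {y : ι → ℕ} (hy : y ∈ loadFiber C n S) : S.Nonempty := by
  obtain ⟨h, rfl⟩ := mem_loadFiber.1 hy
  exact nonfull_nonempty_of_lt hn (mem_loadBox.1 h).2.le

/-- The distance structure of the ring: `gap S i` is the number of full bins directly before
bin `i`, when `S` is the set of non-full bins. -/
structure IsGap (gap : Finset ι → ι → ℕ) : Prop where
  univ : ∀ i, gap Finset.univ i = 0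
  sum : ∀ S : Finset ι, S.Nonempty → ∑ i ∈ S, (gap S i + 1) = Fintype.card ι
  insert : ∀ S : Finset ι, S.Nonempty → ∀ (f : ℕ → ℝ) (v : ℕ → ι → ℝ),
    ∑ h ∈ Sᶜ, f (gap (insert h S) h) * ∏ l ∈ S, v (gap (insert h S) l) l =
      ∑ i ∈ S, ∑ t ∈ Finset.range (gap S i),
        f t * (v (gap S i - 1 - t) i * ∏ l ∈ S.erase i, v (gap S l) l)

/-- The normalizing weights of uniform insertion. -/
noncomputable def uniformInsertWeight (C k : ℕ) : ℕ → ℕ → ℝ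
  | 0, _ => 1
  | n + 1, b => uniformInsertWeight C k n b * ((n : ℝ) + 1 - ((k : ℝ) - b) * C) / b +
      ((k : ℝ) - b) * uniformInsertWeight C k n (b + 1) / ((C - 1).factorial * ((b : ℝ) + 1))

theorem sum_fiber_eq {C n : ℕ} {S : Finset ι} {y : ι → ℕ} (hy : y ∈ loadFiber C n S) :
    ((∑ i ∈ S, y i : ℕ) : ℝ) = (n : ℝ) - ((Fintype.card ι : ℝ) - S.card) * C := by
  obtain ⟨hbox, rfl⟩ := mem_loadFiber.1 hy
  obtain ⟨hle, hsum⟩ := mem_loadBox.1 hbox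
  have h1 : ∑ i ∈ (nonfull C y)ᶜ, y i = (Fintype.card ι - (nonfull C y).card) * C := by
    rw [← Finset.card_compl, ← smul_eq_mul, ← Finset.sum_const]
    refine Finset.sum_congr rfl fun i hi => ?_
    rw [Finset.mem_compl, mem_nonfull] at hi
    exact le_antisymm (hle i) (not_lt.1 hi)
  have h2 := Finset.sum_add_sum_compl (nonfull C y) y
  rw [hsum, h1] at h2
  have h3 : (n : ℝ) = ((∑ i ∈ nonfull C y, y i : ℕ) : ℝ) +
      (((Fintype.card ι - (nonfull C y).card : ℕ) : ℝ)) * C := by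
    rw [← h2]; push_cast; ring
  rw [h3, Nat.cast_sub (Finset.card_le_univ _)]
  ring

/-- Every predecessor has weight a multiple of `∏ 1 / y i!`. Removing an object from bin `i`
produces the factor `y i`, and the sum of these over `S` is fixed by the number of objects and
`S.card`; hence the normalization depends on `S.card` alone. -/
theorem law_uniformInsert {C : ℕ} (hC : 0 < C) {E : ℕ → ((ι → ℕ) → ℝ) → ℝ}
    (hE : IsLoadChain C (fun S (_ : ι) => 1 / (S.card : ℝ)) E) {n : ℕ}
    (hn : n < Fintype.card ι * C) (F : (ι → ℕ) → ℝ) :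
    E n F = ∑ y ∈ loadBox ι C n, productLaw C
      (fun S => uniformInsertWeight C (Fintype.card ι) n S.card)
      (fun _ _ j => 1 / (j.factorial : ℝ)) y * F y := by
  refine hE.law hC (fun n S => uniformInsertWeight C (Fintype.card ι) n S.card)
    (fun _ _ j => 1 / (j.factorial : ℝ)) (by simp [uniformInsertWeight]) ?_ n hn F
  intro n S hS y hy
  set W := uniformInsertWeight C (Fintype.card ι) with hW
  set P := ∏ i ∈ S, 1 / ((y i).factorial : ℝ) with hP
  have hb : (0 : ℝ) < S.card := by exact_mod_cast hS.card_pos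
  have h1 : ∀ i ∈ S, (if y i = 0 then 0 else W n S.card * (1 / ((y i - 1).factorial : ℝ) *
      ∏ l ∈ S.erase i, 1 / ((y l).factorial : ℝ)) * (1 / (S.card : ℝ))) =
      W n S.card / S.card * P * (y i : ℝ) := by
    intro i hi
    split_ifs with h
    · simp [h]
    · obtain ⟨m, hm⟩ := Nat.exists_eq_succ_of_ne_zero h
      rw [hP, ← Finset.mul_prod_erase S _ hi, hm, Nat.succ_sub_one, Nat.factorial_succ]
      have : (m.factorial : ℝ) ≠ 0 := by positivity
      have : ((m : ℝ) + 1) ≠ 0 := by positivity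
      push_cast
      field_simp
  have h2 : ∀ h ∈ Sᶜ, W n (insert h S).card * (1 / ((C - 1).factorial : ℝ) *
      ∏ l ∈ S, 1 / ((y l).factorial : ℝ)) * (1 / ((insert h S).card : ℝ)) =
      W n (S.card + 1) / ((C - 1).factorial * ((S.card : ℝ) + 1)) * P := by
    intro h hh
    rw [Finset.card_insert_of_notMem (Finset.mem_compl.1 hh)]
    rw [← hP]
    have : ((S.card : ℝ) + 1) ≠ 0 := by positivity
    push_cast
    field_simp
  rw [Finset.sum_congr rfl h1, Finset.sum_congr rfl h2, Finset.sum_const, Finset.card_compl,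
    ← Finset.mul_sum, nsmul_eq_mul, Nat.cast_sub S.card_le_univ]
  have h3 := sum_fiber_eq hy
  push_cast at h3
  rw [h3, hW, uniformInsertWeight, ← hW]
  field_simp

/-- A non-full bin together with the gap before it is a block holding `gap S i * C + y i` objects.
The last-object identity, summed over the blocks, yields the total `n + 1`, which turns `n!` into
`(n + 1)!`. -/
theorem law_gapInsert {C : ℕ} (hC : 0 < C) {gap : Finset ι → ι → ℕ} (hgap : IsGap gap)
    {E : ℕ → ((ι → ℕ) → ℝ) → ℝ}
    (hE : IsLoadChain C (fun S i => ((gap S i + 1 : ℕ) : ℝ) / (Fintype.card ι : ℝ)) E) {n : ℕ}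
    (hn : n < Fintype.card ι * C) (F : (ι → ℕ) → ℝ) :
    E n F = ∑ y ∈ loadBox ι C n, productLaw C
      (fun _ => (n.factorial : ℝ) / (Fintype.card ι : ℝ) ^ n)
      (fun S i j => blockWeight C (gap S i) j) y * F y := by
  refine hE.law hC (fun n _ => (n.factorial : ℝ) / (Fintype.card ι : ℝ) ^ n)
    (fun S i j => blockWeight C (gap S i) j) (by simp [hgap.univ, blockWeight]) ?_ n hn F
  intro n S hS y hy
  have hk : (0 : ℝ) < Fintype.card ι := by
    have := hS.card_pos.trans_le S.card_le_univ
    exact_mod_cast this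
  set k : ℝ := (Fintype.card ι : ℝ) with hkdef
  set P := ∏ i ∈ S, blockWeight C (gap S i) (y i) with hP
  have h2 : ∑ h ∈ Sᶜ, (n.factorial : ℝ) / k ^ n * (blockWeight C (gap (insert h S) h) (C - 1) *
      ∏ l ∈ S, blockWeight C (gap (insert h S) l) (y l)) *
        (((gap (insert h S) h + 1 : ℕ) : ℝ) / k) =
      (n.factorial : ℝ) / k ^ (n + 1) * ∑ i ∈ S, ∑ t ∈ Finset.range (gap S i),
        ((t + 1 : ℕ) : ℝ) * blockWeight C t (C - 1) * (blockWeight C (gap S i - 1 - t) (y i) *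
          ∏ l ∈ S.erase i, blockWeight C (gap S l) (y l)) := by
    rw [← hgap.insert S hS (fun t => ((t + 1 : ℕ) : ℝ) * blockWeight C t (C - 1))
      (fun g l => blockWeight C g (y l)), Finset.mul_sum]
    refine Finset.sum_congr rfl fun h _ => ?_
    rw [pow_succ]
    field_simp
  have h1 : ∑ i ∈ S, (if y i = 0 then 0 else (n.factorial : ℝ) / k ^ n *
      (blockWeight C (gap S i) (y i - 1) * ∏ l ∈ S.erase i, blockWeight C (gap S l) (y l)) *
        (((gap S i + 1 : ℕ) : ℝ) / k)) =
      (n.factorial : ℝ) / k ^ (n + 1) * ∑ i ∈ S, ((gap S i + 1 : ℕ) : ℝ) *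
        (if y i = 0 then 0 else blockWeight C (gap S i) (y i - 1)) *
          ∏ l ∈ S.erase i, blockWeight C (gap S l) (y l) := by
    rw [Finset.mul_sum]
    refine Finset.sum_congr rfl fun i _ => ?_
    split_ifs
    · simp
    · rw [pow_succ]
      field_simp
  rw [h1, h2, ← mul_add, ← Finset.sum_add_distrib]
  have h3 : ∀ i ∈ S, ((gap S i + 1 : ℕ) : ℝ) *
        (if y i = 0 then 0 else blockWeight C (gap S i) (y i - 1)) *
          ∏ l ∈ S.erase i, blockWeight C (gap S l) (y l) +
      ∑ t ∈ Finset.range (gap S i), ((t + 1 : ℕ) : ℝ) * blockWeight C t (C - 1) *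
        (blockWeight C (gap S i - 1 - t) (y i) *
          ∏ l ∈ S.erase i, blockWeight C (gap S l) (y l)) =
      ((gap S i * C + y i : ℕ) : ℝ) * P := by
    intro i hi
    rw [hP, ← Finset.mul_prod_erase S _ hi, ← mul_assoc, blockWeight_add_last_ball hC, add_mul,
      Finset.sum_mul]
    congr 1
    exact Finset.sum_congr rfl fun t _ => by ring
  rw [Finset.sum_congr rfl h3, ← Finset.sum_mul]
  have h4 : ∑ i ∈ S, ((gap S i * C + y i : ℕ) : ℝ) = (n : ℝ) + 1 := by
    have e1 := hgap.sum S hS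
    have e2 : ((∑ i ∈ S, (gap S i + 1) : ℕ) : ℝ) = k := by rw [e1]
    have e3 := sum_fiber_eq hy
    push_cast at e2 e3 ⊢
    rw [Finset.sum_add_distrib] at e2 ⊢
    rw [← Finset.sum_mul, e3]
    rw [Finset.sum_const, nsmul_eq_mul, mul_one] at e2
    rw [← hkdef, ← e2]
    ring
  rw [h4, Nat.factorial_succ]
  push_cast
  ring

end compare

/-! ### Comparison of the two chains -/

/-- A function that is nonnegative and monotone on a finite set of naturals agrees there with a
monotone function. -/
theorem exists_monotone_extension (B : Finset ℕ) (g : ℕ → ℝ) (h0 : ∀ j, 0 ≤ g j)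
    (hg : ∀ j ∈ B, ∀ l ∈ B, j ≤ l → g j ≤ g l) : ∃ G : ℕ → ℝ, Monotone G ∧ ∀ j ∈ B, G j = g j := by
  refine ⟨fun j => (insert 0 ((B.filter (· ≤ j)).image g)).max' ⟨0, Finset.mem_insert_self _ _⟩,
    fun j l hjl => ?_, fun j hj => ?_⟩
  · refine Finset.max'_subset _ (Finset.insert_subset_insert _ (Finset.image_subset_image ?_))
    intro m hm
    rw [Finset.mem_filter] at *
    exact ⟨hm.1, hm.2.trans hjl⟩
  · refine le_antisymm (Finset.max'_le _ _ _ fun x hx => ?_) (Finset.le_max' _ _ ?_)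
    · rcases Finset.mem_insert.1 hx with rfl | hx
      · exact h0 j
      · obtain ⟨m, hm, rfl⟩ := Finset.mem_image.1 hx
        rw [Finset.mem_filter] at hm
        exact hg m hm.1 j hj hm.2
    · exact Finset.mem_insert_of_mem (Finset.mem_image_of_mem g
        (Finset.mem_filter.2 ⟨hj, le_rfl⟩))

theorem capExp_topInd {ι : Type*} [DecidableEq ι] (a : ι → ℕ → ℝ) (D : ℕ) (V : Finset ι) (s : ℤ) :
    capExp a (D + 1) (topInd D) V s =
      ∑ i ∈ V, a i D * capSum a (D + 1) (V.erase i) (s - D) := by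
  refine Finset.sum_congr rfl fun i _ => ?_
  simp_rw [mul_assoc]
  rw [sum_topInd_mul]

theorem isMomentSeq_gap {ι : Type*} (C : ℕ) (gap : Finset ι → ι → ℕ) (S : Finset ι) (i : ι) :
    IsMomentSeq fun j => (j.factorial : ℝ) * blockWeight C (gap S i) j :=
  isMomentSeq_blockWeight C _

section compare
variable {ι : Type*} [Fintype ι] [DecidableEq ι] {D : ℕ} {gap : Finset ι → ι → ℕ}
  {ER EB : ℕ → ((ι → ℕ) → ℝ) → ℝ}

/-- Under clockwise probing a bin is filled at least as fast as under uniform insertion. -/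
theorem fillRate_mul_capSum_le (hgap : IsGap gap) (n : ℕ) {S : Finset ι} (hS : S.Nonempty) :
    fillRate D (Fintype.card ι) n (fullCount S) *
        capSum (fun i j => blockWeight (D + 1) (gap S i) j) (D + 1) S
          (n - (D + 1 : ℕ) * (Fintype.card ι - S.card : ℕ)) ≤
      ∑ i ∈ S, ((gap S i + 1 : ℕ) : ℝ) / (Fintype.card ι : ℝ) * (blockWeight (D + 1) (gap S i) D *
        capSum (fun i j => blockWeight (D + 1) (gap S i) j) (D + 1) (S.erase i)
          (n - (D + 1 : ℕ) * (Fintype.card ι - S.card : ℕ) - D)) := by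
  set a : ι → ℕ → ℝ := fun i j => blockWeight (D + 1) (gap S i) j with ha
  have ha0 : ∀ i j, 0 ≤ a i j := fun i j => (blockWeight_pos _ _ _).le
  set s : ℤ := n - (D + 1 : ℕ) * (Fintype.card ι - S.card : ℕ) with hs
  have hb : (0 : ℝ) < S.card := by exact_mod_cast hS.card_pos
  have hk : (0 : ℝ) < Fintype.card ι := by
    exact_mod_cast hS.card_pos.trans_le S.card_le_univ
  have h1 := uniExp_topInd_mul_capSum_le (isMomentSeq_gap (D + 1) gap S) D S s
  have h2 := fillRate_mul_uniSum D n (S := S)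
  rw [← hs] at h2
  -- The insertion probability is proportional to `gap S i + 1`, and longer gaps are likelier to
  -- have their bin at level `D`: this correlation only helps clockwise probing.
  have hcheb := card_mul_sum_top_ge (a := a) (D := D) ha0 (l := fun i => gap S i + 1)
    (fun i i' j hi hj => blockWeight_cross (D + 1) (by omega) hj) S s
  have hsum : ∑ i ∈ S, ((gap S i + 1 : ℕ) : ℝ) = Fintype.card ι := by
    exact_mod_cast hgap.sum S hS
  rw [hsum, ← capExp_topInd] at hcheb
  have hR : ∑ i ∈ S, ((gap S i + 1 : ℕ) : ℝ) / (Fintype.card ι : ℝ) *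
      (a i D * capSum a (D + 1) (S.erase i) (s - D)) =
      (∑ i ∈ S, ((gap S i + 1 : ℕ) : ℝ) * (a i D * capSum a (D + 1) (S.erase i) (s - D))) /
        Fintype.card ι := by
    rw [Finset.sum_div]
    exact Finset.sum_congr rfl fun i _ => by ring
  change _ ≤ ∑ i ∈ S, ((gap S i + 1 : ℕ) : ℝ) / (Fintype.card ι : ℝ) *
      (a i D * capSum a (D + 1) (S.erase i) (s - D))
  rw [hR, le_div_iff₀ hk]
  have hE : 0 ≤ capExp a (D + 1) (topInd D) S s :=
    capExp_nonneg (fun i _ j _ => ha0 i j) (fun j _ => by unfold topInd; split_ifs <;> norm_num) _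
  have h3 : S.card * (fillRate D (Fintype.card ι) n (fullCount S) * capSum a (D + 1) S s) ≤
      capExp a (D + 1) (topInd D) S s := by
    rcases (uniSum_nonneg (D + 1) S.card s).eq_or_lt with h0 | h0
    · have : capSum a (D + 1) S s = 0 := by
        refine capSum_eq_zero _ _ _ _ fun h => ?_
        have := (uniSum_pos_iff D _ _).2 h
        rw [← h0] at this
        exact lt_irrefl _ this
      rw [this, mul_zero, mul_zero]
      exact hE
    · refine le_of_mul_le_mul_right ?_ h0
      calc _ = S.card * (fillRate D (Fintype.card ι) n (fullCount S) * uniSum (D + 1) S.card s) *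
            capSum a (D + 1) S s := by ring
        _ = uniExp (D + 1) (topInd D) S.card s * capSum a (D + 1) S s := by
          rw [h2]; field_simp
        _ ≤ _ := h1
  refine le_of_mul_le_mul_left ?_ hb
  calc _ = Fintype.card ι * (S.card * (fillRate D (Fintype.card ι) n (fullCount S) *
        capSum a (D + 1) S s)) := by ring
    _ ≤ Fintype.card ι * capExp a (D + 1) (topInd D) S s := mul_le_mul_of_nonneg_left h3 hk.le
    _ ≤ _ := hcheb

/-- The number of full bins is stochastically smaller under uniform insertion. -/
theorem fullCount_uniform_le_gap (hgap : IsGap gap)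
    (hR : IsLoadChain (D + 1) (fun S (_ : ι) => 1 / (S.card : ℝ)) ER)
    (hB : IsLoadChain (D + 1) (fun S i => ((gap S i + 1 : ℕ) : ℝ) / (Fintype.card ι : ℝ)) EB)
    (n : ℕ) (hn : n < Fintype.card ι * (D + 1)) : ∀ G : ℕ → ℝ, Monotone G →
    ER n (fun y => G (fullCount (nonfull (D + 1) y))) ≤
      EB n fun y => G (fullCount (nonfull (D + 1) y)) := by
  induction n with
  | zero =>
    intro G _
    rw [hR.zero, hB.zero]
  | succ n ih =>
    intro G hG
    have hn' : n < Fintype.card ι * (D + 1) := by omega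
    -- Conditional mean of `G` after one more uniform insertion, given `j` full bins. It lies
    -- between `G j` and `G (j + 1)` because the fill rate is a probability, hence it is monotone
    -- and the induction hypothesis applies to it.
    set H : ℕ → ℝ := fun j => G j + (G (j + 1) - G j) * fillRate D (Fintype.card ι) n j with hH
    have hH1 : ∀ j, G j ≤ H j := fun j => by
      have := mul_nonneg (sub_nonneg.2 (hG j.le_succ)) (fillRate_nonneg D (Fintype.card ι) n j)
      simp only [hH]
      linarith
    have hH2 : ∀ j, H j ≤ G (j + 1) := fun j => by
      have := mul_le_mul_of_nonneg_left (fillRate_le_one D (Fintype.card ι) n j)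
        (sub_nonneg.2 (hG j.le_succ))
      simp only [hH]
      linarith
    have hHmono : Monotone H := monotone_nat_of_le_succ fun j => (hH2 j).trans (hH1 (j + 1))
    rw [hR.succ _ _ hn', hB.succ _ _ hn']
    have hRH : ER n (fun y => ∑ i ∈ nonfull (D + 1) y, 1 / ((nonfull (D + 1) y).card : ℝ) *
          G (fullCount (nonfull (D + 1) (addOne y i)))) =
        ER n fun y => H (fullCount (nonfull (D + 1) y)) := by
      rw [law_uniformInsert D.succ_pos hR hn', law_uniformInsert D.succ_pos hR hn',
        sum_loadBox_eq_sum_loadFiber, sum_loadBox_eq_sum_loadFiber]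
      refine Finset.sum_congr rfl fun S _ => ?_
      have hnf : ∀ y ∈ loadFiber (D + 1) n S, nonfull (D + 1) y = S := fun y hy =>
        (mem_loadFiber.1 hy).2
      rcases S.eq_empty_or_nonempty with hS | hS
      · refine Finset.sum_congr rfl fun y hy => ?_
        exact absurd hS (IsLoadChain.nonempty_of_mem hn' hy).ne_empty
      have hb : (S.card : ℝ) ≠ 0 := by exact_mod_cast hS.card_pos.ne'
      have hκ : ∑ _i ∈ S, 1 / (S.card : ℝ) = 1 := by
        rw [Finset.sum_const, nsmul_eq_mul]; field_simp
      set W := fun S : Finset ι => uniformInsertWeight (D + 1) (Fintype.card ι) n S.card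
      set u : Finset ι → ι → ℕ → ℝ := fun _ _ j => 1 / (j.factorial : ℝ) with hu
      have e1 := sum_productLaw_step D n W u hκ G
      have e2 := sum_productLaw_fiber_const (D + 1) n W u S (H (fullCount S))
      refine (Finset.sum_congr rfl fun y hy => ?_).trans (e1.trans
        (Eq.trans ?_ (e2.symm.trans (Finset.sum_congr rfl fun y hy => ?_))))
      · rw [hnf y hy]
      · congr 1
        rw [← Finset.mul_sum, ← capExp_topInd, hu, capExp_uniform, capSum_uniform]
        have := fillRate_mul_uniSum D n (S := S)
        simp only [hH]
        rw [div_eq_mul_one_div, mul_comm _ (1 / (S.card : ℝ))] at this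
        rw [← this]
        ring
      · rw [hnf y hy]
    rw [hRH]
    refine (ih hn' H hHmono).trans ?_
    rw [law_gapInsert D.succ_pos hgap hB hn', law_gapInsert D.succ_pos hgap hB hn',
      sum_loadBox_eq_sum_loadFiber, sum_loadBox_eq_sum_loadFiber]
    -- Under clockwise probing, `H` underestimates the conditional mean on every `S`, since the
    -- actual fill rate is at least the uniform one.
    refine Finset.sum_le_sum fun S _ => ?_
    have hnf : ∀ y ∈ loadFiber (D + 1) n S, nonfull (D + 1) y = S := fun y hy =>
      (mem_loadFiber.1 hy).2
    rcases S.eq_empty_or_nonempty with hS | hS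
    · refine (Finset.sum_congr rfl fun y hy => ?_).le
      exact absurd hS (IsLoadChain.nonempty_of_mem hn' hy).ne_empty
    have hk : (0 : ℝ) < Fintype.card ι := by
      exact_mod_cast hS.card_pos.trans_le S.card_le_univ
    have hκ : ∑ i ∈ S, ((gap S i + 1 : ℕ) : ℝ) / (Fintype.card ι : ℝ) = 1 := by
      rw [← Finset.sum_div, ← Nat.cast_sum, hgap.sum S hS, div_self hk.ne']
    set c := fun _ : Finset ι => (n.factorial : ℝ) / (Fintype.card ι : ℝ) ^ n with hc
    set a : Finset ι → ι → ℕ → ℝ := fun S i j => blockWeight (D + 1) (gap S i) j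
    have e1 := sum_productLaw_step D n c a hκ G
    have e2 := sum_productLaw_fiber_const (D + 1) n c a S (H (fullCount S))
    have e3 : ∑ y ∈ loadFiber (D + 1) n S, productLaw (D + 1) c a y *
        H (fullCount (nonfull (D + 1) y)) =
        ∑ y ∈ loadFiber (D + 1) n S, productLaw (D + 1) c a y * H (fullCount S) :=
      Finset.sum_congr rfl fun y hy => by rw [hnf y hy]
    have e4 : ∑ y ∈ loadFiber (D + 1) n S, productLaw (D + 1) c a y *
        ∑ i ∈ nonfull (D + 1) y, ((gap (nonfull (D + 1) y) i + 1 : ℕ) : ℝ) /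
          (Fintype.card ι : ℝ) * G (fullCount (nonfull (D + 1) (addOne y i))) =
        ∑ y ∈ loadFiber (D + 1) n S, productLaw (D + 1) c a y *
          ∑ i ∈ S, ((gap S i + 1 : ℕ) : ℝ) / (Fintype.card ι : ℝ) *
            G (fullCount (nonfull (D + 1) (addOne y i))) :=
      Finset.sum_congr rfl fun y hy => by rw [hnf y hy]
    rw [e3, e2, e4, e1]
    refine mul_le_mul_of_nonneg_left ?_ (by positivity)
    have h := mul_le_mul_of_nonneg_left (fillRate_mul_capSum_le (D := D) hgap n hS)
      (sub_nonneg.2 (hG (fullCount S).le_succ))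
    simp only [hH]
    linarith

/-- The deficits below each level are smaller in the mean under uniform insertion. -/
theorem deficit_uniform_le_gap (hgap : IsGap gap)
    (hR : IsLoadChain (D + 1) (fun S (_ : ι) => 1 / (S.card : ℝ)) ER)
    (hB : IsLoadChain (D + 1) (fun S i => ((gap S i + 1 : ℕ) : ℝ) / (Fintype.card ι : ℝ)) EB)
    {n : ℕ} (hn : n < Fintype.card ι * (D + 1)) {a : ℕ} (ha : a ≤ D + 1) :
    ER n (fun y => ∑ i, deficit a (y i)) ≤ EB n fun y => ∑ i, deficit a (y i) := by
  set k := Fintype.card ι with hk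
  set E : ℕ → ℝ := fun j => uniExp (D + 1) (deficit a) (k - j) (n - (D + 1) * (j : ℕ)) with hE
  set A : ℕ → ℝ := fun j => uniSum (D + 1) (k - j) (n - (D + 1) * (j : ℕ)) with hA
  have hA0 : ∀ j, 0 ≤ A j := fun j => uniSum_nonneg _ _ _
  set g : ℕ → ℝ := fun j => E j / A j with hg
  -- The conditional mean deficit `g` is known to increase only over the attainable numbers of full
  -- bins, while the stochastic comparison needs a function monotone everywhere.
  obtain ⟨G, hG, hGg⟩ := exists_monotone_extension ((Finset.range (k + 1)).filter fun j => A j ≠ 0)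
    g (fun j => div_nonneg (uniExp_nonneg (deficit_nonneg a) _ _) (hA0 j)) (by
      intro j hj l hl hjl
      rw [Finset.mem_filter, Finset.mem_range] at hj hl
      have h := uniExp_top_cross D ha k n hjl (by omega)
      simp only [hg]
      rwa [div_le_div_iff₀ (lt_of_le_of_ne (hA0 j) hj.2.symm)
        (lt_of_le_of_ne (hA0 l) hl.2.symm)])
  have hcardS : ∀ S : Finset ι, k - fullCount S = S.card := fun S => by
    have := S.card_le_univ
    unfold fullCount
    omega
  have hs : ∀ S : Finset ι, ((n : ℤ) - (D + 1 : ℕ) * (k - S.card : ℕ)) =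
      n - (D + 1) * (fullCount S : ℕ) := fun S => by
    unfold fullCount; push_cast; rfl
  have hAS : ∀ S : Finset ι, A (fullCount S) =
      uniSum (D + 1) S.card (n - (D + 1 : ℕ) * (k - S.card : ℕ)) := fun S => by
    simp only [hA]; rw [hcardS, hs]
  have hES : ∀ S : Finset ι, E (fullCount S) =
      uniExp (D + 1) (deficit a) S.card (n - (D + 1 : ℕ) * (k - S.card : ℕ)) := fun S => by
    simp only [hE]; rw [hcardS, hs]
  have hGS : ∀ S : Finset ι, A (fullCount S) ≠ 0 →
      G (fullCount S) * A (fullCount S) = E (fullCount S) := fun S h => by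
    rw [hGg _ (Finset.mem_filter.2 ⟨Finset.mem_range.2 (by unfold fullCount; omega), h⟩)]
    simp only [hg]
    field_simp
  have hdef : ∀ S : Finset ι, ∀ y ∈ loadFiber (D + 1) n S, ∑ i, deficit a (y i) =
      ∑ i ∈ S, deficit a (y i) := fun S y hy => by
    obtain ⟨-, rfl⟩ := mem_loadFiber.1 hy
    rw [sum_deficit_nonfull ha]
  have hcount : ∀ S : Finset ι, ∀ y ∈ loadFiber (D + 1) n S, G (fullCount (nonfull (D + 1) y)) =
      G (fullCount S) := fun S y hy => by
    rw [(mem_loadFiber.1 hy).2]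
  have eD : ∀ (c : Finset ι → ℝ) (b : Finset ι → ι → ℕ → ℝ) (S : Finset ι),
      ∑ y ∈ loadFiber (D + 1) n S, productLaw (D + 1) c b y * ∑ i, deficit a (y i) =
        c S * capExp (b S) (D + 1) (deficit a) S (n - (D + 1 : ℕ) * (k - S.card : ℕ)) := by
    intro c b S
    rw [← sum_loadFiber_prod_mul_sum, ← sum_productLaw_fiber]
    exact Finset.sum_congr rfl fun y hy => by rw [hdef S y hy]
  have eG : ∀ (c : Finset ι → ℝ) (b : Finset ι → ι → ℕ → ℝ) (S : Finset ι),
      ∑ y ∈ loadFiber (D + 1) n S, productLaw (D + 1) c b y *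
          G (fullCount (nonfull (D + 1) y)) =
        c S * (capSum (b S) (D + 1) S (n - (D + 1 : ℕ) * (k - S.card : ℕ)) *
          G (fullCount S)) := by
    intro c b S
    rw [← sum_productLaw_fiber_const]
    exact Finset.sum_congr rfl fun y hy => by rw [hcount S y hy]
  -- For equal weights the conditional mean given `S` depends only on the number of full bins, so
  -- this is an equality; for clockwise probing it becomes an inequality on each `S`.
  have hRG : ER n (fun y => ∑ i, deficit a (y i)) =
      ER n fun y => G (fullCount (nonfull (D + 1) y)) := by
    rw [law_uniformInsert D.succ_pos hR hn, law_uniformInsert D.succ_pos hR hn,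
      sum_loadBox_eq_sum_loadFiber, sum_loadBox_eq_sum_loadFiber]
    refine Finset.sum_congr rfl fun S _ => ?_
    rw [eD, eG, capExp_uniform, capSum_uniform, ← hAS, ← hES]
    congr 1
    by_cases h : A (fullCount S) = 0
    · rw [h, zero_mul, hES]
      rw [hAS] at h
      exact uniExp_eq_zero_of_uniSum _ h
    · rw [mul_comm, hGS S h]
  rw [hRG]
  refine (fullCount_uniform_le_gap hgap hR hB n hn G hG).trans ?_
  rw [law_gapInsert D.succ_pos hgap hB hn, law_gapInsert D.succ_pos hgap hB hn,
    sum_loadBox_eq_sum_loadFiber, sum_loadBox_eq_sum_loadFiber]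
  refine Finset.sum_le_sum fun S _ => ?_
  rw [eD, eG]
  refine mul_le_mul_of_nonneg_left ?_ (by positivity)
  set w : ι → ℕ → ℝ := fun i j => blockWeight (D + 1) (gap S i) j
  have hw0 : ∀ i j, 0 ≤ w i j := fun i j => (blockWeight_pos _ _ _).le
  have h1 := uniExp_mul_capSum_moment_le (isMomentSeq_gap (D + 1) gap S) ha S
    (n - (D + 1 : ℕ) * (k - S.card : ℕ))
  rw [← hAS, ← hES] at h1
  by_cases h : A (fullCount S) = 0
  · have : capSum w (D + 1) S (n - (D + 1 : ℕ) * (k - S.card : ℕ)) = 0 := by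
      refine capSum_eq_zero _ _ _ _ fun h' => ?_
      have := (uniSum_pos_iff D _ _).2 h'
      rw [← hAS, h] at this
      exact lt_irrefl _ this
    rw [this, zero_mul]
    exact capExp_nonneg (fun i _ j _ => hw0 i j) (fun j _ => deficit_nonneg _ _) _
  · refine le_of_mul_le_mul_right ?_ (lt_of_le_of_ne (hA0 _) (Ne.symm h))
    refine le_trans (le_of_eq ?_) h1
    rw [← hGS S h]
    ring

end compare

/-! ### Gaps on the ring -/

section ring
variable {k : ℕ} [NeZero k]

theorem ofNat_add_eq (s t : ℕ) : Fin.ofNat k (s + t) = Fin.ofNat k s + Fin.ofNat k t := by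
  ext
  simp [Fin.val_add, Nat.add_mod]

theorem ofNat_zero_eq : Fin.ofNat k 0 = 0 := rfl

theorem ofNat_self_eq : Fin.ofNat k k = 0 := by
  ext
  simp

theorem ofNat_val_eq (x : Fin k) : Fin.ofNat k x = x := by
  ext
  simp

theorem ofNat_inj_of_lt {s t : ℕ} (hs : s < k) (ht : t < k) (h : Fin.ofNat k s = Fin.ofNat k t) :
    s = t := by
  have := congrArg Fin.val h
  simpa [Nat.mod_eq_of_lt hs, Nat.mod_eq_of_lt ht] using this

theorem exists_sub_ofNat_succ_mem {S : Finset (Fin k)} (hS : S.Nonempty) (i : Fin k) :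
    ∃ g : ℕ, i - Fin.ofNat k (g + 1) ∈ S := by
  obtain ⟨a, ha⟩ := hS
  refine ⟨(i - a : Fin k).val + (k - 1), ?_⟩
  rw [add_assoc, Nat.sub_add_cancel (NeZero.one_le), ofNat_add_eq, ofNat_self_eq, ofNat_val_eq,
    add_zero, sub_sub_cancel]
  exact ha

theorem exists_add_ofNat_mem {S : Finset (Fin k)} (hS : S.Nonempty) (h : Fin k) :
    ∃ t : ℕ, h + Fin.ofNat k t ∈ S := by
  obtain ⟨a, ha⟩ := hS
  exact ⟨(a - h : Fin k).val, by rwa [ofNat_val_eq, add_sub_cancel]⟩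

open Classical in
/-- The number of consecutive bins outside `S` directly before bin `i`. -/
noncomputable def ringGap (S : Finset (Fin k)) (i : Fin k) : ℕ :=
  if hS : S.Nonempty then Nat.find (exists_sub_ofNat_succ_mem hS i) else 0

open Classical in
/-- The number of steps from bin `h` to the next bin of `S` in clockwise direction. -/
noncomputable def ringDist (S : Finset (Fin k)) (h : Fin k) : ℕ :=
  if hS : S.Nonempty then Nat.find (exists_add_ofNat_mem hS h) else 0

/-- The first bin of `S` from bin `h` on in clockwise direction. -/
noncomputable def ringNext (S : Finset (Fin k)) (h : Fin k) : Fin k :=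
  h + Fin.ofNat k (ringDist S h)

theorem ringGap_eq {S : Finset (Fin k)} {i : Fin k} {g : ℕ} (hg : i - Fin.ofNat k (g + 1) ∈ S)
    (h : ∀ u < g, i - Fin.ofNat k (u + 1) ∉ S) : ringGap S i = g := by
  rw [ringGap, dif_pos ⟨_, hg⟩, Nat.find_eq_iff]
  exact ⟨hg, h⟩

theorem sub_ringGap_mem {S : Finset (Fin k)} (hS : S.Nonempty) (i : Fin k) :
    i - Fin.ofNat k (ringGap S i + 1) ∈ S := by
  rw [ringGap, dif_pos hS]
  exact Nat.find_spec (exists_sub_ofNat_succ_mem hS i)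

theorem sub_notMem_of_lt_ringGap {S : Finset (Fin k)} {i : Fin k} {u : ℕ} (hu : u < ringGap S i) :
    i - Fin.ofNat k (u + 1) ∉ S := by
  rw [ringGap] at hu
  split_ifs at hu with hS
  · exact Nat.find_min _ hu
  · exact absurd hu (Nat.not_lt_zero _)

theorem ringGap_lt {S : Finset (Fin k)} {i : Fin k} (hi : i ∈ S) : ringGap S i < k := by
  by_contra h
  have hk : k - 1 + 1 = k := Nat.sub_add_cancel NeZero.one_le
  have := sub_notMem_of_lt_ringGap (S := S) (i := i) (u := k - 1) (by omega)
  rw [hk, ofNat_self_eq, sub_zero] at this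
  exact this hi

theorem ringDist_eq {S : Finset (Fin k)} {h : Fin k} {t : ℕ} (ht : h + Fin.ofNat k t ∈ S)
    (hlt : ∀ u < t, h + Fin.ofNat k u ∉ S) : ringDist S h = t := by
  rw [ringDist, dif_pos ⟨_, ht⟩, Nat.find_eq_iff]
  exact ⟨ht, hlt⟩

theorem ringNext_mem {S : Finset (Fin k)} (hS : S.Nonempty) (h : Fin k) : ringNext S h ∈ S := by
  rw [ringNext, ringDist, dif_pos hS]
  exact Nat.find_spec (exists_add_ofNat_mem hS h)

theorem notMem_of_lt_ringDist {S : Finset (Fin k)} {h : Fin k} {u : ℕ} (hu : u < ringDist S h) :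
    h + Fin.ofNat k u ∉ S := by
  rw [ringDist] at hu
  split_ifs at hu with hS
  · exact Nat.find_min _ hu
  · exact absurd hu (Nat.not_lt_zero _)

theorem ringDist_sub {S : Finset (Fin k)} {i : Fin k} (hi : i ∈ S) {t : ℕ}
    (ht : t ≤ ringGap S i) : ringDist S (i - Fin.ofNat k t) = t := by
  refine ringDist_eq (by rwa [sub_add_cancel]) fun u hu => ?_
  obtain ⟨w, rfl⟩ := Nat.exists_eq_add_of_lt hu
  have : i - Fin.ofNat k (u + w + 1) + Fin.ofNat k u = i - Fin.ofNat k (w + 1) := by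
    rw [add_assoc u, ofNat_add_eq u]
    abel
  rw [this]
  exact sub_notMem_of_lt_ringGap (by omega)

theorem ringNext_sub {S : Finset (Fin k)} {i : Fin k} (hi : i ∈ S) {t : ℕ}
    (ht : t ≤ ringGap S i) : ringNext S (i - Fin.ofNat k t) = i := by
  rw [ringNext, ringDist_sub hi ht, sub_add_cancel]

theorem ringNext_sub_ringDist (S : Finset (Fin k)) (h : Fin k) :
    ringNext S h - Fin.ofNat k (ringDist S h) = h := by
  rw [ringNext, add_sub_cancel_right]

theorem ringDist_le_ringGap {S : Finset (Fin k)} (hS : S.Nonempty) (h : Fin k) :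
    ringDist S h ≤ ringGap S (ringNext S h) := by
  by_contra hlt
  rw [not_le] at hlt
  obtain ⟨w, hw⟩ := Nat.exists_eq_add_of_lt hlt
  have h1 := sub_ringGap_mem hS (ringNext S h)
  have : ringNext S h - Fin.ofNat k (ringGap S (ringNext S h) + 1) = h + Fin.ofNat k w := by
    set g := ringGap S (ringNext S h)
    rw [ringNext, hw, show g + w + 1 = w + (g + 1) by omega, ofNat_add_eq w]
    abel
  rw [this] at h1
  exact notMem_of_lt_ringDist (by omega) h1

/-- Bin `i` is the first one of `S` for itself and the bins of the gap before it. -/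
theorem card_filter_ringNext {S : Finset (Fin k)} {i : Fin k} (hi : i ∈ S) :
    (Finset.univ.filter fun h => ringNext S h = i).card = ringGap S i + 1 := by
  rw [← Finset.card_range (ringGap S i + 1)]
  refine (Finset.card_nbij' (fun t => i - Fin.ofNat k t) (ringDist S) ?_ ?_ ?_ ?_).symm
  · intro t ht
    rw [Finset.mem_coe, Finset.mem_range] at ht
    simpa using ringNext_sub hi (by omega : t ≤ _)
  · intro h hh
    have hh : ringNext S h = i := by simpa using hh
    have := ringDist_le_ringGap ⟨i, hi⟩ h
    rw [hh] at this
    simpa using Nat.lt_succ_of_le this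
  · intro t ht
    rw [Finset.mem_coe, Finset.mem_range] at ht
    exact ringDist_sub hi (by omega)
  · intro h hh
    have hh : ringNext S h = i := by simpa using hh
    have := ringNext_sub_ringDist S h
    rwa [hh] at this

/-- The fibres of `ringNext S` partition the ring into the blocks of the bins `i ∈ S`. A bin `h`
outside `S` lies in exactly one block and, when added to `S`, cuts its gap into the part before `h`
and the part between `h` and `i`; all other gaps are unchanged. -/
theorem isGap_ringGap : IsGap (ringGap : Finset (Fin k) → Fin k → ℕ) where
  univ i := ringGap_eq (Finset.mem_univ _) fun _ h => absurd h (Nat.not_lt_zero _)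
  sum S hS := by
    rw [← Finset.card_univ, Finset.card_eq_sum_card_fiberwise (f := ringNext S) (t := S)
      fun h _ => ringNext_mem hS h]
    exact Finset.sum_congr rfl fun i hi => (card_filter_ringNext hi).symm
  insert S hS f v := by
    rw [← Finset.sum_fiberwise_of_maps_to (g := ringNext S) (t := S)
      fun h _ => ringNext_mem hS h]
    refine Finset.sum_congr rfl fun i hi => ?_
    have hlt := ringGap_lt hi
    symm
    -- The parameter `t` is the number of full bins of the block that lie before `h`, so `h` sits
    -- `ringGap S i - t` steps before `i`.
    refine Finset.sum_nbij' (fun t => i - Fin.ofNat k (ringGap S i - t))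
      (fun h => ringGap S i - ringDist S h) ?_ ?_ ?_ ?_ ?_
    · intro t ht
      rw [Finset.mem_range] at ht
      rw [Finset.mem_filter, Finset.mem_compl]
      obtain ⟨w, hw⟩ : ∃ w, ringGap S i - t = w + 1 := ⟨ringGap S i - t - 1, by omega⟩
      refine ⟨?_, ringNext_sub hi (by omega)⟩
      rw [hw]
      exact sub_notMem_of_lt_ringGap (by omega)
    · intro h hh
      rw [Finset.mem_filter, Finset.mem_compl] at hh
      have hpos : ringDist S h ≠ 0 := fun h0 => by
        have := ringNext_mem hS h
        rw [ringNext, h0, ofNat_zero_eq, add_zero] at this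
        exact hh.1 this
      have := ringDist_le_ringGap hS h
      rw [hh.2] at this
      rw [Finset.mem_range]
      omega
    · intro t ht
      rw [Finset.mem_range] at ht
      rw [ringDist_sub hi (by omega)]
      omega
    · intro h hh
      rw [Finset.mem_filter] at hh
      have h1 := ringDist_le_ringGap hS h
      have h2 := ringNext_sub_ringDist S h
      rw [hh.2] at h1 h2
      rw [Nat.sub_sub_self h1, h2]
    · intro t ht
      rw [Finset.mem_range] at ht
      obtain ⟨s, hs⟩ : ∃ s, ringGap S i = t + (s + 1) := ⟨ringGap S i - t - 1, by omega⟩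
      have hst : ringGap S i - t = s + 1 := by omega
      rw [hst]
      set h := i - Fin.ofNat k (s + 1) with hh
      have g1 : ringGap (insert h S) h = t := by
        have e : ∀ u, h - Fin.ofNat k (u + 1) = i - Fin.ofNat k (s + u + 1 + 1) := fun u => by
          rw [show s + u + 1 + 1 = (s + 1) + (u + 1) by omega, ofNat_add_eq (s + 1), hh]
          abel
        refine ringGap_eq (Finset.mem_insert_of_mem ?_) fun u hu => ?_
        · rw [e, show s + t + 1 = ringGap S i by omega]
          exact sub_ringGap_mem hS i
        · rw [Finset.mem_insert, not_or]
          refine ⟨fun h0 => ?_, ?_⟩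
          · rw [sub_eq_self, ← ofNat_zero_eq] at h0
            exact absurd (ofNat_inj_of_lt (by omega) (by omega) h0) (by omega)
          · rw [e]
            exact sub_notMem_of_lt_ringGap (by omega)
      have g2 : ringGap (insert h S) i = s := by
        refine ringGap_eq (Finset.mem_insert_self _ _) fun u hu => ?_
        rw [Finset.mem_insert, not_or]
        refine ⟨fun h0 => ?_, sub_notMem_of_lt_ringGap (by omega)⟩
        rw [hh, sub_right_inj] at h0
        exact absurd (ofNat_inj_of_lt (by omega) (by omega) h0) (by omega)
      have g3 : ∀ l ∈ S.erase i, ringGap (insert h S) l = ringGap S l := by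
        intro l hl
        rw [Finset.mem_erase] at hl
        refine ringGap_eq (Finset.mem_insert_of_mem (sub_ringGap_mem hS l)) fun u hu => ?_
        rw [Finset.mem_insert, not_or]
        refine ⟨fun h0 => hl.1 ?_, sub_notMem_of_lt_ringGap hu⟩
        rw [← ringNext_sub hl.2 (show u + 1 ≤ ringGap S l by omega), h0, hh,
          ringNext_sub hi (by omega)]
      rw [← Finset.mul_prod_erase S _ hi, g1, g2, show ringGap S i - 1 - t = s by omega]
      congr 2
      exact Finset.prod_congr rfl fun l hl => by rw [g3 l hl]

/-- Clockwise probing finds the first available bin from the hash value on. -/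
theorem placeObject_clockwise {C : ℕ} {y : Fin k → ℕ} (hy : (nonfull C y).Nonempty) (b : Fin k) :
    placeObject C y (fun t => b + Fin.ofNat k t) = addOne y (ringNext (nonfull C y) b) := by
  have hp : ∃ t, y (b + Fin.ofNat k t) < C :=
    (exists_add_ofNat_mem hy b).imp fun t ht => mem_nonfull.1 ht
  have hd : ringDist (nonfull C y) b = Nat.find hp :=
    ringDist_eq (mem_nonfull.2 (Nat.find_spec hp)) fun u hu h => Nat.find_min hp hu
      (mem_nonfull.1 h)
  unfold placeObject
  rw [dif_pos hp, addOne, ringNext, hd]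

theorem sum_ringNext {S : Finset (Fin k)} (hS : S.Nonempty) (G : Fin k → ℝ) :
    ∑ b, G (ringNext S b) = ∑ i ∈ S, ((ringGap S i + 1 : ℕ) : ℝ) * G i := by
  rw [← Finset.sum_fiberwise_of_maps_to (g := ringNext S) (t := S)
    fun h _ => ringNext_mem hS h]
  refine Finset.sum_congr rfl fun i hi => ?_
  rw [Finset.sum_congr rfl fun b hb => congrArg G (Finset.mem_filter.1 hb).2, Finset.sum_const,
    card_filter_ringNext hi, nsmul_eq_mul]

end ring

/-! ### The placement rules as load chains -/

section process
variable {k : ℕ}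

theorem placeObject_comp_equiv (C : ℕ) (e : Equiv.Perm (Fin k)) (y : Fin k → ℕ) (p : ℕ → Fin k) :
    placeObject C (fun i => y (e.symm i)) (fun t => e (p t)) =
      fun i => placeObject C y p (e.symm i) := by
  unfold placeObject
  by_cases h : ∃ t, y (p t) < C
  · have h' : ∃ t, y (e.symm (e (p t))) < C := by simpa using h
    have hf : Nat.find h' = Nat.find h := Nat.find_congr' (by simp)
    rw [dif_pos h, dif_pos h', hf]
    ext i
    simp only [Function.update_apply, Equiv.symm_apply_eq, Equiv.symm_apply_apply]
  · have h' : ¬ ∃ t, y (e.symm (e (p t))) < C := by simpa using h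
    rw [dif_neg h, dif_neg h']

/-- Renumbering the bins of all probes renumbers the loads. -/
theorem finalLoad_comp_equiv (C : ℕ) (e : Equiv.Perm (Fin k)) : ∀ (n : ℕ) (p : Fin n → ℕ → Fin k),
    finalLoad C n (fun j t => e (p j t)) = fun i => finalLoad C n p (e.symm i)
  | 0, _ => rfl
  | n + 1, p => by
    have ih := finalLoad_comp_equiv C e n fun j => p j.castSucc
    simp only [finalLoad]
    rw [ih, placeObject_comp_equiv]

theorem sum_finalLoad_le (C : ℕ) : ∀ (n : ℕ) (p : Fin n → ℕ → Fin k),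
    ∑ i, finalLoad C n p i ≤ n
  | 0, _ => by simp [finalLoad]
  | n + 1, p => by
    have ih := sum_finalLoad_le C n fun j => p j.castSucc
    simp only [finalLoad]
    unfold placeObject
    split_ifs with h
    · have := sum_update_eq (finalLoad C n fun j => p j.castSucc) (p (Fin.last n) (Nat.find h))
        (finalLoad C n (fun j => p j.castSucc) (p (Fin.last n) (Nat.find h)) + 1)
      omega
    · omega

theorem placeObject_eq_addOne_iff {C : ℕ} {y : Fin k → ℕ} {p : ℕ → Fin k} {i : Fin k} :
    placeObject C y p = addOne y i ↔
      ∃ t, p t = i ∧ y (p t) < C ∧ ∀ u < t, ¬ y (p u) < C := by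
  have hinj : ∀ b, addOne y b = addOne y i → b = i := fun b h => by
    by_contra hb
    have := congrFun h b
    simp [addOne, hb] at this
  unfold placeObject
  split_ifs with hp
  · constructor
    · intro h
      exact ⟨Nat.find hp, hinj _ h, Nat.find_spec hp, fun u hu => Nat.find_min hp hu⟩
    · rintro ⟨t, rfl, h1, h2⟩
      rw [(Nat.find_eq_iff hp).2 ⟨h1, h2⟩, addOne]
  · constructor
    · intro h
      have := congrFun h i
      simp [addOne] at this
    · rintro ⟨t, -, h, -⟩
      exact absurd ⟨t, h⟩ hp

theorem exists_abs_le_of_le (C : ℕ) (F : (Fin k → ℕ) → ℝ) :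
    ∃ M, ∀ y : Fin k → ℕ, (∀ i, y i ≤ C) → |F y| ≤ M := by
  refine ⟨∑ y ∈ Fintype.piFinset fun _ => Finset.range (C + 1), |F y|, fun y hy => ?_⟩
  refine Finset.single_le_sum (f := fun y => |F y|) (fun _ _ => abs_nonneg _) ?_
  rw [Fintype.mem_piFinset]
  exact fun i => Finset.mem_range_succ_iff.2 (hy i)

theorem integrable_of_le {Ω : Type*} [MeasurableSpace Ω] (μ : Measure Ω) [IsFiniteMeasure μ]
    {C : ℕ} {X : Ω → Fin k → ℕ} (hX : Measurable X) (hC : ∀ ω i, X ω i ≤ C)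
    (F : (Fin k → ℕ) → ℝ) : Integrable (fun ω => F (X ω)) μ := by
  obtain ⟨M, hM⟩ := exists_abs_le_of_le C F
  exact Integrable.of_bound ((measurable_of_countable F).comp hX).aestronglyMeasurable M
    (Filter.Eventually.of_forall fun ω => hM _ (hC ω))

theorem placeObject_le {C : ℕ} {y : Fin k → ℕ} (hy : ∀ i, y i ≤ C) (p : ℕ → Fin k) (i : Fin k) :
    placeObject C y p i ≤ C := by
  unfold placeObject
  split_ifs with hp
  · have := Nat.find_spec hp
    rw [Function.update_apply]
    split_ifs
    · omega
    · exact hy i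
  · exact hy i

theorem measurable_finalLoad_comp (C n : ℕ) {Φ : (ℕ → Fin k) → ℕ → Fin k} (hΦ : Measurable Φ) :
    Measurable fun h : Fin n → ℕ → Fin k => finalLoad C n fun j => Φ (h j) :=
  (measurable_finalLoad C n).comp
    (measurable_pi_lambda _ fun j => hΦ.comp (measurable_pi_apply j))

variable [NeZero k]

/-- The law of the hash values of one object. -/
noncomputable def probeLaw (k : ℕ) [NeZero k] : Measure (ℕ → Fin k) :=
  Measure.infinitePi fun _ => (PMF.uniformOfFintype (Fin k)).toMeasure

instance : IsProbabilityMeasure (probeLaw k) := by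
  unfold probeLaw; infer_instance

instance (n : ℕ) : IsProbabilityMeasure (hashLaw k n) := by
  unfold hashLaw; infer_instance

theorem hashLaw_eq_pi (n : ℕ) : hashLaw k n = Measure.pi fun _ => probeLaw k := rfl

/-- The mean of a function of the loads after `n` steps if the hash values `p` of an object lead
to the probing order `Φ p`. -/
noncomputable def loadMean (C : ℕ) (Φ : (ℕ → Fin k) → ℕ → Fin k) (n : ℕ) (F : (Fin k → ℕ) → ℝ) :
    ℝ :=
  ∫ h, F (finalLoad C n fun j => Φ (h j)) ∂hashLaw k n

theorem integrable_loadMean (C n : ℕ) {Φ : (ℕ → Fin k) → ℕ → Fin k} (hΦ : Measurable Φ)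
    (F : (Fin k → ℕ) → ℝ) :
    Integrable (fun h => F (finalLoad C n fun j => Φ (h j))) (hashLaw k n) :=
  integrable_of_le _ (measurable_finalLoad_comp C n hΦ) (fun _ => finalLoad_le C n _) F

theorem loadMean_succ (C n : ℕ) {Φ : (ℕ → Fin k) → ℕ → Fin k} (hΦ : Measurable Φ)
    (F : (Fin k → ℕ) → ℝ) : loadMean C Φ (n + 1) F =
      ∫ h, ∫ p, F (placeObject C (finalLoad C n fun j => Φ (h j)) (Φ p)) ∂probeLaw k
        ∂hashLaw k n := by
  have hmp := measurePreserving_piFinSuccAbove (fun _ : Fin (n + 1) => probeLaw k) (Fin.last n)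
  set G : (ℕ → Fin k) × (Fin n → ℕ → Fin k) → ℝ := fun x =>
    F (placeObject C (finalLoad C n fun j => Φ (x.2 j)) (Φ x.1)) with hG
  have h1 : loadMean C Φ (n + 1) F = ∫ x, G x ∂(probeLaw k).prod (hashLaw k n) := by
    rw [hashLaw_eq_pi, ← hmp.integral_comp']
    unfold loadMean
    rw [hashLaw_eq_pi]
    refine integral_congr_ae (Filter.Eventually.of_forall fun h => ?_)
    simp only [hG, finalLoad, MeasurableEquiv.piFinSuccAbove_apply]
    simp [Fin.insertNthEquiv]
    rfl
  rw [h1, integral_prod_symm]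
  refine integrable_of_le (C := C) _ ?_ (fun x => placeObject_le (finalLoad_le C n _) _) F
  exact (measurable_placeObject C).comp
    (((measurable_finalLoad_comp C n hΦ).comp measurable_snd).prodMk (hΦ.comp measurable_fst))

/-- A placement rule leads to a chain of loads if the place of an object depends only on the set
of non-full bins. -/
theorem isLoadChain_loadMean {C : ℕ} {Φ : (ℕ → Fin k) → ℕ → Fin k} (hΦ : Measurable Φ)
    {κ : Finset (Fin k) → Fin k → ℝ}
    (hstep : ∀ y : Fin k → ℕ, (nonfull C y).Nonempty → ∀ F : (Fin k → ℕ) → ℝ,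
      ∫ p, F (placeObject C y (Φ p)) ∂probeLaw k =
        ∑ i ∈ nonfull C y, κ (nonfull C y) i * F (addOne y i)) :
    IsLoadChain C κ (loadMean C Φ) where
  zero F := by simp [loadMean, finalLoad]
  succ n F hn := by
    rw [loadMean_succ C n hΦ]
    exact integral_congr_ae (Filter.Eventually.of_forall fun h =>
      hstep _ (nonfull_nonempty_of_lt hn (sum_finalLoad_le C n _)) F)

theorem measurePreserving_eval_probeLaw (t : ℕ) :
    MeasurePreserving (Function.eval t) (probeLaw k) (PMF.uniformOfFintype (Fin k)).toMeasure :=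
  measurePreserving_eval_infinitePi _ t

theorem measurePreserving_perm_uniform (e : Equiv.Perm (Fin k)) :
    MeasurePreserving e (PMF.uniformOfFintype (Fin k)).toMeasure
      (PMF.uniformOfFintype (Fin k)).toMeasure := by
  refine ⟨measurable_of_countable _, Measure.ext_of_singleton fun b => ?_⟩
  rw [Measure.map_apply (measurable_of_countable _) (measurableSet_singleton b)]
  have : e ⁻¹' {b} = {e.symm b} := by
    ext x; simp [Equiv.eq_symm_apply]
  rw [this, PMF.toMeasure_apply_singleton _ _ (measurableSet_singleton _),
    PMF.toMeasure_apply_singleton _ _ (measurableSet_singleton _)]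
  simp

theorem measurePreserving_perm_probeLaw (e : Equiv.Perm (Fin k)) :
    MeasurePreserving (fun (p : ℕ → Fin k) t => e (p t)) (probeLaw k) (probeLaw k) := by
  refine ⟨measurable_pi_lambda _ fun t =>
    (measurable_of_countable e).comp (measurable_pi_apply t), ?_⟩
  unfold probeLaw
  rw [Measure.infinitePi_map_pi _ (fun _ => measurable_of_countable e)]
  simp_rw [(measurePreserving_perm_uniform e).map_eq]

theorem measurePreserving_perm_hashLaw (n : ℕ) (e : Equiv.Perm (Fin k)) :
    MeasurePreserving (fun (h : Fin n → ℕ → Fin k) j t => e (h j t)) (hashLaw k n)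
      (hashLaw k n) :=
  measurePreserving_pi _ _ fun _ => measurePreserving_perm_probeLaw e

/-- The probing order of an object under clockwise probing. -/
def clockwise (p : ℕ → Fin k) (t : ℕ) : Fin k := p 0 + Fin.ofNat k t

theorem measurable_clockwise : Measurable (clockwise : (ℕ → Fin k) → ℕ → Fin k) :=
  measurable_pi_lambda _ fun t =>
    (measurable_of_countable fun b : Fin k => b + Fin.ofNat k t).comp (measurable_pi_apply 0)

theorem isLoadChain_clockwise (C : ℕ) :
    IsLoadChain C (fun S i => ((ringGap S i + 1 : ℕ) : ℝ) / (Fintype.card (Fin k) : ℝ))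
      (loadMean C (clockwise (k := k))) := by
  refine isLoadChain_loadMean measurable_clockwise fun y hy F => ?_
  have h1 : ∀ p : ℕ → Fin k, F (placeObject C y (clockwise p)) =
      F (addOne y (ringNext (nonfull C y) (p 0))) := fun p =>
    congrArg F (placeObject_clockwise hy (p 0))
  have h := (measurePreserving_eval_probeLaw (k := k) 0).map_eq
  have h2 : ∫ p : ℕ → Fin k, F (addOne y (ringNext (nonfull C y) (p 0))) ∂probeLaw k =
      ∫ b, F (addOne y (ringNext (nonfull C y) b)) ∂(PMF.uniformOfFintype (Fin k)).toMeasure := by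
    rw [← h, integral_map (measurable_pi_apply 0).aemeasurable
      (measurable_of_countable _).aestronglyMeasurable]
  refine ((integral_congr_ae (Filter.Eventually.of_forall h1)).trans h2).trans ?_
  rw [PMF.integral_eq_sum]
  simp only [PMF.uniformOfFintype_apply, smul_eq_mul]
  rw [← Finset.mul_sum, sum_ringNext hy fun i => F (addOne y i), Finset.mul_sum]
  refine Finset.sum_congr rfl fun i _ => ?_
  rw [ENNReal.toReal_inv, ENNReal.toReal_natCast]
  ring

/-- Missing one fixed bin of `S` in `m` probes has probability `r ^ m` with `r < 1`. -/
theorem ae_exists_mem_of_nonempty {S : Finset (Fin k)} (hS : S.Nonempty) :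
    ∀ᵐ p ∂probeLaw k, ∃ t, p t ∈ S := by
  obtain ⟨b, hb⟩ := hS
  set r := (PMF.uniformOfFintype (Fin k)).toMeasure {b}ᶜ with hr
  have hr1 : r < 1 := by
    rw [hr, prob_compl_eq_one_sub (measurableSet_singleton b),
      PMF.toMeasure_apply_singleton _ _ (measurableSet_singleton b)]
    exact ENNReal.sub_lt_self ENNReal.one_ne_top one_ne_zero (by simp)
  rw [ae_iff]
  have hle : ∀ m : ℕ, probeLaw k {p | ¬ ∃ t, p t ∈ S} ≤ r ^ m := fun m => by
    calc _ ≤ probeLaw k (Set.pi (Finset.range m) fun _ => {b}ᶜ) := by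
          refine measure_mono fun p hp t _ hbt => hp ⟨t, ?_⟩
          rwa [hbt]
      _ = r ^ m := by
          unfold probeLaw
          rw [Measure.infinitePi_pi _ fun _ _ => (measurableSet_singleton b).compl]
          simp [hr]
  exact le_antisymm (ge_of_tendsto' (ENNReal.tendsto_pow_atTop_nhds_zero_of_lt_one hr1) hle)
    zero_le

/-- Interchanging two non-full bins preserves the law of the probes and the set of full bins, so all
non-full bins are equally likely to be chosen; almost surely one of them is. -/
theorem isLoadChain_uniform (C : ℕ) :
    IsLoadChain C (fun S (_ : Fin k) => 1 / (S.card : ℝ)) (loadMean C id) := by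
  refine isLoadChain_loadMean measurable_id fun y hy F => ?_
  set A : Fin k → Set (ℕ → Fin k) := fun i => {p | placeObject C y p = addOne y i} with hA
  have hAm : ∀ i, MeasurableSet (A i) := fun i =>
    ((measurable_placeObject C).comp (measurable_const.prodMk measurable_id))
      (measurableSet_singleton (addOne y i))
  have hsum : ∀ F : (Fin k → ℕ) → ℝ, ∫ p, F (placeObject C y p) ∂probeLaw k =
      ∑ i ∈ nonfull C y, (probeLaw k).real (A i) * F (addOne y i) := by
    intro F
    have h1 : ∀ᵐ p ∂probeLaw k, F (placeObject C y p) =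
        ∑ i ∈ nonfull C y, (A i).indicator (fun _ => F (addOne y i)) p := by
      filter_upwards [ae_exists_mem_of_nonempty hy] with p hp
      have hp' : ∃ t, y (p t) < C := hp.imp fun t ht => mem_nonfull.1 ht
      set i := p (Nat.find hp') with hi
      have hpi : placeObject C y p = addOne y i := placeObject_eq_addOne_iff.2
        ⟨_, rfl, Nat.find_spec hp', fun u hu => Nat.find_min hp' hu⟩
      rw [Finset.sum_eq_single_of_mem i (mem_nonfull.2 (Nat.find_spec hp')), hpi,
        Set.indicator_of_mem (show p ∈ A i from hpi)]
      intro l _ hl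
      refine Set.indicator_of_notMem (fun h => hl ?_) _
      have h : placeObject C y p = addOne y l := h
      rw [hpi] at h
      by_contra hne
      have := congrFun h l
      simp [addOne, hne] at this
    rw [integral_congr_ae h1, integral_finsetSum _ fun i _ =>
      (integrable_const _).indicator (hAm i)]
    refine Finset.sum_congr rfl fun i _ => ?_
    rw [integral_indicator_const _ (hAm i), smul_eq_mul]
  have hsymm : ∀ i ∈ nonfull C y, ∀ l ∈ nonfull C y,
      (probeLaw k).real (A i) = (probeLaw k).real (A l) := by
    intro i hi l hl
    rw [mem_nonfull] at hi hl
    have hy' : ∀ b, y (Equiv.swap i l b) < C ↔ y b < C := by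
      intro b
      rw [Equiv.swap_apply_def]
      split_ifs with h1 h2
      · simp [h1, hi, hl]
      · simp [h2, hi, hl]
      · rfl
    have h := (measurePreserving_perm_probeLaw (Equiv.swap i l)).measureReal_preimage
      (hAm l).nullMeasurableSet
    rw [← h]
    congr 1
    ext p
    simp only [hA, Set.mem_preimage, Set.mem_ofPred_eq, placeObject_eq_addOne_iff, hy']
    refine exists_congr fun t => and_congr_left fun _ => ?_
    rw [Equiv.swap_apply_eq_iff, Equiv.swap_apply_right]
  obtain ⟨b, hb⟩ := hy
  -- The constant function determines the common probability.
  have hone := hsum fun _ => 1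
  rw [Finset.sum_congr rfl fun i hi => by rw [hsymm i hi b hb, mul_one]] at hone
  rw [Finset.sum_const, nsmul_eq_mul] at hone
  have hc : ((nonfull C y).card : ℝ) ≠ 0 := by
    exact_mod_cast (Finset.card_pos.2 ⟨b, hb⟩).ne'
  have hval : (probeLaw k).real (A b) = 1 / ((nonfull C y).card : ℝ) := by
    rw [eq_div_iff hc, mul_comm, ← hone]
    simp
  refine (hsum F).trans (Finset.sum_congr rfl fun i hi => ?_)
  rw [hsymm i hi b hb, hval]

/-- Rotating all hash values by `i - l` preserves their law and rotates the loads, provided that the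
probing rule commutes with rotations. -/
theorem loadMean_apply_eq (C n : ℕ) {Φ : (ℕ → Fin k) → ℕ → Fin k} (hΦ : Measurable Φ)
    (hrot : ∀ c p, Φ (fun t => p t + c) = fun t => Φ p t + c) (φ : ℕ → ℝ) (i l : Fin k) :
    loadMean C Φ n (fun y => φ (y i)) = loadMean C Φ n fun y => φ (y l) := by
  have h := measurePreserving_perm_hashLaw n (Equiv.addRight (i - l))
  unfold loadMean
  conv_lhs => rw [← h.map_eq]
  rw [integral_map h.measurable.aemeasurable
    (integrable_of_le _ (measurable_finalLoad_comp C n hΦ) (fun _ => finalLoad_le C n _)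
      fun y => φ (y i)).aestronglyMeasurable]
  refine integral_congr_ae (Filter.Eventually.of_forall fun x => ?_)
  have e := congrFun (finalLoad_comp_equiv C (Equiv.addRight (i - l)) n fun j => Φ (x j)) i
  simp only [Equiv.coe_addRight, Equiv.addRight_symm, neg_sub, add_sub_cancel] at e
  simp only [Equiv.coe_addRight, hrot, e]

/-- By rotation symmetry the mean of a function of one load is the average over all bins. -/
theorem loadMean_apply_eq_div (C n : ℕ) {Φ : (ℕ → Fin k) → ℕ → Fin k} (hΦ : Measurable Φ)
    (hrot : ∀ c p, Φ (fun t => p t + c) = fun t => Φ p t + c) (φ : ℕ → ℝ) (i : Fin k) :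
    loadMean C Φ n (fun y => φ (y i)) = loadMean C Φ n (fun y => ∑ l, φ (y l)) / k := by
  have h : loadMean C Φ n (fun y => ∑ l, φ (y l)) = ∑ l, loadMean C Φ n fun y => φ (y l) :=
    integral_finsetSum _ fun l _ => integrable_loadMean C n hΦ fun y => φ (y l)
  rw [h, Finset.sum_congr rfl fun l _ => loadMean_apply_eq C n hΦ hrot φ l i, Finset.sum_const,
    Finset.card_univ, Fintype.card_fin, nsmul_eq_mul,
    mul_div_cancel_left₀ _ (Nat.cast_ne_zero.2 (NeZero.ne k))]

end process

/-! ### Reduction of convex functions to deficits -/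

section convex

/-- A function on `{0, …, D + 1}` is a combination of deficits, with its second differences as
coefficients, up to an affine function. -/
theorem eq_affine_add_sum_deficit (φ : ℕ → ℝ) (D : ℕ) {x : ℕ} (hx : x ≤ D + 1) :
    φ x = φ (D + 1) + ((D : ℝ) + 1 - x) * (φ D - φ (D + 1)) +
      ∑ b ∈ Finset.range D, (φ (b + 2) - 2 * φ (b + 1) + φ b) * deficit (b + 1) x := by
  induction D with
  | zero =>
    interval_cases x <;> simp
  | succ D ih =>
    rw [Finset.sum_range_succ]
    rcases Nat.lt_or_ge (D + 1) x with h | h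
    · obtain rfl : x = D + 1 + 1 := le_antisymm hx h
      have : ∀ b ∈ Finset.range D, (φ (b + 2) - 2 * φ (b + 1) + φ b) *
          deficit (b + 1) (D + 1 + 1) = 0 := fun b hb => by
        rw [Finset.mem_range] at hb
        rw [deficit, Nat.sub_eq_zero_of_le (by omega), Nat.cast_zero, mul_zero]
      rw [Finset.sum_eq_zero this, deficit, Nat.sub_eq_zero_of_le (by omega)]
      push_cast
      ring
    · have e := ih h
      have hd : deficit (D + 1) x = (D : ℝ) + 1 - x := by
        rw [deficit, Nat.cast_sub h]
        push_cast
        ring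
      rw [hd]
      push_cast
      linear_combination e

end convex

section chain
variable {ι : Type*} [Fintype ι] [DecidableEq ι]

/-- The mean only depends on the values at the load vectors with the right total. -/
theorem IsLoadChain.congr {C : ℕ} {κ : Finset ι → ι → ℝ} {E : ℕ → ((ι → ℕ) → ℝ) → ℝ}
    (hE : IsLoadChain C κ E) (n : ℕ) (hn : n ≤ Fintype.card ι * C) :
    ∀ F F' : (ι → ℕ) → ℝ, (∀ y ∈ loadBox ι C n, F y = F' y) → E n F = E n F' := by
  induction n with
  | zero =>
    intro F F' h
    rw [hE.zero, hE.zero]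
    exact h _ (by simp [loadBox_zero])
  | succ n ih =>
    intro F F' h
    rw [hE.succ n F hn, hE.succ n F' hn]
    refine ih (by omega) _ _ fun y hy => Finset.sum_congr rfl fun i hi => ?_
    rw [h]
    rw [mem_loadBox] at hy ⊢
    rw [mem_nonfull] at hi
    refine ⟨fun l => ?_, ?_⟩
    · rw [addOne, Function.update_apply]
      split_ifs
      · omega
      · exact hy.1 l
    · have := sum_update_eq y i (y i + 1)
      rw [addOne]
      omega

theorem loadBox_full {C : ℕ} {y : ι → ℕ} (hy : y ∈ loadBox ι C (Fintype.card ι * C)) (i : ι) :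
    y i = C := by
  rw [mem_loadBox] at hy
  have h : ∑ i, y i = ∑ _i : ι, C := by
    rw [hy.2, Finset.sum_const, Finset.card_univ, smul_eq_mul]
  exact (Finset.sum_eq_sum_iff_of_le fun i _ => hy.1 i).1 h i (Finset.mem_univ i)

end chain

theorem numFull_eq_sum {k : ℕ} (C : ℕ) (y : Fin k → ℕ) : (numFull C y : ℝ) = ∑ i, topInd C (y i) := by
  simp [numFull, topInd]

section compare
variable {k : ℕ} [NeZero k]

/-- The case `n = k * C` is not covered by the product-form laws, which need a non-full bin, but
there all loads equal `C`. -/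
theorem loadMean_eq_of_full {C n : ℕ} {Φ : (ℕ → Fin k) → ℕ → Fin k}
    {κ : Finset (Fin k) → Fin k → ℝ} (h : IsLoadChain C κ (loadMean C Φ)) (hn : n = k * C)
    (φ : ℕ → ℝ) : loadMean C Φ n (fun y => ∑ i, φ (y i)) = k * φ C := by
  rw [h.congr n (by rw [Fintype.card_fin, hn]) _ (fun _ => k * φ C)]
  · simp [loadMean]
  · intro y hy
    have hy' : y ∈ loadBox (Fin k) C (Fintype.card (Fin k) * C) := by
      rwa [Fintype.card_fin, ← hn]
    simp [loadBox_full hy']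

/-- The affine part of `φ` sums to a constant because the total load is `n`; only the deficits
remain random. -/
theorem loadMean_eq_sum_deficit {D n : ℕ} {Φ : (ℕ → Fin k) → ℕ → Fin k} (hΦ : Measurable Φ)
    {κ : Finset (Fin k) → Fin k → ℝ} (h : IsLoadChain (D + 1) κ (loadMean (D + 1) Φ))
    (hn : n ≤ k * (D + 1)) (φ : ℕ → ℝ) :
    loadMean (D + 1) Φ n (fun y => ∑ i, φ (y i)) =
      k * φ (D + 1) + (k * ((D : ℝ) + 1) - n) * (φ D - φ (D + 1)) +
        ∑ b ∈ Finset.range D, (φ (b + 2) - 2 * φ (b + 1) + φ b) *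
          loadMean (D + 1) Φ n fun y => ∑ i, deficit (b + 1) (y i) := by
  rw [h.congr n (by rwa [Fintype.card_fin]) _ (fun y => k * φ (D + 1) +
    (k * ((D : ℝ) + 1) - n) * (φ D - φ (D + 1)) +
      ∑ b ∈ Finset.range D, (φ (b + 2) - 2 * φ (b + 1) + φ b) * ∑ i, deficit (b + 1) (y i))]
  · have hi : ∀ b ∈ Finset.range D, Integrable (fun x : Fin n → ℕ → Fin k =>
        (φ (b + 2) - 2 * φ (b + 1) + φ b) *
          ∑ i, deficit (b + 1) (finalLoad (D + 1) n (fun j => Φ (x j)) i)) (hashLaw k n) :=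
      fun b _ => integrable_loadMean (D + 1) n hΦ fun y =>
        (φ (b + 2) - 2 * φ (b + 1) + φ b) * ∑ i, deficit (b + 1) (y i)
    unfold loadMean
    rw [integral_add (integrable_const _) (integrable_finsetSum _ hi), integral_finsetSum _ hi]
    simp_rw [integral_const_mul]
    simp
  · intro y hy
    rw [mem_loadBox] at hy
    have hs : ∑ i, (y i : ℝ) = n := by exact_mod_cast hy.2
    rw [Finset.sum_congr rfl fun i _ => eq_affine_add_sum_deficit φ D (hy.1 i),
      Finset.sum_add_distrib, Finset.sum_add_distrib, ← Finset.sum_mul, Finset.sum_sub_distrib,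
      hs, Finset.sum_comm]
    simp_rw [Finset.mul_sum]
    simp [mul_add]

/-- Sums of convex functions of the loads are smaller in the mean under uniform rehashing than
under clockwise probing. -/
theorem loadMean_sum_le {n C : ℕ} (hn : n ≤ k * C) {φ : ℕ → ℝ}
    (hφ : ∀ b, b + 2 ≤ C → 0 ≤ φ (b + 2) - 2 * φ (b + 1) + φ b) :
    loadMean C (id : (ℕ → Fin k) → ℕ → Fin k) n (fun y => ∑ i, φ (y i)) ≤
      loadMean C (clockwise (k := k)) n fun y => ∑ i, φ (y i) := by
  have hR := isLoadChain_uniform (k := k) C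
  have hB := isLoadChain_clockwise (k := k) C
  rcases hn.eq_or_lt with h | h
  · rw [loadMean_eq_of_full hR h, loadMean_eq_of_full hB h]
  · obtain ⟨D, rfl⟩ : ∃ D, C = D + 1 := Nat.exists_eq_succ_of_ne_zero (by rintro rfl; simp at h)
    rw [loadMean_eq_sum_deficit measurable_id hR hn,
      loadMean_eq_sum_deficit measurable_clockwise hB hn]
    refine add_le_add_right (Finset.sum_le_sum fun b hb => ?_) _
    rw [Finset.mem_range] at hb
    exact mul_le_mul_of_nonneg_left
      (deficit_uniform_le_gap isGap_ringGap hR hB (by rwa [Fintype.card_fin]) (by omega))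
      (hφ b (by omega))

/-- Convex functions of a load are smaller in the mean under uniform rehashing. -/
theorem integral_loadRJCH_le {n C : ℕ} (hn : n ≤ k * C) {φ : ℕ → ℝ}
    (hφ : ∀ b, b + 2 ≤ C → 0 ≤ φ (b + 2) - 2 * φ (b + 1) + φ b) (i : Fin k) :
    ∫ h, φ (loadRJCH C n h i) ∂hashLaw k n ≤ ∫ h, φ (loadCHBL C n h i) ∂hashLaw k n := by
  have e1 := loadMean_apply_eq_div C n measurable_id (fun _ _ => rfl) φ i
  have e2 := loadMean_apply_eq_div C n measurable_clockwise
    (fun c p => funext fun t => add_right_comm (p 0) c (Fin.ofNat k t)) φ i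
  have h := div_le_div_of_nonneg_right (loadMean_sum_le hn hφ) (Nat.cast_nonneg (α := ℝ) k)
  rw [← e1, ← e2] at h
  exact h

/-- Both `x` and `-x` have vanishing second differences. Equality of the means reduces the variance
comparison to that of the second moments. -/
theorem integral_loadRJCH_eq {n C : ℕ} (hn : n ≤ k * C) (i : Fin k) :
    ∫ h, (loadRJCH C n h i : ℝ) ∂hashLaw k n = ∫ h, (loadCHBL C n h i : ℝ) ∂hashLaw k n := by
  refine le_antisymm (integral_loadRJCH_le hn (φ := fun x => (x : ℝ)) (fun b _ => ?_) i) ?_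
  · push_cast
    linarith
  · have h := integral_loadRJCH_le hn (φ := fun x => -(x : ℝ)) (fun b _ => by
      push_cast; linarith) i
    rw [integral_neg, integral_neg] at h
    linarith

theorem second_difference_rpow_nonneg {d : ℝ} (hd : 1 ≤ d) (b : ℕ) :
    0 ≤ ((b + 2 : ℕ) : ℝ) ^ d - 2 * ((b + 1 : ℕ) : ℝ) ^ d + (b : ℝ) ^ d := by
  have h := (convexOn_rpow hd).2 (Set.mem_Ici.2 (Nat.cast_nonneg (α := ℝ) b))
    (Set.mem_Ici.2 (Nat.cast_nonneg (α := ℝ) (b + 2))) (by norm_num : (0 : ℝ) ≤ 1 / 2)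
    (by norm_num : (0 : ℝ) ≤ 1 / 2) (by norm_num)
  have e : (1 / 2 : ℝ) • (b : ℝ) + (1 / 2 : ℝ) • ((b + 2 : ℕ) : ℝ) = ((b + 1 : ℕ) : ℝ) := by
    simp only [smul_eq_mul]
    push_cast
    ring
  rw [e] at h
  simp only [smul_eq_mul] at h
  linarith

/-- The indicator of `C` is convex on `{0, …, C}`, because it is nonzero only at the right endpoint.
-/
theorem integral_numFull_le {n C : ℕ} (hn : n ≤ k * C) :
    ∫ h, (numFull C (loadRJCH C n h) : ℝ) ∂hashLaw k n ≤
      ∫ h, (numFull C (loadCHBL C n h) : ℝ) ∂hashLaw k n := by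
  simp_rw [numFull_eq_sum]
  refine loadMean_sum_le hn (φ := topInd C) fun b hb => ?_
  have : topInd C (b + 1) = 0 := if_neg (by omega)
  rw [this]
  unfold topInd
  split_ifs <;> norm_num

end compare

theorem theorem1 (k n C : ℕ) [NeZero k] (hn : n ≤ k * C) :
    (∀ (d : ℝ), 1 ≤ d → ∀ i : Fin k,
      (∫ h, (loadRJCH C n h i : ℝ) ^ d ∂(hashLaw k n))
        ≤ ∫ h, (loadCHBL C n h i : ℝ) ^ d ∂(hashLaw k n)) ∧
    (∀ i : Fin k,
      (∫ h, (loadRJCH C n h i : ℝ) ^ 2 ∂(hashLaw k n))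
        ≤ ∫ h, (loadCHBL C n h i : ℝ) ^ 2 ∂(hashLaw k n)) ∧
    (∀ i : Fin k,
      variance (fun h => (loadRJCH C n h i : ℝ)) (hashLaw k n)
        ≤ variance (fun h => (loadCHBL C n h i : ℝ)) (hashLaw k n)) ∧
    (∫ h, (numFull C (loadRJCH C n h) : ℝ) ∂(hashLaw k n))
      ≤ ∫ h, (numFull C (loadCHBL C n h) : ℝ) ∂(hashLaw k n) := by
  have hsq : ∀ i : Fin k, (∫ h, (loadRJCH C n h i : ℝ) ^ 2 ∂(hashLaw k n))
      ≤ ∫ h, (loadCHBL C n h i : ℝ) ^ 2 ∂(hashLaw k n) := fun i =>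
    integral_loadRJCH_le hn (φ := fun x => (x : ℝ) ^ 2) (fun b _ => by push_cast; nlinarith) i
  have hmem : ∀ (X : (Fin n → ℕ → Fin k) → Fin k → ℕ), Measurable X → (∀ h i, X h i ≤ C) →
      ∀ i, MemLp (fun h => (X h i : ℝ)) 2 (hashLaw k n) := fun X hX hC i => by
    refine MemLp.of_bound ((measurable_of_countable fun y : Fin k → ℕ => (y i : ℝ)).comp
      hX).aestronglyMeasurable C (Filter.Eventually.of_forall fun h => ?_)
    simpa using hC h i
  refine ⟨fun d hd i => integral_loadRJCH_le hn (φ := fun x => (x : ℝ) ^ d)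
    (fun b _ => second_difference_rpow_nonneg hd b) i, hsq, fun i => ?_, integral_numFull_le hn⟩
  rw [variance_eq_sub (hmem _ (measurable_loadRJCH C n) (fun h => finalLoad_le C n _) i),
    variance_eq_sub (hmem _ (measurable_loadCHBL C n) (fun h => finalLoad_le C n _) i),
    integral_loadRJCH_eq hn]
  exact sub_le_sub_right (hsq i) _
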